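/- Identify each ordinal with its set of predecessors; in particular $n=\{0,\dots,n-1\}$ for $n\in\mathbb N$. Let $\mathsf{Ord}$ be the category of ordinals and strictly increasing functions, and let $\mathsf{Nat}$ be its full subcategory of natural numbers. **Dilators.** A *pre-dilator* is a functor $D:\mathsf{Nat}\to\mathsf{Ord}$ with a natural transformation $\operatorname{supp}:D\Rightarrow[\cdot]^{<\omega}$ (finite subsets) such that, for every strictly increasing $f:m\to n$ and every $\sigma\in D(n)$, $\operatorname{supp}_n(\sigma)\subseteq\operatorname{rng}(f)$ implies $\sigma\in\operatorname{rng}(D(f))$. Its trace is $\operatorname{Tr}(D)=\{(\sigma,n)\mid \sigma\in D(n),\ \operatorname{supp}_n(\sigma)=n\}$. For an ordinal $\alpha$, let $\overline D(\alpha)$ be the set of expressions $(\sigma;\gamma_0,\dots,\gamma_{n-1};\alpha)_D$ with $(\sigma,n)\in\operatorname{Tr}(D)$ and $\gamma_0<\dots<\gamma_{n-1}<\alpha$, ordered by $$(\sigma;\gamma_0,\dots,\gamma_{m-1};\alpha)_D<(\tau;\delta_0,\dots,\delta_{n-1};\alpha)_D\iff D(|\iota_c|)(\sigma)<D(|\iota_d|)(\tau),$$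 where $c=\{\gamma_0,\dots,\gamma_{m-1}\}$, $d=\{\delta_0,\dots,\delta_{n-1}\}$, and $|\iota_c|:|c|\to|c\cup d|$, $|\iota_d|:|d|\to|c\cup d|$ are the strictly increasing maps between cardinalities that are induced by the inclusions into $c\cup d$. A *dilator* is a pre-dilator for which $\overline D(\alpha)$ is well-founded for every ordinal $\alpha$; then $D(\alpha)$ denotes the unique ordinal that admits an order isomorphism $\eta_\alpha:D(\alpha)\to\overline D(\alpha)$. A *normal dilator* is a dilator with a natural transformation $\mu$ from the inclusion $\mathsf{Nat}\hookrightarrow\mathsf{Ord}$ to $D:\mathsf{Nat}\to\mathsf{Ord}$ such that $\sigma<\mu_n(k)\Leftrightarrow\operatorname{supp}_n(\sigma)\subseteq k$ for all $k<n$ and $\sigma\in D(n)$. **The relation $\leq_1^D$.** Let $D$ be a normal dilator. Write $\gamma\simeq(\sigma;\gamma_0,\dots,\gamma_{n-1})_D$ if $\eta_\alpha(\gamma)=(\sigma;\gamma_0,\dots,\gamma_{n-1};\alpha)_D$ for some (equivalently, every) $\alpha$ with $\gamma<D(\alpha)$; every ordinal has exactly one such representation. By recursion on $\beta$, $\alpha\leq_1^D\beta$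 holds if and only if $\alpha\leq\beta$ and for all finite $X\subseteq\alpha$ and $Y\subseteq\beta\setminus\alpha$ there are a finite $\widetilde Y\subseteq\alpha$ and a bijection $f:X\cup Y\to X\cup\widetilde Y$ that fixes $X$ pointwise and preserves and reflects $\leq$, $\leq_1^D$ and all relations $\gamma\simeq(\sigma;\gamma_0,\dots,\gamma_{n-1})_D$ with $(\sigma,n)\in\operatorname{Tr}(D)$. **The classes $C_D(\gamma)$.** For $\gamma\geq D(0)$ write $\gamma\simeq(\sigma;\gamma_0,\dots,\gamma_n)_D$ and put $\gamma^*=\sup\{\gamma_i+1\mid i<n\}$; for $\delta\geq\gamma^*$ let $\gamma[\delta]$ be the ordinal with $\gamma[\delta]\simeq(\sigma;\gamma_0,\dots,\gamma_{n-1},\delta)_D$. Put $$C_D(\gamma)=\{\delta\in\mathsf{Ord}\mid\delta\geq\gamma^*\text{ and }\delta\leq_1^D\gamma[\delta]\}.$$ **Theorem.** Let $D$ be a normal dilator and let $\mathbb A$ be an admissible set (a transitive set such that $(\mathbb A,\in)$ is a model of Kripke–Platek set theory) that contains the set-sized functor $D:\mathsf{Nat}\to\mathsf{Ord}$ as an element.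 Let $\Omega=\mathsf{Ord}\cap\mathbb A$ be the height of $\mathbb A$. Then for every ordinal $\gamma\in D(\Omega+1)\setminus\Omega$, i.e. $\Omega\leq\gamma<D(\Omega+1)$, the set $C_D(\gamma)\cap\Omega$ is closed and unbounded in $\Omega$. -/

import Mathlib

universe u

/-! ### Pre-dilators -/

/-- A pre-dilator: a functor `D` from the category of natural numbers `n = {0, …, n-1}` (with
strictly increasing maps) to the category of ordinals (with strictly increasing maps), together
with a natural transformation `supp : D ⇒ [·]^{<ω}` that satisfies the support condition.
An ordinal `α` is identified with its set `Set.Iio α` of predecessors. -/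
structure PreDilator where
  /-- the values `D(n)` on objects -/
  obj : ℕ → Ordinal.{u}
  /-- the action `D(f) : D(m) → D(n)` on strictly increasing maps `f : m → n` -/
  map : ∀ {m n : ℕ}, (Fin m ↪o Fin n) → (Set.Iio (obj m) ↪o Set.Iio (obj n))
  map_id : ∀ (n : ℕ) (σ : Set.Iio (obj n)), map (RelEmbedding.refl (· ≤ ·)) σ = σ
  map_comp : ∀ {k m n : ℕ} (f : Fin k ↪o Fin m) (g : Fin m ↪o Fin n) (σ : Set.Iio (obj k)),
    map (f.trans g) σ = map g (map f σ)
  /-- the supports `supp_n : D(n) → [n]^{<ω}` -/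
  supp : ∀ n : ℕ, Set.Iio (obj n) → Finset (Fin n)
  supp_map : ∀ {m n : ℕ} (f : Fin m ↪o Fin n) (σ : Set.Iio (obj m)),
    supp n (map f σ) = (supp m σ).map f.toEmbedding
  support_condition : ∀ {m n : ℕ} (f : Fin m ↪o Fin n) (σ : Set.Iio (obj n)),
    (supp n σ : Set (Fin n)) ⊆ Set.range f → σ ∈ Set.range (map f)

/-- For an injective enumeration `g` of ordinals `g 0 < … < g (n-1)` that all lie in the finite
set `b`, this is the strictly increasing map `n → |b|` whose composition with the increasing
enumeration of `b` is `g`. When `c` is the range of `g`, it is the map `|ι| : |c| → |b|` that is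
induced by the inclusion `ι : c ↪ b`. -/
noncomputable def positionEmb {n : ℕ} (g : Fin n → Ordinal.{u}) (hg : StrictMono g)
    (b : Finset Ordinal.{u}) (hb : ∀ i, g i ∈ b) : Fin n ↪o Fin b.card :=
  OrderEmbedding.ofStrictMono (fun i => (b.orderIsoOfFin rfl).symm ⟨g i, hb i⟩)
    (fun _ _ hij => (b.orderIsoOfFin rfl).symm.strictMono (Subtype.mk_lt_mk.2 (hg hij)))

theorem positionEmb_eq {n : ℕ} (g : Fin n → Ordinal.{u}) (hg : StrictMono g)
    (b : Finset Ordinal.{u}) (hb : ∀ i, g i ∈ b) (i : Fin n) :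
    b.orderEmbOfFin rfl (positionEmb g hg b hb i) = g i :=
  congrArg Subtype.val ((b.orderIsoOfFin rfl).apply_symm_apply ⟨g i, hb i⟩)

namespace PreDilator

variable (D : PreDilator.{u})

/-- The trace `Tr(D)`: pairs `(n, σ)` with `σ ∈ D(n)` and `supp_n(σ) = n`. -/
def Trace : Type (u + 1) :=
  {s : Σ n : ℕ, Set.Iio (D.obj n) // D.supp s.1 s.2 = Finset.univ}

/-- The expressions `(σ; γ₀, …, γ_{n-1})_D` with `(σ, n) ∈ Tr(D)` and ordinals
`γ₀ < … < γ_{n-1}`. -/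
@[ext] structure Term where
  /-- the constructor symbol `(σ, n)` -/
  sym : D.Trace
  /-- the arguments `γ₀, …, γ_{n-1}` -/
  args : Fin sym.1.1 → Ordinal.{u}
  strictMono : StrictMono args

variable {D}

namespace Term

/-- The finite set `{γ₀, …, γ_{n-1}}` of arguments. -/
noncomputable def argSet (t : D.Term) : Finset Ordinal.{u} := Finset.univ.image t.args

theorem args_mem (t : D.Term) (i : Fin t.sym.1.1) : t.args i ∈ t.argSet :=
  Finset.mem_image_of_mem _ (Finset.mem_univ i)

/-- The element `D(|ι_c^b|)(σ)` of `D(|b|)`, where `c ⊆ b` is the set of arguments. -/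
noncomputable def lift (t : D.Term) (b : Finset Ordinal.{u}) (hb : t.argSet ⊆ b) :
    Set.Iio (D.obj b.card) :=
  D.map (positionEmb t.args t.strictMono b (fun i => hb (t.args_mem i))) t.sym.1.2

/-- The order between expressions: with `c` and `d` the respective sets of arguments, one has
`(σ; …) < (τ; …)` if and only if `D(|ι_c^{c∪d}|)(σ) < D(|ι_d^{c∪d}|)(τ)` in `D(|c ∪ d|)`. -/
protected def Lt (s t : D.Term) : Prop :=
  s.lift (s.argSet ∪ t.argSet) Finset.subset_union_left <
    t.lift (s.argSet ∪ t.argSet) Finset.subset_union_right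

end Term

variable (D)

/-- The set `D̄(α)` of all expressions `(σ; γ₀, …, γ_{n-1}; α)_D` with `γ_{n-1} < α`. -/
def Bar (α : Ordinal.{u}) : Type (u + 1) := {t : D.Term // ∀ i, t.args i < α}

/-- The order of `D̄(α)`. -/
def BarLt (α : Ordinal.{u}) (s t : D.Bar α) : Prop := s.1.Lt t.1

end PreDilator

/-- A dilator is a pre-dilator such that `D̄(α)` is well-founded for every ordinal `α`. -/
structure Dilator extends PreDilator.{u} where
  wellFounded : ∀ α : Ordinal.{u}, WellFounded (toPreDilator.BarLt α)

/-- A normal dilator is a dilator `D` together with a natural transformation `μ` from the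
inclusion of the natural numbers into the ordinals to `D` that satisfies the normality
condition. -/
structure NormalDilator extends Dilator.{u} where
  /-- the components `μ_n : n → D(n)` -/
  mu : ∀ n : ℕ, Fin n ↪o Set.Iio (obj n)
  map_mu : ∀ {m n : ℕ} (f : Fin m ↪o Fin n) (k : Fin m), map f (mu m k) = mu n (f k)
  normality_condition : ∀ (n : ℕ) (k : Fin n) (σ : Set.Iio (obj n)),
    σ < mu n k ↔ ∀ i ∈ supp n σ, i < k

/-! ### The expressions below `α` are well-ordered -/

namespace PreDilator

variable {D : PreDilator.{u}}

theorem Term.lift_trans (t : D.Term) {b b' : Finset Ordinal.{u}} (hb : t.argSet ⊆ b)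
    (hbb' : b ⊆ b') :
    t.lift b' (hb.trans hbb') =
      D.map (positionEmb (b.orderEmbOfFin rfl) (b.orderEmbOfFin rfl).strictMono b'
        (fun i => hbb' (b.orderEmbOfFin_mem rfl i))) (t.lift b hb) := by
  unfold Term.lift
  rw [← D.map_comp]
  congr 2
  refine DFunLike.ext _ _ fun i => (b'.orderEmbOfFin rfl).injective ?_
  rw [positionEmb_eq, RelEmbedding.trans_apply, positionEmb_eq (b.orderEmbOfFin rfl),
    positionEmb_eq]

theorem Term.lt_iff (s t : D.Term) (b : Finset Ordinal.{u}) (hs : s.argSet ⊆ b)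
    (ht : t.argSet ⊆ b) : s.Lt t ↔ s.lift b hs < t.lift b ht := by
  have h : s.argSet ∪ t.argSet ⊆ b := Finset.union_subset hs ht
  rw [Term.Lt, s.lift_trans Finset.subset_union_left h, t.lift_trans Finset.subset_union_right h]
  exact (D.map _).lt_iff_lt.symm

theorem Term.lift_injective (s t : D.Term) (b : Finset Ordinal.{u}) (hs : s.argSet ⊆ b)
    (ht : t.argSet ⊆ b) (h : s.lift b hs = t.lift b ht) : s = t := by
  have hsupp := congrArg (D.supp _) h
  unfold Term.lift at hsupp h
  rw [D.supp_map, D.supp_map, s.sym.2, t.sym.2] at hsupp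
  have hrange : Set.range s.args = Set.range t.args := by
    have := congrArg (fun x : Finset (Fin b.card) =>
      b.orderEmbOfFin rfl '' (x : Set (Fin b.card))) hsupp
    simp only [Finset.coe_map, Finset.coe_univ, Set.image_univ, ← Set.range_comp] at this
    convert this using 2
    · ext i; exact (positionEmb_eq _ _ _ _ i).symm
    · ext i; exact (positionEmb_eq _ _ _ _ i).symm
  obtain ⟨⟨⟨m, σ⟩, h1⟩, g, hg⟩ := s
  obtain ⟨⟨⟨n, τ⟩, h2⟩, k, hk⟩ := t
  obtain rfl : m = n := by
    have := congrArg Finset.card hsupp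
    simpa using this
  obtain rfl : g = k := (StrictMono.range_inj hg hk).1 hrange
  obtain rfl : σ = τ := (D.map _).injective h
  rfl

instance Term.isStrictTotalOrder : IsStrictTotalOrder D.Term Term.Lt where
  irrefl s := by
    rw [Term.lt_iff s s s.argSet subset_rfl subset_rfl]
    exact lt_irrefl _
  trans r s t h1 h2 := by
    have hr : r.argSet ⊆ r.argSet ∪ s.argSet ∪ t.argSet := by grind
    have hs : s.argSet ⊆ r.argSet ∪ s.argSet ∪ t.argSet := by grind
    have ht : t.argSet ⊆ r.argSet ∪ s.argSet ∪ t.argSet := by grind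
    rw [Term.lt_iff _ _ _ hr hs] at h1
    rw [Term.lt_iff _ _ _ hs ht] at h2
    rw [Term.lt_iff _ _ _ hr ht]
    exact h1.trans h2
  trichotomous s t h1 h2 := by
    have hs : s.argSet ⊆ s.argSet ∪ t.argSet := Finset.subset_union_left
    have ht : t.argSet ⊆ s.argSet ∪ t.argSet := Finset.subset_union_right
    rw [Term.lt_iff _ _ _ hs ht] at h1
    rw [Term.lt_iff _ _ _ ht hs] at h2
    exact Term.lift_injective s t _ hs ht (le_antisymm (not_lt.1 h2) (not_lt.1 h1))

instance (α : Ordinal.{u}) : Small.{u} (D.Bar α) := by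
  let e : D.Bar α → Σ n : ℕ, Set.Iio (D.obj n) × (Fin n → Set.Iio α) :=
    fun t => ⟨t.1.sym.1.1, t.1.sym.1.2, fun i => ⟨t.1.args i, t.2 i⟩⟩
  refine small_of_injective (f := e) ?_
  rintro ⟨⟨⟨⟨m, σ⟩, h1⟩, g, hg⟩, hs⟩ ⟨⟨⟨⟨n, τ⟩, h2⟩, k, hk⟩, ht⟩ h
  simp only [e, Sigma.mk.injEq] at h
  obtain ⟨rfl, h⟩ := h
  simp only [heq_eq_eq, Prod.mk.injEq] at h
  obtain ⟨rfl, h⟩ := h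
  obtain rfl : g = k := by
    funext i
    exact congrArg Subtype.val (congrFun h i)
  rfl

end PreDilator

/-! ### The values `D(α)`, representations, and the relation `≤₁ᴰ` -/

namespace Dilator

variable (D : Dilator.{u})

instance isWellOrder (α : Ordinal.{u}) : IsWellOrder (D.Bar α) (D.BarLt α) where
  wf := D.wellFounded α
  trichotomous s t h1 h2 :=
    Subtype.ext (PreDilator.Term.isStrictTotalOrder.trichotomous s.1 t.1 h1 h2)

/-- `D̄(α)` is isomorphic to an ordinal. -/
theorem exists_value (α : Ordinal.{u}) :
    ∃ β : Ordinal.{u},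
      Nonempty ((fun x y : Set.Iio β => x < y) ≃r D.BarLt α) := by
  let e := equivShrink.{u} (D.Bar α)
  let r : Shrink.{u} (D.Bar α) → Shrink.{u} (D.Bar α) → Prop := e.symm ⁻¹'o D.BarLt α
  let f : r ≃r D.BarLt α := RelIso.preimage e.symm (D.BarLt α)
  have : IsWellOrder (Shrink.{u} (D.Bar α)) r := f.toRelEmbedding.isWellOrder
  exact ⟨Ordinal.type r, ⟨(Ordinal.enum r).trans f⟩⟩

/-- The value `D(α)`: the (unique) ordinal that is isomorphic to `D̄(α)`. -/
noncomputable def value (α : Ordinal.{u}) : Ordinal.{u} := (D.exists_value α).choose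

/-- The (unique) order isomorphism `η_α : D(α) → D̄(α)`. -/
noncomputable def eta (α : Ordinal.{u}) :
    (fun x y : Set.Iio (D.value α) => x < y) ≃r D.BarLt α :=
  (D.exists_value α).choose_spec.some

/-- The relation `γ ≃ (σ; γ₀, …, γ_{n-1})_D`, for `s = (σ, n)` in the trace and arbitrary
`g = (γ₀, …, γ_{n-1})`: we have `γ₀ < … < γ_{n-1}` and, for some ordinal `α` with `γ < D(α)`,
`η_α(γ) = (σ; γ₀, …, γ_{n-1}; α)_D`. (For normal `D`, this does not depend on `α`.) -/
def Rep (γ : Ordinal.{u}) (s : D.Trace) (g : Fin s.1.1 → Ordinal.{u}) : Prop :=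
  ∃ (hg : StrictMono g) (α : Ordinal.{u}) (hγ : γ < D.value α),
    (D.eta α ⟨γ, hγ⟩).1 = ⟨s, g, hg⟩

/-- `f` is an isomorphism between the substructures with universes `Z` and `W`, in the language
with the symbols `≤`, `R` and `γ ≃ (σ; γ₀, …, γ_{n-1})_D` for all `(σ, n) ∈ Tr(D)`. -/
structure IsIso (R : Ordinal.{u} → Ordinal.{u} → Prop) (f : Ordinal.{u} → Ordinal.{u})
    (Z W : Finset Ordinal.{u}) : Prop where
  bijOn : Set.BijOn f Z W
  le_iff : ∀ γ ∈ Z, ∀ γ' ∈ Z, (γ ≤ γ' ↔ f γ ≤ f γ')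
  rel_iff : ∀ γ ∈ Z, ∀ γ' ∈ Z, (R γ γ' ↔ R (f γ) (f γ'))
  rep_iff : ∀ γ ∈ Z, ∀ (s : D.Trace) (g : Fin s.1.1 → Ordinal.{u}), (∀ i, g i ∈ Z) →
    (D.Rep γ s g ↔ D.Rep (f γ) s (f ∘ g))

/-- One step in the recursive definition of `≤₁ᴰ`: assuming that `γ ≤₁ᴰ γ'` is given by `R γ γ'`
for all `γ' < β`, this expresses `α ≤₁ᴰ β`. -/
def LeOneStep (R : Ordinal.{u} → Ordinal.{u} → Prop) (α β : Ordinal.{u}) : Prop :=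
  α ≤ β ∧ ∀ X Y : Finset Ordinal.{u}, (∀ x ∈ X, x < α) → (∀ y ∈ Y, α ≤ y ∧ y < β) →
    ∃ (Y' : Finset Ordinal.{u}) (f : Ordinal.{u} → Ordinal.{u}), (∀ y ∈ Y', y < α) ∧
      D.IsIso R f (X ∪ Y) (X ∪ Y') ∧ ∀ x ∈ X, f x = x

/-- The relation `α ≤₁ᴰ β`, by recursion on `β`. See `Dilator.leOne_iff` for the recursive
clause. -/
def LeOne (α β : Ordinal.{u}) : Prop :=
  (Ordinal.lt_wf.fix (C := fun _ => Ordinal.{u} → Prop)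
    (fun β ih α => D.LeOneStep (fun γ γ' => ∃ h : γ' < β, ih γ' h γ) α β)) β α

/-- The defining recursive clause of `≤₁ᴰ`: we have `α ≤₁ᴰ β` if and only if `α ≤ β` and for all
finite `X ⊆ α` and `Y ⊆ β \ α` there are a finite `Y' ⊆ α` and an isomorphism
`f : X ∪ Y → X ∪ Y'` that fixes `X`. -/
theorem leOne_iff (α β : Ordinal.{u}) : D.LeOne α β ↔ D.LeOneStep D.LeOne α β := by
  have h1 : D.LeOne α β ↔ D.LeOneStep (fun γ γ' => γ' < β ∧ D.LeOne γ γ') α β := by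
    unfold LeOne
    rw [WellFounded.fix_eq]
    simp only [exists_prop]
  rw [h1]
  unfold LeOneStep
  refine and_congr_right fun hαβ => forall₄_congr fun X Y hX hY => ?_
  refine exists_congr fun Y' => exists_congr fun f => and_congr_right fun hY' => ?_
  refine and_congr_left fun _ => ?_
  have hZ : ∀ γ ∈ X ∪ Y, γ < β := fun γ hγ => (Finset.mem_union.1 hγ).elim
    (fun h => (hX γ h).trans_le hαβ) (fun h => (hY γ h).2)
  have hW : ∀ γ ∈ X ∪ Y', γ < β := fun γ hγ => (Finset.mem_union.1 hγ).elim
    (fun h => (hX γ h).trans_le hαβ) (fun h => (hY' γ h).trans_le hαβ)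
  constructor
  · rintro ⟨a, b, c, d⟩
    refine ⟨a, b, fun γ hγ γ' hγ' => ?_, d⟩
    have := c γ hγ γ' hγ'
    simpa [hZ γ' hγ', hW _ (a.mapsTo hγ')] using this
  · rintro ⟨a, b, c, d⟩
    refine ⟨a, b, fun γ hγ γ' hγ' => ?_, d⟩
    have := c γ hγ γ' hγ'
    simpa [hZ γ' hγ', hW _ (a.mapsTo hγ')] using this

end Dilator

/-! ### The classes `C_D(γ)` -/

namespace NormalDilator

variable (D : NormalDilator.{u})

/-- For an ordinal `γ ≥ D(0)` with representation `γ ≃ (σ; γ₀, …, γₙ)_D`, this is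
`γ* = sup {γᵢ + 1 | i < n}` (the last argument `γₙ` is disregarded). -/
noncomputable def star (γ : Ordinal.{u}) : Ordinal.{u} :=
  sSup {ξ | ∃ (s : D.Trace) (g : Fin s.1.1 → Ordinal.{u}), D.Rep γ s g ∧
    ∃ i : Fin s.1.1, (i : ℕ) + 1 < s.1.1 ∧ ξ = g i + 1}

/-- `ξ` is the ordinal `γ[δ]`: for `γ ≃ (σ; γ₀, …, γₙ)_D` we have
`ξ ≃ (σ; γ₀, …, γ_{n-1}, δ)_D`. -/
def IsSubst (γ δ ξ : Ordinal.{u}) : Prop :=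
  ∃ (s : D.Trace) (g : Fin s.1.1 → Ordinal.{u}), D.Rep γ s g ∧ 0 < s.1.1 ∧
    D.Rep ξ s (fun i => if (i : ℕ) + 1 = s.1.1 then δ else g i)

/-- The ordinal `γ[δ]` (for `γ ≥ D(0)` and `δ ≥ γ*`): the unique `ξ` with `D.IsSubst γ δ ξ`. -/
noncomputable def subst (γ δ : Ordinal.{u}) : Ordinal.{u} := sInf {ξ | D.IsSubst γ δ ξ}

/-- The class `C_D(γ) = {δ ≥ γ* | δ ≤₁ᴰ γ[δ]}` (for `γ ≥ D(0)`). -/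
def clubClass (γ : Ordinal.{u}) : Set Ordinal.{u} :=
  {δ | D.star γ ≤ δ ∧ D.LeOne δ (D.subst γ δ)}

end NormalDilator

/-! ### Pre-dilators as sets -/

/-- A map `f : α → β` between ordinals as a set: the triple that consists of domain, codomain and
graph, with ordinals turned into von Neumann ordinals. -/
noncomputable def codeMorphism {α β : Ordinal.{u}} (f : Set.Iio α → Set.Iio β) : ZFSet.{u} :=
  ZFSet.pair (ZFSet.pair α.toZFSet β.toZFSet)
    (ZFSet.range fun x : Set.Iio α => ZFSet.pair x.1.toZFSet (f x).1.toZFSet)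

/-- A map `f : m → n` between natural numbers as a set, as in `codeMorphism`. -/
noncomputable def codeNatMorphism {m n : ℕ} (f : Fin m → Fin n) : ZFSet.{u} :=
  ZFSet.pair (ZFSet.pair (Ordinal.toZFSet m) (Ordinal.toZFSet n))
    (ZFSet.range fun i : Fin m =>
      ZFSet.pair (Ordinal.toZFSet (i : ℕ)) (Ordinal.toZFSet (f i : ℕ)))

/-- The functor `D` from natural numbers to ordinals as a set: the pair that consists of the
function `n ↦ D(n)` on objects and the function `f ↦ D(f)` on morphisms (both given as sets of
ordered pairs). -/
noncomputable def PreDilator.code (D : PreDilator.{u}) : ZFSet.{u} :=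
  ZFSet.pair
    (ZFSet.range fun n : ℕ => ZFSet.pair (Ordinal.toZFSet n) (D.obj n).toZFSet)
    (ZFSet.range fun p : (Σ m n : ℕ, Fin m ↪o Fin n) =>
      ZFSet.pair (codeNatMorphism p.2.2) (codeMorphism (D.map p.2.2)))

/-! ### Admissible sets -/

/-- The `Δ₀`-formulas in the language of set theory, with de Bruijn indices: all quantifiers are
bounded. In `ball j φ` (read: "for all `x ∈ v_j` we have `φ`"), the variable `0` of `φ` is the
bound one, and the variable `k + 1` of `φ` refers to the variable `k` of `ball j φ`. -/
inductive DeltaZero : Type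
  | mem (i j : ℕ) : DeltaZero
  | eq (i j : ℕ) : DeltaZero
  | neg (φ : DeltaZero) : DeltaZero
  | and (φ ψ : DeltaZero) : DeltaZero
  | ball (j : ℕ) (φ : DeltaZero) : DeltaZero

/-- The variable assignment with values `x, v 0, v 1, …`. -/
def consAssign {M : Type*} (x : M) (v : ℕ → M) : ℕ → M
  | 0 => x
  | k + 1 => v k

/-- Satisfaction of `Δ₀`-formulas in the structure `(A, ∈)`. -/
def DeltaZero.Realize (A : ZFSet.{u}) : DeltaZero → (ℕ → {x : ZFSet.{u} // x ∈ A}) → Prop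
  | mem i j, v => (v i).1 ∈ (v j).1
  | eq i j, v => v i = v j
  | neg φ, v => ¬ φ.Realize A v
  | and φ ψ, v => φ.Realize A v ∧ ψ.Realize A v
  | ball j φ, v => ∀ x : {x : ZFSet.{u} // x ∈ A}, x.1 ∈ (v j).1 → φ.Realize A (consAssign x v)

/-- Admissible sets: transitive (non-empty) sets `A` such that `(A, ∈)` is a model of
Kripke-Platek set theory. The axioms of extensionality and foundation (for arbitrary formulas)
hold in any transitive set. The remaining axioms are pairing, union, `Δ₀`-separation and
`Δ₀`-collection. -/
structure IsAdmissible (A : ZFSet.{u}) : Prop where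
  nonempty : ∃ x, x ∈ A
  transitive : A.IsTransitive
  pairing : ∀ x ∈ A, ∀ y ∈ A, ∃ z ∈ A, x ∈ z ∧ y ∈ z
  union : ∀ x ∈ A, ∃ z ∈ A, ∀ y ∈ x, ∀ w ∈ y, w ∈ z
  separation : ∀ (φ : DeltaZero) (v : ℕ → {x : ZFSet.{u} // x ∈ A}), ∀ a ∈ A,
    ∃ b ∈ A, ∀ x : {x : ZFSet.{u} // x ∈ A},
      x.1 ∈ b ↔ x.1 ∈ a ∧ φ.Realize A (consAssign x v)
  collection : ∀ (φ : DeltaZero) (v : ℕ → {x : ZFSet.{u} // x ∈ A}), ∀ a ∈ A,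
    (∀ x : {x : ZFSet.{u} // x ∈ A}, x.1 ∈ a →
      ∃ y : {x : ZFSet.{u} // x ∈ A}, φ.Realize A (consAssign y (consAssign x v))) →
    ∃ b ∈ A, ∀ x : {x : ZFSet.{u} // x ∈ A}, x.1 ∈ a →
      ∃ y : {x : ZFSet.{u} // x ∈ A}, y.1 ∈ b ∧ φ.Realize A (consAssign y (consAssign x v))

/-!
The theorem is proved by replacing ordinals with terms and the relation `≤₁ᴰ` with a recursive
condition on terms that an admissible set can evaluate.

Since `D` is normal, every ordinal is denoted by exactly one term (`NormalDilator.ord`), and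
`α ↦ D(α)` is a normal function `NormalDilator.muOrd` such that the terms with arguments below `α`
denote precisely the ordinals below `D(α)`. A term with last argument `δ` denotes an ordinal `γ` in
the interval from `D(δ)` to `D(δ + 1)`, and the ordinal `γ[δ']` is denoted by the term with last
argument `δ'` instead (`PreDilator.Term.setTop`). A term with last argument `δ` that denotes `γ` is
called good when `δ` is a nonzero fixed point of `D` with `δ ≤₁ᴰ γ`.

The combinatorial core is `NormalDilator.good_iff`. It says that a term `t` with last argument `δ`
is good precisely if `δ` is a nonzero fixed point and for each term `s < t` with last argument `δ`
there are arbitrarily large `δ' < δ` such that `s[δ']` is good. For the converse direction, a finite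
set of ordinals between `δ` and `γ` is given by finitely many terms with bounded parameters. Only
terms with last argument `δ` matter, and replacing `δ` by a sufficiently large `δ' < δ` yields a
finite isomorphism (`NormalDilator.exists_iso_of_setTop`): the relation `≤₁ᴰ` between the ordinals
in question is determined by goodness, because `α ≤₁ᴰ β` with `α < β` forces `D(α) = α`. Closedness
of `C_D(γ)` follows, as the condition passes to limits (`NormalDilator.mem_clubClass_of_forall_lt`).

For unboundedness, goodness has to be seen as a `Δ`-property inside the admissible set. Here,
`Admissible.IsSigma` is a semantic version of the `Σ`-formulas with parameters: predicates are
classified on contexts, which represent lists of variables for elements of `A`, and `Σ`-functions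
(`Admissible.IsFun`, `Admissible.AFun`) may be substituted. The axioms of Kripke-Platek set theory
yield the principles of `Σ`-collection, `Σ`-replacement and `Σ`-recursion
(`Admissible.IsFun.recursion`). Terms with arguments below the height `Ω` are coded by elements of
`A`, their order is `Δ` since comparison only needs finite embeddings and the values of `D` on them,
and `Σ`-recursion shows that the ordinals they denote lie below `Ω`. Hence `D(Ω) = Ω`
(`Admissible.muOrd_height`), so that the ordinals `γ` from the theorem are those that are denoted by
terms with last argument `Ω`. By `NormalDilator.good_iff` and `Σ`-recursion on the arguments,
goodness of terms is `Δ` (`Admissible.IsDelta.good`).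

Now let `t` have last argument `Ω`. By induction on `t`, there are arbitrarily large `δ < Ω` such
that `t[δ]` is good (`Admissible.exists_good_setTop`). Indeed, for `η < Ω` and each `s < t[η]` with
last argument `η`, the induction hypothesis for `s[Ω] < t` provides `δ' > η` such that `s[δ']` is
good. Collection bounds these `δ'` for all `s` at once. Iterating the resulting function `ω` times
inside `A`, one reaches a limit `δ < Ω` that satisfies the condition from `NormalDilator.good_iff`.
-/

/-! ### Comparison of terms -/

namespace PreDilator

variable {D : PreDilator.{u}}

namespace Term

theorem positionEmb_lt_iff {m n : ℕ} {a : Fin m → Ordinal.{u}} {a' : Fin n → Ordinal.{u}}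
    (ha : StrictMono a) (ha' : StrictMono a') (b : Finset Ordinal.{u}) (hb : ∀ i, a i ∈ b)
    (hb' : ∀ i, a' i ∈ b) (i : Fin m) (j : Fin n) :
    positionEmb a ha b hb i < positionEmb a' ha' b hb' j ↔ a i < a' j := by
  rw [← (b.orderEmbOfFin rfl).lt_iff_lt, positionEmb_eq, positionEmb_eq]

/-- The union of the two argument sets may be replaced by any finite linear order into which the
two argument sequences are mapped compatibly. -/
theorem lt_iff_map_lt (s t : D.Term) {k : ℕ} (f : Fin s.sym.1.1 ↪o Fin k)
    (g : Fin t.sym.1.1 ↪o Fin k) (h1 : ∀ i j, s.args i < t.args j ↔ f i < g j)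
    (h2 : ∀ i j, t.args j < s.args i ↔ g j < f i) :
    s.Lt t ↔ D.map f s.sym.1.2 < D.map g t.sym.1.2 := by
  set b := s.argSet ∪ t.argSet with hb
  have hs : ∀ i, s.args i ∈ b := fun i => Finset.mem_union_left _ (s.args_mem i)
  have ht : ∀ i, t.args i ∈ b := fun i => Finset.mem_union_right _ (t.args_mem i)
  set p := positionEmb s.args s.strictMono b hs with hp
  set q := positionEmb t.args t.strictMono b ht with hq
  have hcover : ∀ x : Fin b.card, (∃ i, p i = x) ∨ ∃ j, q j = x := by
    intro x
    have hx := Finset.mem_union.1 (b.orderEmbOfFin_mem rfl x)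
    simp only [argSet, Finset.mem_image, Finset.mem_univ, true_and] at hx
    refine hx.imp ?_ ?_ <;> rintro ⟨i, hi⟩ <;> refine ⟨i, (b.orderEmbOfFin rfl).injective ?_⟩
    · rw [hp, positionEmb_eq, hi]
    · rw [hq, positionEmb_eq, hi]
  have hpq : ∀ i j, p i < q j ↔ f i < g j := fun i j => by
    rw [hp, hq, positionEmb_lt_iff, h1]
  have hqp : ∀ i j, q j < p i ↔ g j < f i := fun i j => by
    rw [hp, hq, positionEmb_lt_iff, h2]
  have heq : ∀ i j, p i = q j ↔ f i = g j := fun i j => by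
    have := hpq i j; have := hqp i j; grind
  have hr : ∀ x : Fin b.card, ∃ z : Fin k, (∀ i, p i = x → f i = z) ∧ ∀ j, q j = x → g j = z := by
    intro x
    rcases hcover x with ⟨i, rfl⟩ | ⟨j, rfl⟩
    · exact ⟨f i, fun i' h => congrArg f (p.injective h), fun j h => ((heq i j).1 h.symm).symm⟩
    · exact ⟨g j, fun i h => (heq i j).1 h, fun j' h => congrArg g (q.injective h)⟩
  choose r hr1 hr2 using hr
  have hrmono : StrictMono r := by
    intro x y hxy
    rcases hcover x with ⟨i, rfl⟩ | ⟨j, rfl⟩ <;> rcases hcover y with ⟨i', rfl⟩ | ⟨j', rfl⟩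
    · rw [← hr1 _ i rfl, ← hr1 _ i' rfl]; exact f.lt_iff_lt.2 (p.lt_iff_lt.1 hxy)
    · rw [← hr1 _ i rfl, ← hr2 _ j' rfl]; exact (hpq _ _).1 hxy
    · rw [← hr2 _ j rfl, ← hr1 _ i' rfl]; exact (hqp _ _).1 hxy
    · rw [← hr2 _ j rfl, ← hr2 _ j' rfl]; exact g.lt_iff_lt.2 (q.lt_iff_lt.1 hxy)
  have hf : f = p.trans (OrderEmbedding.ofStrictMono r hrmono) :=
    DFunLike.ext _ _ fun i => hr1 _ i rfl
  have hg : g = q.trans (OrderEmbedding.ofStrictMono r hrmono) :=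
    DFunLike.ext _ _ fun i => hr2 _ i rfl
  rw [hf, hg, D.map_comp, D.map_comp, (D.map _).lt_iff_lt]
  exact s.lt_iff t b Finset.subset_union_left Finset.subset_union_right

/-- The order between two terms depends only on their symbols and on the relative position of
their arguments. -/
theorem lt_congr {x y : D.Trace} {a a' : Fin x.1.1 → Ordinal.{u}} {b b' : Fin y.1.1 → Ordinal.{u}}
    (ha : StrictMono a) (ha' : StrictMono a') (hb : StrictMono b) (hb' : StrictMono b')
    (h1 : ∀ i j, a i < b j ↔ a' i < b' j) (h2 : ∀ i j, b j < a i ↔ b' j < a' i) :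
    (⟨x, a, ha⟩ : D.Term).Lt ⟨y, b, hb⟩ ↔ (⟨x, a', ha'⟩ : D.Term).Lt ⟨y, b', hb'⟩ := by
  set s : D.Term := ⟨x, a, ha⟩
  set t : D.Term := ⟨y, b, hb⟩
  have hs : ∀ i, a i ∈ s.argSet ∪ t.argSet := fun i => Finset.mem_union_left _ (s.args_mem i)
  have ht : ∀ i, b i ∈ s.argSet ∪ t.argSet := fun i => Finset.mem_union_right _ (t.args_mem i)
  rw [lt_iff_map_lt s t (positionEmb a ha _ hs) (positionEmb b hb _ ht)
      (fun i j => (positionEmb_lt_iff ..).symm) (fun i j => (positionEmb_lt_iff ..).symm),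
    lt_iff_map_lt ⟨x, a', ha'⟩ ⟨y, b', hb'⟩ (positionEmb a ha _ hs) (positionEmb b hb _ ht)
      (fun i j => by rw [positionEmb_lt_iff, h1]) (fun i j => by rw [positionEmb_lt_iff, h2])]

end Term

end PreDilator

/-! ### The ordinal that a term denotes -/

namespace PreDilator

variable {D : PreDilator.{u}}

/-- The least strict upper bound of the arguments of a term. -/
noncomputable def Term.bound (t : D.Term) : Ordinal.{u} := Finset.univ.sup fun i => t.args i + 1

theorem Term.bound_le_iff {t : D.Term} {α : Ordinal.{u}} : t.bound ≤ α ↔ ∀ i, t.args i < α := by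
  simp [Term.bound, Finset.sup_le_iff]

theorem Term.lt_bound (t : D.Term) (i : Fin t.sym.1.1) : t.args i < t.bound :=
  Term.bound_le_iff.1 le_rfl i

end PreDilator

namespace NormalDilator

open PreDilator

variable (D : NormalDilator.{u})

theorem supp_mu_one : D.supp 1 (D.mu 1 0) = Finset.univ := by
  have h := (D.normality_condition 1 0 (D.mu 1 0)).not.1 (lt_irrefl _)
  push Not at h
  obtain ⟨i, hi, -⟩ := h
  ext j
  rw [Subsingleton.elim j i]
  exact iff_of_true hi (Finset.mem_univ _)

/-- The symbol of the terms that denote the values of the normal function `μ`. -/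
def muSym : D.Trace := ⟨⟨1, D.mu 1 0⟩, D.supp_mu_one⟩

/-- The term that denotes `μ(α)`. -/
def muTerm (α : Ordinal.{u}) : D.Term :=
  ⟨D.muSym, fun _ => α, fun i j h => absurd h (by
    have : Subsingleton (Fin D.muSym.1.1) := inferInstanceAs (Subsingleton (Fin 1))
    rw [Subsingleton.elim i j]; exact lt_irrefl _)⟩

variable {D}

/-- Normality for arbitrary ordinals. -/
theorem lt_muTerm_iff (t : D.Term) (α : Ordinal.{u}) :
    t.Lt (D.muTerm α) ↔ ∀ i, t.args i < α := by
  set b := t.argSet ∪ (D.muTerm α).argSet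
  have ht : t.argSet ⊆ b := Finset.subset_union_left
  have hm : (D.muTerm α).argSet ⊆ b := Finset.subset_union_right
  rw [t.lt_iff _ b ht hm]
  have h1 : (D.muTerm α).lift b hm = D.mu b.card
      (positionEmb _ (D.muTerm α).strictMono b (fun i => hm ((D.muTerm α).args_mem i))
        (0 : Fin 1)) := D.map_mu _ _
  rw [h1, D.normality_condition]
  unfold Term.lift
  rw [D.supp_map, t.sym.2]
  simp only [Finset.mem_map, Finset.mem_univ, true_and, forall_exists_index,
    forall_apply_eq_imp_iff]
  exact forall_congr' fun i => Term.positionEmb_lt_iff ..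

theorem lt_muTerm_iff_bound (t : D.Term) (α : Ordinal.{u}) :
    t.Lt (D.muTerm α) ↔ t.bound ≤ α := by
  rw [lt_muTerm_iff, Term.bound_le_iff]

theorem bound_le_of_lt {s t : D.Term} (h : s.Lt t) : s.bound ≤ t.bound :=
  (lt_muTerm_iff_bound s t.bound).1 (_root_.trans h ((lt_muTerm_iff_bound t t.bound).2 le_rfl))

/-- The terms with arguments below `α`, as an initial segment of the ordinals. -/
noncomputable def barInitialSeg (D : NormalDilator.{u}) (α : Ordinal.{u}) :
    InitialSeg (D.BarLt α) ((· < ·) : Ordinal.{u} → Ordinal.{u} → Prop) where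
  toFun t := ((D.eta α).symm t).1
  inj' _ _ h := (D.eta α).symm.injective (Subtype.ext h)
  map_rel_iff' := (D.eta α).symm.map_rel_iff
  mem_range_of_rel' t γ h := ⟨D.eta α ⟨γ, lt_trans h ((D.eta α).symm t).2⟩,
    congrArg Subtype.val ((D.eta α).symm_apply_apply _)⟩

/-- The inclusion between terms with arguments below `α` and below `β`. -/
def barInclusion (D : NormalDilator.{u}) {α β : Ordinal.{u}} (h : α ≤ β) :
    InitialSeg (D.BarLt α) (D.BarLt β) where
  toFun t := ⟨t.1, fun i => (t.2 i).trans_le h⟩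
  inj' _ _ h := Subtype.ext (congrArg (fun x : D.Bar β => x.1) h)
  map_rel_iff' := Iff.rfl
  mem_range_of_rel' t s h := ⟨⟨s.1, Term.bound_le_iff.1
    ((bound_le_of_lt h).trans (Term.bound_le_iff.2 t.2))⟩, rfl⟩

/-- The ordinal denoted by a term. -/
noncomputable def ord (t : D.Term) : Ordinal.{u} := D.barInitialSeg t.bound ⟨t, t.lt_bound⟩

theorem ord_eq (t : D.Term) {α : Ordinal.{u}} (h : ∀ i, t.args i < α) :
    ord t = ((D.eta α).symm ⟨t, h⟩).1 := by
  have h' := InitialSeg.eq ((D.barInclusion (Term.bound_le_iff.2 h)).trans (D.barInitialSeg α))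
    (D.barInitialSeg t.bound) ⟨t, t.lt_bound⟩
  exact h'.symm

theorem ord_eta {α : Ordinal.{u}} (x : Set.Iio (D.value α)) : ord (D.eta α x).1 = x.1 :=
  (ord_eq _ (D.eta α x).2).trans (congrArg Subtype.val ((D.eta α).symm_apply_apply x))

theorem ord_lt_ord {s t : D.Term} : ord s < ord t ↔ s.Lt t := by
  have hs := Term.bound_le_iff.1 (le_max_left s.bound t.bound)
  have ht := Term.bound_le_iff.1 (le_max_right s.bound t.bound)
  rw [ord_eq s hs, ord_eq t ht]
  exact (D.eta (max s.bound t.bound)).symm.map_rel_iff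

theorem ord_injective : Function.Injective (ord (D := D)) := by
  intro s t h
  refine PreDilator.Term.isStrictTotalOrder.trichotomous s t ?_ ?_ <;>
    rw [← ord_lt_ord, h] <;> exact lt_irrefl _

theorem ord_inj {s t : D.Term} : ord s = ord t ↔ s = t := ord_injective.eq_iff

theorem ord_le_ord {s t : D.Term} : ord s ≤ ord t ↔ ¬ t.Lt s := by
  rw [← ord_lt_ord, not_lt]

theorem ord_lt_value {t : D.Term} {α : Ordinal.{u}} : ord t < D.value α ↔ ∀ i, t.args i < α := by
  constructor
  · intro h
    rw [← ord_injective (ord_eta ⟨ord t, h⟩)]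
    exact (D.eta α ⟨ord t, h⟩).2
  · intro h
    rw [ord_eq t h]
    exact ((D.eta α).symm ⟨t, h⟩).2

/-- The normal function `μ` that comes with `D`, on all ordinals; `μ(α)` is also the ordinal
`D(α)`. -/
noncomputable def muOrd (D : NormalDilator.{u}) (α : Ordinal.{u}) : Ordinal.{u} := ord (D.muTerm α)

/-- The terms with arguments below `α` are those that denote ordinals below `D(α)`. -/
theorem ord_lt_muOrd {t : D.Term} {α : Ordinal.{u}} :
    ord t < D.muOrd α ↔ ∀ i, t.args i < α := by
  rw [muOrd, ord_lt_ord, lt_muTerm_iff]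

theorem muOrd_strictMono : StrictMono D.muOrd := fun _ _ h =>
  ord_lt_muOrd.2 fun _ => h

theorem le_muOrd (α : Ordinal.{u}) : α ≤ D.muOrd α := muOrd_strictMono.le_apply

theorem ord_surjective : Function.Surjective (ord (D := D)) := by
  intro γ
  have h : γ < D.value (γ + 1) := (le_muOrd γ).trans_lt
    (ord_lt_value.2 fun _ => Order.lt_add_one_iff.2 le_rfl)
  exact ⟨(D.eta _ ⟨γ, h⟩).1, ord_eta ⟨γ, h⟩⟩

theorem value_eq_muOrd (α : Ordinal.{u}) : D.value α = D.muOrd α := by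
  refine le_antisymm (not_lt.1 fun h => ?_) (not_lt.1 fun h => ?_)
  · exact lt_irrefl α (ord_lt_value.1 h ⟨0, Nat.zero_lt_one⟩)
  · obtain ⟨t, ht⟩ := ord_surjective (D := D) (D.value α)
    rw [← ht, ord_lt_muOrd, ← ord_lt_value, ht] at h
    exact lt_irrefl _ h

theorem rep_iff {γ : Ordinal.{u}} {s : D.Trace} {g : Fin s.1.1 → Ordinal.{u}} :
    D.Rep γ s g ↔ ∃ hg : StrictMono g, ord ⟨s, g, hg⟩ = γ := by
  constructor
  · rintro ⟨hg, α, hγ, h⟩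
    exact ⟨hg, by rw [← h]; exact ord_eta ⟨γ, hγ⟩⟩
  · rintro ⟨hg, rfl⟩
    have h : ord (⟨s, g, hg⟩ : D.Term) < D.value (Term.bound (⟨s, g, hg⟩ : D.Term)) :=
      ord_lt_value.2 (Term.lt_bound _)
    exact ⟨hg, _, h, ord_injective (ord_eta ⟨_, h⟩)⟩

theorem args_le_ord (t : D.Term) (i : Fin t.sym.1.1) : t.args i ≤ ord t := by
  refine (le_muOrd (D := D) _).trans (not_lt.1 fun h => ?_)
  exact lt_irrefl _ (ord_lt_muOrd.1 h i)

end NormalDilator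

/-! ### The last argument of a term -/

namespace PreDilator

namespace Term

variable {D : PreDilator.{u}}

/-- The last argument of the term `t` is `δ`; in particular, `t` has an argument. -/
def HasTop (t : D.Term) (δ : Ordinal.{u}) : Prop :=
  ∃ i : Fin t.sym.1.1, (i : ℕ) + 1 = t.sym.1.1 ∧ t.args i = δ

/-- All arguments of `t` but the last one are smaller than `δ`. -/
def ParamsLt (t : D.Term) (δ : Ordinal.{u}) : Prop :=
  ∀ i : Fin t.sym.1.1, (i : ℕ) + 1 ≠ t.sym.1.1 → t.args i < δ

/-- The term `t` with its last argument replaced by `δ`. -/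
def setTop (t : D.Term) (δ : Ordinal.{u}) (h : t.ParamsLt δ) : D.Term where
  sym := t.sym
  args i := if (i : ℕ) + 1 = t.sym.1.1 then δ else t.args i
  strictMono i j hij := by
    have hj := j.2
    have hij' : (i : ℕ) < j := hij
    have hi : (i : ℕ) + 1 ≠ t.sym.1.1 := by omega
    simp only [hi, if_false]
    split_ifs
    · exact h i hi
    · exact t.strictMono hij

theorem setTop_args_top (t : D.Term) {δ : Ordinal.{u}} (h : t.ParamsLt δ) {i : Fin t.sym.1.1}
    (hi : (i : ℕ) + 1 = t.sym.1.1) : (t.setTop δ h).args i = δ := if_pos hi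

theorem setTop_args_of_ne (t : D.Term) {δ : Ordinal.{u}} (h : t.ParamsLt δ) {i : Fin t.sym.1.1}
    (hi : (i : ℕ) + 1 ≠ t.sym.1.1) : (t.setTop δ h).args i = t.args i := if_neg hi

theorem HasTop.paramsLt {t : D.Term} {δ : Ordinal.{u}} (h : t.HasTop δ) : t.ParamsLt δ := by
  obtain ⟨i, hi, rfl⟩ := h
  intro j hj
  refine t.strictMono (show (j : ℕ) < i from ?_)
  have := j.2
  omega

theorem ParamsLt.mono {t : D.Term} {δ ε : Ordinal.{u}} (h : t.ParamsLt δ) (hδ : δ ≤ ε) :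
    t.ParamsLt ε := fun i hi => (h i hi).trans_le hδ

theorem HasTop.eq {t : D.Term} {δ ε : Ordinal.{u}} (h : t.HasTop δ) (h' : t.HasTop ε) : δ = ε := by
  obtain ⟨i, hi, rfl⟩ := h
  obtain ⟨j, hj, rfl⟩ := h'
  rw [show i = j from Fin.ext (by omega)]

theorem HasTop.args_le {t : D.Term} {δ : Ordinal.{u}} (h : t.HasTop δ) (i) : t.args i ≤ δ := by
  by_cases hi : (i : ℕ) + 1 = t.sym.1.1
  · exact (HasTop.eq ⟨i, hi, rfl⟩ h).le
  · exact (h.paramsLt i hi).le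

theorem hasTop_iff_bound_eq {t : D.Term} {δ : Ordinal.{u}} : t.HasTop δ ↔ t.bound = δ + 1 := by
  constructor
  · intro h
    refine le_antisymm (bound_le_iff.2 fun i => Order.lt_add_one_iff.2 (h.args_le i)) ?_
    obtain ⟨i, -, rfl⟩ := h
    exact Order.add_one_le_of_lt (t.lt_bound i)
  · intro h
    rcases Nat.eq_zero_or_pos t.sym.1.1 with h0 | h0
    · have : t.bound ≤ 0 := bound_le_iff.2 fun i => absurd i.2 (by omega)
      rw [h] at this
      exact absurd this (not_le.2 (Order.lt_add_one_iff.2 zero_le))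
    · have htop : t.HasTop (t.args ⟨t.sym.1.1 - 1, by omega⟩) := ⟨_, by simp; omega, rfl⟩
      convert htop
      refine le_antisymm ?_ (Order.lt_add_one_iff.1 (h ▸ t.lt_bound _))
      have := bound_le_iff.2 fun i => Order.lt_add_one_iff.2 (htop.args_le i)
      rw [h] at this
      exact Order.lt_add_one_iff.1 ((Order.lt_add_one_iff.2 le_rfl).trans_le this)

theorem HasTop.setTop {t : D.Term} {δ ε : Ordinal.{u}} (h : t.HasTop δ) (hε : t.ParamsLt ε) :
    (t.setTop ε hε).HasTop ε := by
  obtain ⟨i, hi, -⟩ := h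
  exact ⟨i, hi, setTop_args_top t hε hi⟩

theorem paramsLt_setTop {t : D.Term} {δ ε : Ordinal.{u}} (h : t.ParamsLt δ) :
    (t.setTop δ h).ParamsLt ε ↔ t.ParamsLt ε := by
  refine forall_congr' fun i => forall_congr' fun hi => ?_
  rw [setTop_args_of_ne t h hi]

theorem setTop_setTop {t : D.Term} {δ ε : Ordinal.{u}} (h : t.ParamsLt δ)
    (h' : (t.setTop δ h).ParamsLt ε) :
    (t.setTop δ h).setTop ε h' = t.setTop ε ((paramsLt_setTop h).1 h') := by
  have : ((t.setTop δ h).setTop ε h').args = (t.setTop ε ((paramsLt_setTop h).1 h')).args := by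
    funext i
    by_cases hi : (i : ℕ) + 1 = t.sym.1.1
    · rw [setTop_args_top t _ hi]; exact setTop_args_top _ h' hi
    · rw [setTop_args_of_ne t _ hi, ← setTop_args_of_ne t h hi]; exact setTop_args_of_ne _ h' hi
  exact Term.ext rfl (heq_of_eq this)

theorem HasTop.setTop_self {t : D.Term} {δ : Ordinal.{u}} (h : t.HasTop δ) :
    t.setTop δ h.paramsLt = t := by
  have : (t.setTop δ h.paramsLt).args = t.args := by
    funext i
    by_cases hi : (i : ℕ) + 1 = t.sym.1.1
    · rw [setTop_args_top t _ hi]; exact h.eq ⟨i, hi, rfl⟩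
    · rw [setTop_args_of_ne t _ hi]
  exact Term.ext rfl (heq_of_eq this)

/-- The order between two terms with the same last argument does not depend on this argument. -/
theorem setTop_lt_setTop {s t : D.Term} {δ ε : Ordinal.{u}} (hs : s.ParamsLt δ) (ht : t.ParamsLt δ)
    (hs' : s.ParamsLt ε) (ht' : t.ParamsLt ε) :
    (s.setTop δ hs).Lt (t.setTop δ ht) ↔ (s.setTop ε hs').Lt (t.setTop ε ht') := by
  refine lt_congr (s.setTop δ hs).strictMono (s.setTop ε hs').strictMono
    (t.setTop δ ht).strictMono (t.setTop ε ht').strictMono (fun i j => ?_) (fun i j => ?_) <;>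
  by_cases hi : (i : ℕ) + 1 = s.sym.1.1 <;> by_cases hj : (j : ℕ) + 1 = t.sym.1.1
  · simp [setTop_args_top s _ hi, setTop_args_top t _ hj]
  · simp [setTop_args_top s _ hi, setTop_args_of_ne t _ hj, (ht j hj).not_gt, (ht' j hj).not_gt]
  · simp [setTop_args_top t _ hj, setTop_args_of_ne s _ hi, hs i hi, hs' i hi]
  · simp [setTop_args_of_ne s _ hi, setTop_args_of_ne t _ hj]
  · simp [setTop_args_top s _ hi, setTop_args_top t _ hj]
  · simp [setTop_args_top s _ hi, setTop_args_of_ne t _ hj, ht j hj, ht' j hj]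
  · simp [setTop_args_top t _ hj, setTop_args_of_ne s _ hi, (hs i hi).not_gt, (hs' i hi).not_gt]
  · simp [setTop_args_of_ne s _ hi, setTop_args_of_ne t _ hj]

/-- Finitely many parameters below a nonzero ordinal `δ` are bounded below `δ`. -/
theorem ParamsLt.exists_lt {t : D.Term} {δ : Ordinal.{u}} (h : t.ParamsLt δ) (hδ : 0 < δ) :
    ∃ η < δ, ∀ i : Fin t.sym.1.1, (i : ℕ) + 1 ≠ t.sym.1.1 → t.args i ≤ η := by
  refine ⟨Finset.univ.sup fun i : Fin t.sym.1.1 =>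
    if (i : ℕ) + 1 ≠ t.sym.1.1 then t.args i else 0, ?_, fun i hi => ?_⟩
  · rw [Finset.sup_lt_iff (by simpa using hδ)]
    intro i _
    split_ifs with hi
    · exact h i hi
    · exact hδ
  · have := Finset.le_sup (f := fun i : Fin t.sym.1.1 =>
      if (i : ℕ) + 1 ≠ t.sym.1.1 then t.args i else 0) (Finset.mem_univ i)
    simpa [hi] using this

end Term

end PreDilator

namespace NormalDilator

open PreDilator

variable {D : NormalDilator.{u}}

theorem hasTop_muTerm (α : Ordinal.{u}) : (D.muTerm α).HasTop α := ⟨⟨0, Nat.zero_lt_one⟩, rfl, rfl⟩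

theorem paramsLt_muTerm (α δ : Ordinal.{u}) : (D.muTerm α).ParamsLt δ := fun i hi =>
  absurd (show (i : ℕ) + 1 = 1 by have : (i : ℕ) < 1 := i.2; omega) hi

theorem setTop_muTerm (α δ : Ordinal.{u}) (h : (D.muTerm α).ParamsLt δ) :
    (D.muTerm α).setTop δ h = D.muTerm δ :=
  Term.ext rfl (heq_of_eq (funext fun i =>
    Term.setTop_args_top (D.muTerm α) h (show (i : ℕ) + 1 = 1 by have : (i : ℕ) < 1 := i.2; omega)))

/-- The terms with last argument `δ` denote the ordinals from `D(δ)` up to `D(δ + 1)`. -/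
theorem hasTop_iff {t : D.Term} {δ : Ordinal.{u}} :
    t.HasTop δ ↔ D.muOrd δ ≤ ord t ∧ ord t < D.muOrd (δ + 1) := by
  rw [Term.hasTop_iff_bound_eq, ← not_lt, ord_lt_muOrd, ord_lt_muOrd, ← Term.bound_le_iff,
    ← Term.bound_le_iff, not_le, ← Order.add_one_le_iff, le_antisymm_iff, and_comm]

theorem Term.HasTop.lt_muOrd {t : D.Term} {δ ε : Ordinal.{u}} (h : t.HasTop δ) (hδ : δ < ε) :
    ord t < D.muOrd ε :=
  ord_lt_muOrd.2 fun i => (PreDilator.Term.HasTop.args_le h i).trans_lt hδ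

theorem Term.HasTop.le_ord {t : D.Term} {δ : Ordinal.{u}} (h : t.HasTop δ) : δ ≤ ord t :=
  (le_muOrd δ).trans (hasTop_iff.1 h).1

end NormalDilator

/-! ### Basic properties of `≤₁ᴰ` -/

namespace Dilator

variable {D : Dilator.{u}} {α β γ : Ordinal.{u}}

theorem IsIso.refl (R : Ordinal.{u} → Ordinal.{u} → Prop) (Z : Finset Ordinal.{u}) :
    D.IsIso R id Z Z :=
  ⟨Set.bijOn_id _, fun _ _ _ _ => Iff.rfl, fun _ _ _ _ => Iff.rfl, fun _ _ _ _ _ => Iff.rfl⟩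

theorem IsIso.comp {R : Ordinal.{u} → Ordinal.{u} → Prop} {f g : Ordinal.{u} → Ordinal.{u}}
    {Z W V : Finset Ordinal.{u}} (hg : D.IsIso R g W V) (hf : D.IsIso R f Z W) :
    D.IsIso R (g ∘ f) Z V where
  bijOn := hg.bijOn.comp hf.bijOn
  le_iff x hx y hy := (hf.le_iff x hx y hy).trans
    (hg.le_iff _ (hf.bijOn.mapsTo hx) _ (hf.bijOn.mapsTo hy))
  rel_iff x hx y hy := (hf.rel_iff x hx y hy).trans
    (hg.rel_iff _ (hf.bijOn.mapsTo hx) _ (hf.bijOn.mapsTo hy))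
  rep_iff x hx s h hh := (hf.rep_iff x hx s h hh).trans
    (hg.rep_iff _ (hf.bijOn.mapsTo hx) s (f ∘ h) fun i => hf.bijOn.mapsTo (hh i))

theorem LeOne.le (h : D.LeOne α β) : α ≤ β := ((D.leOne_iff α β).1 h).1

theorem LeOne.exists_iso (h : D.LeOne α β) (X Y : Finset Ordinal.{u}) (hX : ∀ x ∈ X, x < α)
    (hY : ∀ y ∈ Y, α ≤ y ∧ y < β) : ∃ (Y' : Finset Ordinal.{u}) (f : Ordinal.{u} → Ordinal.{u}),
      (∀ y ∈ Y', y < α) ∧ D.IsIso D.LeOne f (X ∪ Y) (X ∪ Y') ∧ ∀ x ∈ X, f x = x :=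
  ((D.leOne_iff α β).1 h).2 X Y hX hY

variable (D) in
theorem leOne_refl (α : Ordinal.{u}) : D.LeOne α α := by
  refine (D.leOne_iff α α).2 ⟨le_rfl, fun X Y _ hY => ⟨∅, id, by simp, ?_, fun _ _ => rfl⟩⟩
  obtain rfl : Y = ∅ := Finset.eq_empty_of_forall_notMem fun y hy =>
    (hY y hy).2.not_ge (hY y hy).1
  exact IsIso.refl _ _

theorem LeOne.mono_right (h : D.LeOne α γ) (h1 : α ≤ β) (h2 : β ≤ γ) : D.LeOne α β :=
  (D.leOne_iff α β).2 ⟨h1, fun X Y hX hY =>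
    h.exists_iso X Y hX fun y hy => ⟨(hY y hy).1, (hY y hy).2.trans_le h2⟩⟩

theorem LeOne.trans (h : D.LeOne α β) (h' : D.LeOne β γ) : D.LeOne α γ := by
  refine (D.leOne_iff α γ).2 ⟨h.le.trans h'.le, fun X Y hX hY => ?_⟩
  -- move the part of `Y` above `β` below `β`, then everything between `α` and `β` below `α`
  obtain ⟨Y', f, hY', hf, hfX⟩ := h'.exists_iso (X ∪ Y.filter (· < β)) (Y.filter (β ≤ ·))
    (by
      intro x hx
      simp only [Finset.mem_union, Finset.mem_filter] at hx
      exact hx.elim (fun hx => (hX x hx).trans_le h.le) And.right)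
    (by
      intro y hy
      simp only [Finset.mem_filter] at hy
      exact ⟨hy.2, (hY y hy.1).2⟩)
  have hZ : X ∪ Y.filter (· < β) ∪ Y.filter (β ≤ ·) = X ∪ Y := by
    ext y
    have := lt_or_ge y β
    simp only [Finset.mem_union, Finset.mem_filter]
    tauto
  rw [hZ] at hf
  set W := X ∪ Y.filter (· < β) ∪ Y' with hW
  have hWβ : ∀ w ∈ W, w < β := by
    intro w hw
    simp only [hW, Finset.mem_union, Finset.mem_filter] at hw
    rcases hw with (hw | hw) | hw
    · exact (hX w hw).trans_le h.le
    · exact hw.2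
    · exact hY' w hw
  obtain ⟨Y'', g, hY'', hg, hgX⟩ := h.exists_iso (W.filter (· < α)) (W.filter (α ≤ ·))
    (by simp) (by
      intro y hy
      simp only [Finset.mem_filter] at hy
      exact ⟨hy.2, hWβ y hy.1⟩)
  have hW' : W.filter (· < α) ∪ W.filter (α ≤ ·) = W := by
    ext y
    have := lt_or_ge y α
    simp only [Finset.mem_union, Finset.mem_filter]
    tauto
  rw [hW'] at hg
  have hXW : X ⊆ W.filter (· < α) := fun x hx => by
    simp only [hW, Finset.mem_union, Finset.mem_filter]
    exact ⟨Or.inl (Or.inl hx), hX x hx⟩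
  refine ⟨W.filter (· < α) ∪ Y'', g ∘ f, ?_, ?_, ?_⟩
  · intro y hy
    simp only [Finset.mem_union, Finset.mem_filter] at hy
    exact hy.elim And.right (hY'' y)
  · have : X ∪ (W.filter (· < α) ∪ Y'') = W.filter (· < α) ∪ Y'' := by
      rw [← Finset.union_assoc, Finset.union_eq_right.2 hXW]
    rw [this]
    exact hg.comp hf
  · intro x hx
    rw [Function.comp, hfX x (Finset.mem_union_left _ hx), hgX x (hXW hx)]

/-- Any finite subset of a limit is bounded, so that `≤₁ᴰ` is closed under limits on the right. -/
theorem leOne_of_forall_lt (h : α ≤ β) (hlim : ∀ η < β, ∃ β' ≤ β, η < β' ∧ D.LeOne α β') :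
    D.LeOne α β := by
  refine (D.leOne_iff α β).2 ⟨h, fun X Y hX hY => ?_⟩
  rcases Y.eq_empty_or_nonempty with rfl | hne
  · exact ⟨∅, id, by simp, IsIso.refl _ _, fun _ _ => rfl⟩
  · obtain ⟨β', -, hmax, hβ'⟩ := hlim (Y.max' hne) (hY _ (Y.max'_mem hne)).2
    exact hβ'.exists_iso X Y hX fun y hy => ⟨(hY y hy).1, (Y.le_max' y hy).trans_lt hmax⟩

end Dilator

namespace NormalDilator

open PreDilator

variable {D : NormalDilator.{u}}

/-- An ordinal with a proper `≤₁ᴰ`-successor cannot be denoted by a term with smaller arguments,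
so that it is a fixed point of the normal function. -/
theorem muOrd_eq_of_leOne {α β : Ordinal.{u}} (h : D.LeOne α β) (hlt : α < β) :
    D.muOrd α = α := by
  refine le_antisymm (not_lt.1 fun hα => ?_) (le_muOrd α)
  obtain ⟨t, rfl⟩ := ord_surjective (D := D) α
  rw [ord_lt_muOrd] at hα
  obtain ⟨Y', f, hY', hf, hfX⟩ := h.exists_iso t.argSet {ord t}
    (by simpa [Term.argSet] using hα) (by simpa using hlt)
  have hmem : ord t ∈ t.argSet ∪ {ord t} := by simp
  have hrep := (hf.rep_iff (ord t) hmem t.sym t.args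
    fun i => Finset.mem_union_left _ (t.args_mem i)).1 (rep_iff.2 ⟨t.strictMono, rfl⟩)
  have hcomp : f ∘ t.args = t.args := funext fun i => hfX _ (t.args_mem i)
  rw [hcomp, rep_iff] at hrep
  obtain ⟨_, hrep⟩ := hrep
  have := hf.bijOn.mapsTo (Finset.mem_coe.2 hmem)
  rw [← hrep] at this
  simp only [Finset.coe_union, Set.mem_union, Finset.mem_coe] at this
  rcases this with h | h
  · simp only [Term.argSet, Finset.mem_image, Finset.mem_univ, true_and] at h
    obtain ⟨i, hi⟩ := h
    exact (hα i).ne hi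
  · exact (hY' _ h).false

end NormalDilator

/-! ### Terms whose last argument reflects them -/

namespace NormalDilator

open PreDilator PreDilator.Term

variable {D : NormalDilator.{u}}

/-- The term `t` is good if its last argument `δ` is a nonzero fixed point of the normal function
with `δ ≤₁ᴰ γ`, where `γ` is the ordinal denoted by `t`. -/
def Good (t : D.Term) : Prop :=
  ∃ δ, t.HasTop δ ∧ 0 < δ ∧ D.muOrd δ = δ ∧ D.LeOne δ (ord t)

theorem ord_muTerm_of_muOrd_eq {δ : Ordinal.{u}} (h : D.muOrd δ = δ) : ord (D.muTerm δ) = δ := h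

theorem setTop_lt_setTop_iff {s t : D.Term} {δ δ' : Ordinal.{u}} (hs : s.HasTop δ)
    (ht : t.HasTop δ) (hs' : s.ParamsLt δ') (ht' : t.ParamsLt δ') :
    (s.setTop δ' hs').Lt (t.setTop δ' ht') ↔ s.Lt t := by
  rw [← setTop_lt_setTop hs.paramsLt ht.paramsLt hs' ht', hs.setTop_self, ht.setTop_self]

/-- Replacing the last argument `δ` by a smaller `δ'` yields a finite isomorphism, as soon as `δ'`
and `δ` behave alike with respect to the finitely many ordinals involved. -/
theorem exists_iso_of_setTop {δ δ' : Ordinal.{u}} (hδ : δ' < δ) (hμ : D.muOrd δ = δ)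
    (hμ' : D.muOrd δ' = δ') (X Y : Finset Ordinal.{u}) (hX : ∀ x ∈ X, x < δ')
    (hY : ∀ y ∈ Y, ∃ (u : D.Term) (h : u.ParamsLt δ'), ord u = y ∧ u.HasTop δ ∧ D.LeOne δ y ∧
      D.LeOne δ' (ord (u.setTop δ' h)))
    (hXL : ∀ x ∈ X, D.LeOne x δ ↔ D.LeOne x δ') :
    ∃ (Y' : Finset Ordinal.{u}) (f : Ordinal.{u} → Ordinal.{u}), (∀ y ∈ Y', y < δ) ∧
      D.IsIso D.LeOne f (X ∪ Y) (X ∪ Y') ∧ ∀ x ∈ X, f x = x := by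
  classical
  set e : Ordinal.{u} → D.Term := Function.surjInv ord_surjective with he
  have heo : ∀ u, e (ord u) = u := Function.leftInverse_surjInv ⟨ord_injective, ord_surjective⟩
  set f : Ordinal.{u} → Ordinal.{u} := fun y => if y < δ then y else
    if h : (e y).ParamsLt δ' then ord ((e y).setTop δ' h) else 0 with hf
  have hf1 : ∀ {y}, y < δ → f y = y := fun {y} h => if_pos h
  have hf2 : ∀ (u : D.Term) (h : u.ParamsLt δ'), u.HasTop δ → f (ord u) = ord (u.setTop δ' h) := by
    intro u h hu
    simp only [hf]
    rw [if_neg (NormalDilator.Term.HasTop.le_ord hu).not_gt, dif_pos (by rwa [heo])]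
    congr 2
    exact heo u
  have hfδ : f δ = δ' := by
    have := hf2 (D.muTerm δ) (paramsLt_muTerm _ _) (hasTop_muTerm δ)
    rwa [setTop_muTerm, ord_muTerm_of_muOrd_eq hμ, ord_muTerm_of_muOrd_eq hμ'] at this
  set U : Set Ordinal.{u} := {z | z < δ' ∨
    ∃ (u : D.Term) (_ : u.ParamsLt δ'), ord u = z ∧ u.HasTop δ} with hU
  have hδU : δ ∈ U := Or.inr ⟨D.muTerm δ, paramsLt_muTerm _ _, hμ, hasTop_muTerm δ⟩
  have hmono : StrictMonoOn f U := by
    rintro a (ha | ⟨u, hu, rfl, hut⟩) b (hb | ⟨v, hv, rfl, hvt⟩) hab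
    · rwa [hf1 (ha.trans hδ), hf1 (hb.trans hδ)]
    · rw [hf1 (ha.trans hδ), hf2 v hv hvt]
      exact ha.trans_le (NormalDilator.Term.HasTop.le_ord (hvt.setTop hv))
    · exact absurd (hab.trans (hb.trans hδ)) (NormalDilator.Term.HasTop.le_ord hut).not_gt
    · rw [hf2 u hu hut, hf2 v hv hvt, ord_lt_ord, setTop_lt_setTop_iff hut hvt]
      exact ord_lt_ord.1 hab
  have hZU : ∀ z ∈ X ∪ Y, z ∈ U := by
    intro z hz
    rcases Finset.mem_union.1 hz with hz | hz
    · exact Or.inl (hX z hz)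
    · obtain ⟨u, h, rfl, hu, -⟩ := hY z hz
      exact Or.inr ⟨u, h, rfl, hu⟩
  have hlt : ∀ z ∈ U, f z < δ' → f z = z := by
    intro z hz hfz
    rw [← hfδ, hmono.lt_iff_lt hz hδU] at hfz
    exact hf1 hfz
  have hcover : X ∪ Y.image f = (X ∪ Y).image f := by
    rw [Finset.image_union]
    congr 1
    exact ((Finset.image_congr (f := f) (g := id) fun x hx =>
      hf1 ((hX x hx).trans hδ)).trans Finset.image_id).symm
  refine ⟨Y.image f, f, ?_, ⟨?_, ?_, ?_, ?_⟩, fun x hx => hf1 ((hX x hx).trans hδ)⟩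
  · intro y hy
    obtain ⟨y', hy', rfl⟩ := Finset.mem_image.1 hy
    obtain ⟨u, h, rfl, hu, -⟩ := hY y' hy'
    rw [hf2 u h hu, ← hμ]
    exact NormalDilator.Term.HasTop.lt_muOrd (hu.setTop h) hδ
  · rw [hcover, Finset.coe_image]
    exact (hmono.injOn.mono fun z hz => hZU z hz).bijOn_image
  · exact fun a ha b hb => (hmono.le_iff_le (hZU a ha) (hZU b hb)).symm
  · intro a ha b hb
    rcases lt_trichotomy a b with hab | rfl | hab
    · have hfab := hmono (hZU a ha) (hZU b hb) hab
      rcases Finset.mem_union.1 hb with hb | hb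
      · have hb' := hX b hb
        rw [hf1 (hb'.trans hδ), hf1 ((hab.trans hb').trans hδ)]
      · obtain ⟨v, hv, rfl, hvt, hvL, hvL'⟩ := hY b hb
        have hle := NormalDilator.Term.HasTop.le_ord hvt
        have hle' := NormalDilator.Term.HasTop.le_ord (hvt.setTop hv)
        rw [hf2 v hv hvt] at hfab ⊢
        rcases Finset.mem_union.1 ha with ha | ha
        · have ha' := hX a ha
          rw [hf1 (ha'.trans hδ)]
          exact ⟨fun h => ((hXL a ha).1 (h.mono_right (ha'.trans hδ).le hle)).trans hvL',
            fun h => ((hXL a ha).2 (h.mono_right ha'.le hle')).trans hvL⟩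
        · obtain ⟨w, hw, rfl, hwt, -⟩ := hY a ha
          rcases (NormalDilator.Term.HasTop.le_ord hwt).eq_or_lt with h | h
          · rw [← h, hfδ]
            exact iff_of_true hvL hvL'
          · -- neither `a` nor `f a` is a fixed point of the normal function
            refine iff_of_false (fun hL => ?_) (fun hL => ?_)
            · have h1 := muOrd_eq_of_leOne hL hab
              have h2 := (hasTop_iff.1 hwt).2
              rw [← h1] at h2
              exact (muOrd_strictMono.lt_iff_lt.1 h2).not_ge (Order.add_one_le_of_lt h)
            · have h1 := muOrd_eq_of_leOne hL hfab
              have h2 := hmono hδU (hZU _ (Finset.mem_union_right _ ha)) h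
              rw [hfδ] at h2
              rw [hf2 w hw hwt] at h1 h2
              have h3 := (hasTop_iff.1 (hwt.setTop hw)).2
              rw [← h1] at h3
              exact (muOrd_strictMono.lt_iff_lt.1 h3).not_ge (Order.add_one_le_of_lt h2)
    · exact iff_of_true (D.leOne_refl _) (D.leOne_refl _)
    · exact iff_of_false (fun h => h.le.not_gt hab)
        fun h => h.le.not_gt (hmono (hZU b hb) (hZU a ha) hab)
  · intro γ hγ s g hg
    rcases Finset.mem_union.1 hγ with hγ | hγ
    · have hγ' := hX γ hγ
      have hcomp : ∀ i, f (g i) < δ' → f (g i) = g i := fun i => hlt _ (hZU _ (hg i))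
      rw [hf1 (hγ'.trans hδ)]
      constructor
      · intro h
        obtain ⟨hgm, hr⟩ := rep_iff.1 h
        have : f ∘ g = g := funext fun i =>
          hf1 (((args_le_ord (⟨s, g, hgm⟩ : D.Term) i).trans_lt (hr ▸ hγ')).trans hδ)
        rwa [this]
      · intro h
        obtain ⟨hgm, hr⟩ := rep_iff.1 h
        have : f ∘ g = g := funext fun i =>
          hcomp i ((args_le_ord (⟨s, f ∘ g, hgm⟩ : D.Term) i).trans_lt (hr ▸ hγ'))
        rwa [this] at h
    · obtain ⟨u, hu, rfl, hut, -⟩ := hY γ hγ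
      rw [hf2 u hu hut]
      constructor
      · intro h
        obtain ⟨hgm, hr⟩ := rep_iff.1 h
        obtain rfl := ord_injective hr
        have : f ∘ g = (Term.setTop ⟨s, g, hgm⟩ δ' hu).args := funext fun i => by
          by_cases hi : (i : ℕ) + 1 = s.1.1
          · have h1 : g i = δ := HasTop.eq ⟨i, hi, rfl⟩ hut
            rw [setTop_args_top _ hu hi, Function.comp, h1, hfδ]
          · rw [setTop_args_of_ne _ hu hi]
            exact hf1 ((hu i hi).trans hδ)
        rw [this]
        exact rep_iff.2 ⟨(Term.setTop ⟨s, g, hgm⟩ δ' hu).strictMono, rfl⟩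
      · intro h
        obtain ⟨hgm, hr⟩ := rep_iff.1 h
        have hr := ord_injective hr
        obtain ⟨s', a, ha⟩ := u
        obtain rfl : s = s' := congrArg Term.sym hr
        have hargs : f ∘ g = (Term.setTop ⟨s, a, ha⟩ δ' hu).args :=
          eq_of_heq (Term.mk.inj hr).2
        have : g = a := funext fun i => by
          have hi' := congrFun hargs i
          rw [Function.comp] at hi'
          by_cases hi : (i : ℕ) + 1 = s.1.1
          · rw [setTop_args_top _ hu hi, ← hfδ] at hi'
            rw [hmono.injOn (hZU _ (hg i)) hδU hi']
            exact HasTop.eq hut ⟨i, hi, rfl⟩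
          · rw [setTop_args_of_ne _ hu hi] at hi'
            exact (hlt _ (hZU _ (hg i)) (hi'.le.trans_lt (hu i hi))).symm.trans hi'
        subst this
        exact rep_iff.2 ⟨ha, rfl⟩

theorem exists_forall_finset {ι : Type*} (F : Finset ι) {p : ι → Ordinal.{u} → Prop}
    {δ : Ordinal.{u}} (h0 : 0 < δ) (h : ∀ i ∈ F, ∃ η < δ, ∀ δ', η < δ' → δ' < δ → p i δ') :
    ∃ η < δ, ∀ δ', η < δ' → δ' < δ → ∀ i ∈ F, p i δ' := by
  choose! η hη hp using h
  refine ⟨F.sup η, (Finset.sup_lt_iff (by simpa using h0)).2 hη, fun δ' h1 h2 i hi => ?_⟩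
  exact hp i hi δ' ((Finset.le_sup hi).trans_lt h1) h2

/-- If every smaller term with last argument `δ` becomes good when `δ` is replaced by suitable
arguments that are arbitrarily close to `δ`, then `δ` reflects the given term. -/
theorem leOne_of_forall_good {t : D.Term} {δ : Ordinal.{u}} (ht : t.HasTop δ) (h0 : 0 < δ)
    (hμ : D.muOrd δ = δ)
    (h : ∀ s : D.Term, s.Lt t → s.HasTop δ → ∀ η < δ, ∃ δ', η < δ' ∧ δ' < δ ∧
      ∃ hp, Good (s.setTop δ' hp)) : D.LeOne δ (ord t) := by
  obtain ⟨ρ, hρ⟩ : ∃ ρ, ρ = ord t := ⟨_, rfl⟩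
  induction ρ using WellFoundedLT.induction generalizing t with
  | ind ρ ih =>
  subst hρ
  refine (D.leOne_iff _ _).2 ⟨NormalDilator.Term.HasTop.le_ord ht, fun X Y hX hY => ?_⟩
  rcases Y.eq_empty_or_nonempty with rfl | hne
  · exact ⟨∅, id, by simp, Dilator.IsIso.refl _ _, fun _ _ => rfl⟩
  have hYt : ∀ u : D.Term, ord u ∈ Y → u.HasTop δ ∧ D.LeOne δ (ord u) := by
    intro u hu
    have hut : u.HasTop δ := hasTop_iff.2
      ⟨by rw [hμ]; exact (hY _ hu).1, (hY _ hu).2.trans (hasTop_iff.1 ht).2⟩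
    exact ⟨hut, ih _ (hY _ hu).2 hut
      (fun s hs => h s (_root_.trans hs (ord_lt_ord.1 (hY _ hu).2))) rfl⟩
  -- `m` denotes the largest element of `Y`: once `m[δ']` is good, `δ'` is related by `≤₁ᴰ` to
  -- `u[δ']` for every `u` that denotes an element of `Y`
  obtain ⟨m, hm⟩ := ord_surjective (D := D) (Y.max' hne)
  obtain ⟨η1, hη1, hX1⟩ := exists_forall_finset X (p := fun x δ' => x < δ') h0
    fun x hx => ⟨x, hX x hx, fun _ h _ => h⟩
  obtain ⟨η2, hη2, hX2⟩ := exists_forall_finset X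
    (p := fun x δ' => D.LeOne x δ ↔ D.LeOne x δ') h0 (by
      intro x hx
      by_cases hL : D.LeOne x δ
      · exact ⟨x, hX x hx, fun δ' h1 h2 => iff_of_true hL (hL.mono_right h1.le h2.le)⟩
      · have h1 := mt (Dilator.leOne_of_forall_lt (hX x hx).le) hL
        push Not at h1
        obtain ⟨η, hη, h1⟩ := h1
        exact ⟨η, hη, fun δ' h2 h3 => iff_of_false hL (h1 δ' h3.le h2)⟩)
  obtain ⟨η3, hη3, hY3⟩ := exists_forall_finset Y
    (p := fun y δ' => ∀ u : D.Term, ord u = y → u.ParamsLt δ') h0 (by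
      intro y hy
      obtain ⟨u, rfl⟩ := ord_surjective (D := D) y
      obtain ⟨η, hη, hu⟩ := (hYt u hy).1.paramsLt.exists_lt h0
      refine ⟨η, hη, fun δ' h1 _ v hv i hi => ?_⟩
      obtain rfl := ord_injective hv
      exact (hu i hi).trans_lt h1)
  have hmY : ord m ∈ Y := hm ▸ Y.max'_mem hne
  obtain ⟨δ', hηδ, hδ, hmp, δ'', htop, -, hμ', hL⟩ := h m (ord_lt_ord.1 (hY _ hmY).2)
    (hYt m hmY).1 (max η1 (max η2 η3)) (by simp [hη1, hη2, hη3])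
  obtain rfl := htop.eq ((hYt m hmY).1.setTop hmp)
  simp only [max_lt_iff] at hηδ
  refine exists_iso_of_setTop hδ hμ hμ' X Y (hX1 _ hηδ.1 hδ) (fun y hy => ?_)
    (hX2 _ hηδ.2.1 hδ)
  obtain ⟨u, rfl⟩ := ord_surjective (D := D) y
  have hup := hY3 _ hηδ.2.2 hδ _ hy u rfl
  have hut := (hYt u hy).1
  refine ⟨u, hup, rfl, hut, (hYt u hy).2,
    hL.mono_right (NormalDilator.Term.HasTop.le_ord (hut.setTop hup)) ?_⟩
  rw [ord_le_ord, setTop_lt_setTop_iff (hYt m hmY).1 hut, ← ord_le_ord, hm]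
  exact Y.le_max' _ hy

/-- A reflecting last argument can be replaced by smaller ones. -/
theorem exists_good_of_leOne {s t : D.Term} {δ η : Ordinal.{u}} (hμ : D.muOrd δ = δ)
    (hL : D.LeOne δ (ord t)) (hst : s.Lt t) (hs : s.HasTop δ) (hη : η < δ) :
    ∃ δ', η < δ' ∧ δ' < δ ∧ ∃ hp, Good (s.setTop δ' hp) := by
  have hle := NormalDilator.Term.HasTop.le_ord hs
  have hlt := ord_lt_ord.2 hst
  -- an isomorphism that fixes `η` and the parameters of `s` sends `ord s` to the ordinal denoted by
  -- `s[f δ]`, and it preserves the fixed point equation for `δ`, which is an instance of `≃`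
  set X := insert η (s.argSet.filter (· < δ)) with hXdef
  have hX : ∀ x ∈ X, x < δ := by simp [hXdef, hη]
  obtain ⟨Y', f, hY', hf, hfX⟩ := hL.exists_iso X {δ, ord s} hX (by
    simp only [Finset.mem_insert, Finset.mem_singleton]
    rintro y (rfl | rfl)
    · exact ⟨le_rfl, hle.trans_lt hlt⟩
    · exact ⟨hle, hlt⟩)
  have hδ : δ ∈ X ∪ {δ, ord s} := by simp
  have hsm : ord s ∈ X ∪ {δ, ord s} := by simp
  have hηX : η ∈ X := by simp [hXdef]
  have hmono : ∀ x ∈ X, x < f δ := fun x hx => by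
    have := (hf.le_iff δ hδ x (Finset.mem_union_left _ hx)).not
    rw [hfX x hx, not_le, not_le] at this
    exact this.1 (hX x hx)
  have hparam : ∀ i : Fin s.sym.1.1, (i : ℕ) + 1 ≠ s.sym.1.1 → s.args i ∈ X := fun i hi => by
    simp only [hXdef, Finset.mem_insert, Finset.mem_filter]
    exact Or.inr ⟨s.args_mem i, hs.paramsLt i hi⟩
  have hp : s.ParamsLt (f δ) := fun i hi => hmono _ (hparam i hi)
  have htop : ∀ i : Fin s.sym.1.1, (i : ℕ) + 1 = s.sym.1.1 → s.args i = δ :=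
    fun i hi => HasTop.eq ⟨i, hi, rfl⟩ hs
  have hfs : f (ord s) = ord (s.setTop (f δ) hp) := by
    have h1 := (hf.rep_iff (ord s) hsm s.sym s.args (fun i => by
      by_cases hi : (i : ℕ) + 1 = s.sym.1.1
      · rw [htop i hi]; exact hδ
      · exact Finset.mem_union_left _ (hparam i hi))).1 (rep_iff.2 ⟨s.strictMono, rfl⟩)
    have h2 : f ∘ s.args = (s.setTop (f δ) hp).args := funext fun i => by
      by_cases hi : (i : ℕ) + 1 = s.sym.1.1
      · rw [setTop_args_top _ hp hi, Function.comp, htop i hi]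
      · rw [setTop_args_of_ne _ hp hi, Function.comp, hfX _ (hparam i hi)]
    rw [h2] at h1
    exact (rep_iff.1 h1).2.symm
  have hμ' : D.muOrd (f δ) = f δ := by
    have h1 := (hf.rep_iff δ hδ D.muSym (fun _ => δ) (fun _ => hδ)).1
      (rep_iff.2 ⟨(D.muTerm δ).strictMono, hμ⟩)
    exact (rep_iff.1 h1).2
  refine ⟨f δ, hmono η hηX, ?_, hp, f δ, hs.setTop hp, zero_le.trans_lt (hmono η hηX), hμ', ?_⟩
  · have h1 := hf.bijOn.mapsTo (Finset.mem_coe.2 hδ)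
    exact (Finset.mem_union.1 (Finset.mem_coe.1 h1)).elim (hX _) (hY' _)
  · rw [← hfs]
    exact (hf.rel_iff δ hδ _ hsm).1 (hL.mono_right hle hlt.le)

/-- The recursive characterization of good terms. It does not refer to `≤₁ᴰ`. -/
theorem good_iff {t : D.Term} {δ : Ordinal.{u}} (ht : t.HasTop δ) :
    Good t ↔ 0 < δ ∧ D.muOrd δ = δ ∧ ∀ s : D.Term, s.Lt t → s.HasTop δ → ∀ η < δ,
      ∃ δ', η < δ' ∧ δ' < δ ∧ ∃ hp, Good (s.setTop δ' hp) := by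
  constructor
  · rintro ⟨ε, hε, h0, hμ, hL⟩
    obtain rfl := hε.eq ht
    exact ⟨h0, hμ, fun s hst hs η hη => exists_good_of_leOne hμ hL hst hs hη⟩
  · rintro ⟨h0, hμ, h⟩
    exact ⟨δ, ht, h0, hμ, leOne_of_forall_good ht h0 hμ h⟩

end NormalDilator

/-! ### `Δ₀`- and `Σ`-predicates over an admissible set -/

namespace DeltaZero

/-- The renaming of variables below a quantifier. -/
def liftRename (r : ℕ → ℕ) : ℕ → ℕ
  | 0 => 0
  | k + 1 => r k + 1

/-- Renaming of the free variables of a `Δ₀`-formula. -/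
def rename : DeltaZero → (ℕ → ℕ) → DeltaZero
  | mem i j, r => mem (r i) (r j)
  | eq i j, r => eq (r i) (r j)
  | neg φ, r => neg (φ.rename r)
  | and φ ψ, r => and (φ.rename r) (ψ.rename r)
  | ball j φ, r => ball (r j) (φ.rename (liftRename r))

theorem consAssign_comp_liftRename {M : Type*} (x : M) (v : ℕ → M) (r : ℕ → ℕ) :
    consAssign x v ∘ liftRename r = consAssign x (v ∘ r) := by
  funext k
  cases k <;> rfl

theorem realize_rename {A : ZFSet.{u}} (φ : DeltaZero) :
    ∀ (r : ℕ → ℕ) (v : ℕ → {x : ZFSet.{u} // x ∈ A}),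
      (φ.rename r).Realize A v ↔ φ.Realize A (v ∘ r) := by
  induction φ with
  | mem i j => exact fun _ _ => Iff.rfl
  | eq i j => exact fun _ _ => Iff.rfl
  | neg φ ih => exact fun r v => not_congr (ih r v)
  | and φ ψ ih ih' => exact fun r v => and_congr (ih r v) (ih' r v)
  | ball j φ ih =>
    intro r v
    refine forall_congr' fun x => imp_congr Iff.rfl ?_
    rw [ih, consAssign_comp_liftRename]

end DeltaZero

namespace Admissible

/-- The elements of the set `A`, as a type. -/
abbrev Elem (A : ZFSet.{u}) : Type (u + 1) := {x : ZFSet.{u} // x ∈ A}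

/-- A context over `A` is a type `Γ` with a set of basic functions from `Γ` to `A`. One should think
of a sequence of variables, the basic functions being the constants and the values of the
variables. Predicates on `Γ` can then be classified according to the complexity of the formulas
that define them. -/
class Ctx (A : ZFSet.{u}) (Γ : Type (u + 1)) where
  /-- the basic functions -/
  basic : Set (Γ → Elem A)
  const_mem : ∀ a, (fun _ => a) ∈ basic

/-- A type whose elements are coded by elements of `A`. -/
class Coded (A : ZFSet.{u}) (C : Type (u + 1)) where
  /-- the code of an element -/
  enc : C → Elem A

variable {A : ZFSet.{u}}

instance : Coded A (Elem A) := ⟨id⟩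

instance {C : Type (u + 1)} [Coded A C] : Ctx A C where
  basic := insert Coded.enc (Set.range fun a _ => a)
  const_mem a := Or.inr ⟨a, rfl⟩

instance : Ctx A PUnit where
  basic := Set.univ
  const_mem _ := trivial

instance {Γ Δ : Type (u + 1)} [Ctx A Γ] [Ctx A Δ] : Ctx A (Γ × Δ) where
  basic := {t | (∃ s ∈ Ctx.basic, t = s ∘ Prod.fst) ∨ ∃ s ∈ Ctx.basic, t = s ∘ Prod.snd}
  const_mem a := Or.inl ⟨_, Ctx.const_mem a, rfl⟩

variable {Γ Γ' Γ'' Δ : Type (u + 1)} [Ctx A Γ] [Ctx A Γ'] [Ctx A Γ''] [Ctx A Δ]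

variable (A) in
/-- Substitutions of variables and constants for variables. -/
def IsProj (ρ : Γ' → Γ) : Prop := ∀ t ∈ Ctx.basic (A := A) (Γ := Γ), t ∘ ρ ∈ Ctx.basic

theorem IsProj.id : IsProj A (fun g : Γ => g) := fun _ h => h

theorem IsProj.comp {ρ : Γ' → Γ} {ρ' : Γ'' → Γ'} (h : IsProj A ρ) (h' : IsProj A ρ') :
    IsProj A (fun g => ρ (ρ' g)) := fun t ht => h' _ (h t ht)

theorem IsProj.fst : IsProj A (fun p : Γ × Δ => p.1) := fun t ht => Or.inl ⟨t, ht, rfl⟩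

theorem IsProj.snd : IsProj A (fun p : Γ × Δ => p.2) := fun t ht => Or.inr ⟨t, ht, rfl⟩

theorem IsProj.prodMk {ρ : Γ' → Γ} {ρ' : Γ' → Δ} (h : IsProj A ρ) (h' : IsProj A ρ') :
    IsProj A (fun g => (ρ g, ρ' g)) := by
  rintro t (⟨s, hs, rfl⟩ | ⟨s, hs, rfl⟩)
  · exact h s hs
  · exact h' s hs

theorem basic_prod_elem {t : Γ × Elem A → Elem A} (ht : t ∈ Ctx.basic) :
    (∃ s ∈ Ctx.basic (A := A) (Γ := Γ), t = s ∘ Prod.fst) ∨ t = Prod.snd := by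
  rcases ht with h | ⟨s, rfl | ⟨a, rfl⟩, rfl⟩
  · exact Or.inl h
  · exact Or.inr rfl
  · exact Or.inl ⟨_, Ctx.const_mem a, rfl⟩

/-- The variable that has been added to a context can be moved to the position zero. -/
theorem exists_env [Nonempty (Elem A)] (e : ℕ → Γ × Elem A → Elem A) (he : ∀ k, e k ∈ Ctx.basic) :
    ∃ (r : ℕ → ℕ) (e' : ℕ → Γ → Elem A), (∀ k, e' k ∈ Ctx.basic) ∧
      ∀ g x, (fun k => e k (g, x)) = consAssign x (fun k => e' k g) ∘ r := by
  classical
  have h : ∀ k, ∃ s : Γ → Elem A, s ∈ Ctx.basic ∧ (e k = s ∘ Prod.fst ∨ e k = Prod.snd) := by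
    intro k
    rcases basic_prod_elem (he k) with ⟨s, hs, h⟩ | h
    · exact ⟨s, hs, Or.inl h⟩
    · exact ⟨fun _ => Classical.arbitrary _, Ctx.const_mem _, Or.inr h⟩
  choose s hs h using h
  refine ⟨fun k => if e k = Prod.snd then 0 else k + 1, s, hs, fun g x => funext fun k => ?_⟩
  simp only [Function.comp]
  split_ifs with hk
  · rw [hk]; rfl
  · rw [(h k).resolve_right hk]; rfl

variable (A) in
/-- Predicates that are defined by a `Δ₀`-formula with parameters. -/
def IsDelta0 (R : Γ → Prop) : Prop :=
  ∃ (φ : DeltaZero) (e : ℕ → Γ → Elem A), (∀ k, e k ∈ Ctx.basic) ∧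
    ∀ g, R g ↔ φ.Realize A fun k => e k g

namespace IsDelta0

theorem proj {R : Γ → Prop} (h : IsDelta0 A R) {ρ : Γ' → Γ} (hρ : IsProj A ρ) :
    IsDelta0 A fun g => R (ρ g) := by
  obtain ⟨φ, e, he, h⟩ := h
  exact ⟨φ, fun k => e k ∘ ρ, fun k => hρ _ (he k), fun g => h (ρ g)⟩

theorem mem {s t : Γ → Elem A} (hs : s ∈ Ctx.basic) (ht : t ∈ Ctx.basic) :
    IsDelta0 A fun g => (s g).1 ∈ (t g).1 :=
  ⟨.mem 0 1, fun k => if k = 0 then s else t, fun k => by dsimp only; split_ifs <;> assumption,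
    fun _ => Iff.rfl⟩

theorem eq {s t : Γ → Elem A} (hs : s ∈ Ctx.basic) (ht : t ∈ Ctx.basic) :
    IsDelta0 A fun g => s g = t g :=
  ⟨.eq 0 1, fun k => if k = 0 then s else t, fun k => by dsimp only; split_ifs <;> assumption,
    fun _ => Iff.rfl⟩

theorem not {R : Γ → Prop} (h : IsDelta0 A R) : IsDelta0 A fun g => ¬ R g := by
  obtain ⟨φ, e, he, h⟩ := h
  exact ⟨.neg φ, e, he, fun g => not_congr (h g)⟩

theorem and {R S : Γ → Prop} (hR : IsDelta0 A R) (hS : IsDelta0 A S) :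
    IsDelta0 A fun g => R g ∧ S g := by
  obtain ⟨φ, e, he, h⟩ := hR
  obtain ⟨ψ, e', he', h'⟩ := hS
  refine ⟨.and (φ.rename (2 * ·)) (ψ.rename (2 * · + 1)),
    fun k => if k % 2 = 0 then e (k / 2) else e' (k / 2), fun k => ?_, fun g => ?_⟩
  · dsimp only
    split_ifs
    exacts [he _, he' _]
  · refine (and_congr (h g) (h' g)).trans ?_
    simp only [DeltaZero.Realize, DeltaZero.realize_rename]
    refine and_congr (iff_of_eq ?_) (iff_of_eq ?_) <;> congr 1 <;> funext k
    · simp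
    · simp only [Function.comp]
      rw [if_neg (by omega), show (2 * k + 1) / 2 = k by omega]

theorem or {R S : Γ → Prop} (hR : IsDelta0 A R) (hS : IsDelta0 A S) :
    IsDelta0 A fun g => R g ∨ S g := by
  have := (hR.not.and hS.not).not
  simpa only [← not_or, not_not] using this

variable [hA : Fact (IsAdmissible A)]

instance : Nonempty (Elem A) := let ⟨x, hx⟩ := hA.out.nonempty; ⟨⟨x, hx⟩⟩

theorem ball {t : Γ → Elem A} (ht : t ∈ Ctx.basic) {R : Γ → Elem A → Prop}
    (hR : IsDelta0 A fun p : Γ × Elem A => R p.1 p.2) :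
    IsDelta0 A fun g => ∀ x : Elem A, x.1 ∈ (t g).1 → R g x := by
  obtain ⟨φ, e, he, h⟩ := hR
  obtain ⟨r, e', he', hr⟩ := exists_env e he
  refine ⟨.ball 0 (φ.rename (DeltaZero.liftRename Nat.succ ∘ r)),
    fun k => Nat.casesOn k t e', fun k => ?_, fun g => ?_⟩
  · cases k
    exacts [ht, he' _]
  · refine forall_congr' fun x => imp_congr Iff.rfl ?_
    rw [DeltaZero.realize_rename, ← Function.comp_assoc, DeltaZero.consAssign_comp_liftRename]
    refine (h (g, x)).trans (iff_of_eq ?_)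
    rw [hr]
    rfl

theorem bex {t : Γ → Elem A} (ht : t ∈ Ctx.basic) {R : Γ → Elem A → Prop}
    (hR : IsDelta0 A fun p : Γ × Elem A => R p.1 p.2) :
    IsDelta0 A fun g => ∃ x : Elem A, x.1 ∈ (t g).1 ∧ R g x := by
  have := (ball (R := fun g x => ¬ R g x) ht hR.not).not
  push Not at this
  exact this

theorem collection {R : Γ → Elem A → Elem A → Prop}
    (hR : IsDelta0 A fun p : (Γ × Elem A) × Elem A => R p.1.1 p.1.2 p.2) (g : Γ) (a : Elem A)
    (h : ∀ x : Elem A, x.1 ∈ a.1 → ∃ y, R g x y) :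
    ∃ b : Elem A, ∀ x : Elem A, x.1 ∈ a.1 → ∃ y : Elem A, y.1 ∈ b.1 ∧ R g x y := by
  obtain ⟨φ, e, he, hφ⟩ := hR
  obtain ⟨r, e', he', hr⟩ := exists_env e he
  obtain ⟨r', e'', he'', hr'⟩ := exists_env e' he'
  have key : ∀ x y, R g x y ↔ (φ.rename (DeltaZero.liftRename r' ∘ r)).Realize A
      (consAssign y (consAssign x fun k => e'' k g)) := by
    intro x y
    rw [DeltaZero.realize_rename, ← Function.comp_assoc, DeltaZero.consAssign_comp_liftRename]
    refine (hφ ((g, x), y)).trans (iff_of_eq ?_)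
    rw [hr, hr']
  obtain ⟨b, hb, h'⟩ := hA.out.collection (φ.rename (DeltaZero.liftRename r' ∘ r))
    (fun k => e'' k g) a.1 a.2 (by simpa only [key] using h)
  exact ⟨⟨b, hb⟩, by simpa only [key] using h'⟩

theorem separation {R : Γ → Elem A → Prop} (hR : IsDelta0 A fun p : Γ × Elem A => R p.1 p.2)
    (g : Γ) (a : Elem A) :
    ∃ b : Elem A, ∀ x : Elem A, x.1 ∈ b.1 ↔ x.1 ∈ a.1 ∧ R g x := by
  obtain ⟨φ, e, he, hφ⟩ := hR
  obtain ⟨r, e', he', hr⟩ := exists_env e he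
  obtain ⟨b, hb, h⟩ := hA.out.separation (φ.rename r) (fun k => e' k g) a.1 a.2
  refine ⟨⟨b, hb⟩, fun x => (h x).trans (and_congr Iff.rfl ?_)⟩
  rw [DeltaZero.realize_rename, ← hr g x]
  exact (hφ (g, x)).symm

end IsDelta0

variable (A) in
/-- Predicates that are defined by a `Σ`-formula with parameters. -/
def IsSigma (R : Γ → Prop) : Prop :=
  ∃ S : Γ × Elem A → Prop, IsDelta0 A S ∧ ∀ g, R g ↔ ∃ w, S (g, w)

theorem IsDelta0.isSigma [Nonempty (Elem A)] {R : Γ → Prop} (h : IsDelta0 A R) : IsSigma A R :=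
  ⟨fun p => R p.1, h.proj .fst, fun _ => (exists_const _).symm⟩

namespace IsSigma

theorem congr {R S : Γ → Prop} (h : IsSigma A S) (hRS : ∀ g, R g ↔ S g) : IsSigma A R := by
  rwa [show R = S from funext fun g => propext (hRS g)]

theorem proj {R : Γ → Prop} (h : IsSigma A R) {ρ : Γ' → Γ} (hρ : IsProj A ρ) :
    IsSigma A fun g => R (ρ g) := by
  obtain ⟨S, hS, h⟩ := h
  exact ⟨fun p => S (ρ p.1, p.2), hS.proj ((hρ.comp .fst).prodMk .snd), fun g => h (ρ g)⟩

theorem or {R S : Γ → Prop} (hR : IsSigma A R) (hS : IsSigma A S) :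
    IsSigma A fun g => R g ∨ S g := by
  obtain ⟨R', hR', hR⟩ := hR
  obtain ⟨S', hS', hS⟩ := hS
  refine ⟨_, hR'.or hS', fun g => ?_⟩
  rw [exists_or]
  exact or_congr (hR g) (hS g)

end IsSigma

variable [hA : Fact (IsAdmissible A)]

theorem mem_of_mem {x y : ZFSet.{u}} (h : x ∈ y) (hy : y ∈ A) : x ∈ A :=
  hA.out.transitive.mem_trans h hy

namespace IsSigma

theorem exists_pair_superset (x y : Elem A) : ∃ z : Elem A, x.1 ∈ z.1 ∧ y.1 ∈ z.1 := by
  obtain ⟨z, hz, h⟩ := hA.out.pairing x.1 x.2 y.1 y.2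
  exact ⟨⟨z, hz⟩, h⟩

theorem exists_elem {R : Γ → Elem A → Prop} (h : IsSigma A fun p : Γ × Elem A => R p.1 p.2) :
    IsSigma A fun g => ∃ x, R g x := by
  obtain ⟨S, hS, h⟩ := h
  refine ⟨fun p => ∃ x : Elem A, x.1 ∈ p.2.1 ∧ ∃ w : Elem A, w.1 ∈ p.2.1 ∧ S ((p.1, x), w),
    .bex (Or.inr ⟨_, Or.inl rfl, rfl⟩) (.bex (Or.inl ⟨_, Or.inr ⟨_, Or.inl rfl, rfl⟩, rfl⟩)
      (hS.proj (((IsProj.fst.comp (.comp .fst .fst)).prodMk (.comp .snd .fst)).prodMk .snd))),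
    fun g => ?_⟩
  constructor
  · rintro ⟨x, hx⟩
    obtain ⟨w, hw⟩ := (h (g, x)).1 hx
    obtain ⟨u, hu⟩ := exists_pair_superset x w
    exact ⟨u, x, hu.1, w, hu.2, hw⟩
  · rintro ⟨u, x, -, w, -, hw⟩
    exact ⟨x, (h (g, x)).2 ⟨w, hw⟩⟩

theorem and {R S : Γ → Prop} (hR : IsSigma A R) (hS : IsSigma A S) :
    IsSigma A fun g => R g ∧ S g := by
  obtain ⟨R', hR', hR⟩ := hR
  obtain ⟨S', hS', hS⟩ := hS
  have h1 : IsDelta0 A fun p : (Γ × Elem A) × Elem A => R' p.1 ∧ S' (p.1.1, p.2) :=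
    (hR'.proj .fst).and (hS'.proj ((IsProj.fst.comp .fst).prodMk .snd))
  refine (exists_elem (R := fun g x => ∃ w, R' (g, x) ∧ S' (g, w))
    (exists_elem h1.isSigma)).congr fun g => ?_
  rw [hR, hS]
  constructor
  · rintro ⟨⟨x, hx⟩, w, hw⟩; exact ⟨x, w, hx, hw⟩
  · rintro ⟨x, w, hx, hw⟩; exact ⟨⟨x, hx⟩, w, hw⟩

/-- The collection axiom for `Σ`-predicates. -/
theorem collection {R : Γ → Elem A → Elem A → Prop}
    (hR : IsSigma A fun p : (Γ × Elem A) × Elem A => R p.1.1 p.1.2 p.2) (g : Γ) (a : Elem A)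
    (h : ∀ x : Elem A, x.1 ∈ a.1 → ∃ y, R g x y) :
    ∃ b : Elem A, ∀ x : Elem A, x.1 ∈ a.1 → ∃ y : Elem A, y.1 ∈ b.1 ∧ R g x y := by
  obtain ⟨S, hS, hRS⟩ := hR
  have h1 : IsDelta0 A fun p : (Γ × Elem A) × Elem A => ∃ y : Elem A, y.1 ∈ p.2.1 ∧
      ∃ w : Elem A, w.1 ∈ p.2.1 ∧ S ((p.1, y), w) :=
    .bex (Or.inr ⟨_, Or.inl rfl, rfl⟩) (.bex (Or.inl ⟨_, Or.inr ⟨_, Or.inl rfl, rfl⟩, rfl⟩)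
      (hS.proj (((IsProj.fst.comp (.comp .fst .fst)).prodMk (.comp .snd .fst)).prodMk .snd)))
  obtain ⟨b, hb⟩ := h1.collection (R := fun g x u => ∃ y : Elem A, y.1 ∈ u.1 ∧
      ∃ w : Elem A, w.1 ∈ u.1 ∧ S (((g, x), y), w)) g a (by
    intro x hx
    obtain ⟨y, hy⟩ := h x hx
    obtain ⟨w, hw⟩ := (hRS ((g, x), y)).1 hy
    obtain ⟨u, hu⟩ := exists_pair_superset y w
    exact ⟨u, y, hu.1, w, hu.2, hw⟩)
  obtain ⟨c, hc, hcb⟩ := hA.out.union b.1 b.2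
  refine ⟨⟨c, hc⟩, fun x hx => ?_⟩
  obtain ⟨u, hu, y, hy, w, -, hw⟩ := hb x hx
  exact ⟨y, hcb u.1 hu y.1 hy, (hRS ((g, x), y)).2 ⟨w, hw⟩⟩

theorem ball_basic {t : Γ → Elem A} (ht : t ∈ Ctx.basic) {R : Γ → Elem A → Prop}
    (hR : IsSigma A fun p : Γ × Elem A => R p.1 p.2) :
    IsSigma A fun g => ∀ x : Elem A, x.1 ∈ (t g).1 → R g x := by
  obtain ⟨S, hS, hRS⟩ := hR
  have h1 : IsDelta0 A fun p : Γ × Elem A => ∀ x : Elem A, x.1 ∈ (t p.1).1 →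
      ∃ w : Elem A, w.1 ∈ p.2.1 ∧ S ((p.1, x), w) :=
    .ball (Or.inl ⟨t, ht, rfl⟩) (.bex (Or.inl ⟨_, Or.inr ⟨_, Or.inl rfl, rfl⟩, rfl⟩)
      (hS.proj (((IsProj.fst.comp (.comp .fst .fst)).prodMk (.comp .snd .fst)).prodMk .snd)))
  refine ⟨_, h1, fun g => ⟨fun h => ?_, ?_⟩⟩
  · exact hS.collection (R := fun g x w => S ((g, x), w)) g (t g)
      fun x hx => (hRS (g, x)).1 (h x hx)
  · rintro ⟨b, hb⟩ x hx
    obtain ⟨w, -, hw⟩ := hb x hx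
    exact (hRS (g, x)).2 ⟨w, hw⟩

end IsSigma

end Admissible

/-! ### `Δ`-predicates and `Σ`-functions -/

namespace Admissible

variable {A : ZFSet.{u}} {Γ Γ' Γ'' Δ : Type (u + 1)} [Ctx A Γ] [Ctx A Γ'] [Ctx A Γ''] [Ctx A Δ]

variable (A) in
/-- Predicates such that they and their negations are defined by `Σ`-formulas. -/
def IsDelta (R : Γ → Prop) : Prop := IsSigma A R ∧ IsSigma A fun g => ¬ R g

variable (A) in
/-- Set-valued functions that take values in `A` and have a `Σ`-definable graph. -/
structure IsFun (F : Γ → ZFSet.{u}) : Prop where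
  mem : ∀ g, F g ∈ A
  graph : IsSigma A fun p : Γ × Elem A => p.2.1 = F p.1

variable (A) in
/-- `Σ`-definable functions between contexts. -/
@[fun_prop]
def AFun (F : Γ → Δ) : Prop :=
  ∀ t : Δ → Elem A, t ∈ Ctx.basic → IsFun A fun g => (t (F g)).1

theorem IsFun.congr {F G : Γ → ZFSet.{u}} (h : IsFun A F) (hFG : ∀ g, G g = F g) : IsFun A G := by
  rwa [show G = F from funext hFG]

theorem IsDelta.congr {R S : Γ → Prop} (h : IsDelta A S) (hRS : ∀ g, R g ↔ S g) : IsDelta A R := by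
  rwa [show R = S from funext fun g => propext (hRS g)]

theorem IsDelta.not {R : Γ → Prop} (h : IsDelta A R) : IsDelta A fun g => ¬ R g :=
  ⟨h.2, h.1.congr fun _ => not_not⟩

theorem IsFun.proj {F : Γ → ZFSet.{u}} (hF : IsFun A F) {ρ : Γ' → Γ} (hρ : IsProj A ρ) :
    IsFun A fun g => F (ρ g) where
  mem _ := hF.mem _
  graph := hF.graph.proj ((hρ.comp .fst).prodMk .snd)

@[fun_prop]
theorem AFun.prodMk {F : Γ → Γ'} {G : Γ → Δ} (hF : AFun A F) (hG : AFun A G) :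
    AFun A fun g => (F g, G g) := by
  rintro t (⟨s, hs, rfl⟩ | ⟨s, hs, rfl⟩)
  · exact hF s hs
  · exact hG s hs

theorem IsFun.enc {C : Type (u + 1)} [Coded A C] {F : Γ → C} (hF : AFun A F) :
    IsFun A fun g => (Coded.enc (A := A) (F g)).1 := hF _ (Or.inl rfl)

theorem IsFun.val {F : Γ → Elem A} (hF : AFun A F) : IsFun A fun g => (F g).1 :=
  hF _ (Or.inl rfl)

variable [hA : Fact (IsAdmissible A)]

theorem IsDelta0.isDelta {R : Γ → Prop} (h : IsDelta0 A R) : IsDelta A R :=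
  ⟨h.isSigma, h.not.isSigma⟩

theorem IsDelta.and {R S : Γ → Prop} (hR : IsDelta A R) (hS : IsDelta A S) :
    IsDelta A fun g => R g ∧ S g :=
  ⟨hR.1.and hS.1, (hR.2.or hS.2).congr fun _ => not_and_or⟩

theorem IsDelta.or {R S : Γ → Prop} (hR : IsDelta A R) (hS : IsDelta A S) :
    IsDelta A fun g => R g ∨ S g :=
  ⟨hR.1.or hS.1, (hR.2.and hS.2).congr fun _ => not_or⟩

theorem IsDelta.imp {R S : Γ → Prop} (hR : IsDelta A R) (hS : IsDelta A S) :
    IsDelta A fun g => R g → S g := (hR.not.or hS).congr fun _ => imp_iff_not_or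

theorem IsFun.basic {t : Γ → Elem A} (ht : t ∈ Ctx.basic) : IsFun A fun g => (t g).1 where
  mem g := (t g).2
  graph := ((IsDelta0.eq (Or.inr ⟨_, Or.inl rfl, rfl⟩)
    (Or.inl ⟨t, ht, rfl⟩)).isSigma).congr fun _ => Subtype.ext_iff.symm

/-- A `Σ`-function may be substituted into a `Σ`-predicate. -/
theorem IsSigma.subst {F : Γ → ZFSet.{u}} (hF : IsFun A F) {R : Γ → ZFSet.{u} → Prop}
    (hR : IsSigma A fun p : Γ × Elem A => R p.1 p.2.1) : IsSigma A fun g => R g (F g) := by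
  refine (IsSigma.exists_elem (R := fun g x => x.1 = F g ∧ R g x.1) (hF.graph.and hR)).congr
    fun g => ⟨fun h => ⟨⟨F g, hF.mem g⟩, rfl, h⟩, ?_⟩
  rintro ⟨x, hx, h⟩
  rwa [← hx]

theorem IsDelta.subst {F : Γ → ZFSet.{u}} (hF : IsFun A F) {R : Γ → ZFSet.{u} → Prop}
    (hR : IsDelta A fun p : Γ × Elem A => R p.1 p.2.1) : IsDelta A fun g => R g (F g) :=
  ⟨.subst hF hR.1, .subst hF (R := fun g y => ¬ R g y) hR.2⟩

theorem IsDelta.mem {F G : Γ → ZFSet.{u}} (hF : IsFun A F) (hG : IsFun A G) :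
    IsDelta A fun g => F g ∈ G g :=
  .subst hF (R := fun g x => x ∈ G g) (.subst (R := fun (p : Γ × Elem A) y => p.2.1 ∈ y) (hG.proj .fst)
    (IsDelta0.mem (A := A) (Γ := (Γ × Elem A) × Elem A)
      (Or.inl ⟨_, Or.inr ⟨_, Or.inl rfl, rfl⟩, rfl⟩) (Or.inr ⟨_, Or.inl rfl, rfl⟩)).isDelta)

theorem IsDelta.eq {F G : Γ → ZFSet.{u}} (hF : IsFun A F) (hG : IsFun A G) :
    IsDelta A fun g => F g = G g :=
  .subst hF (R := fun g x => x = G g) (.subst (R := fun (p : Γ × Elem A) y => p.2.1 = y) (hG.proj .fst)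
    ((IsDelta0.eq (A := A) (Γ := (Γ × Elem A) × Elem A)
      (Or.inl ⟨_, Or.inr ⟨_, Or.inl rfl, rfl⟩, rfl⟩)
      (Or.inr ⟨_, Or.inl rfl, rfl⟩)).isDelta.congr fun _ => Subtype.ext_iff.symm))

theorem IsSigma.ball {F : Γ → ZFSet.{u}} (hF : IsFun A F) {R : Γ → Elem A → Prop}
    (hR : IsSigma A fun p : Γ × Elem A => R p.1 p.2) :
    IsSigma A fun g => ∀ x : Elem A, x.1 ∈ F g → R g x :=
  .subst hF (R := fun g y => ∀ x : Elem A, x.1 ∈ y → R g x) (.ball_basic (Or.inr ⟨_, Or.inl rfl, rfl⟩)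
    (R := fun (p : Γ × Elem A) x => R p.1 x) (hR.proj ((IsProj.fst.comp .fst).prodMk .snd)))

theorem IsSigma.bex {F : Γ → ZFSet.{u}} (hF : IsFun A F) {R : Γ → Elem A → Prop}
    (hR : IsSigma A fun p : Γ × Elem A => R p.1 p.2) :
    IsSigma A fun g => ∃ x : Elem A, x.1 ∈ F g ∧ R g x :=
  .exists_elem ((IsDelta.mem (.basic (Or.inr ⟨_, Or.inl rfl, rfl⟩)) (hF.proj .fst)).1.and hR)

theorem IsDelta.ball {F : Γ → ZFSet.{u}} (hF : IsFun A F) {R : Γ → Elem A → Prop}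
    (hR : IsDelta A fun p : Γ × Elem A => R p.1 p.2) :
    IsDelta A fun g => ∀ x : Elem A, x.1 ∈ F g → R g x :=
  ⟨.ball hF hR.1, (IsSigma.bex hF (R := fun g x => ¬ R g x) hR.2).congr fun _ => by push Not; rfl⟩

theorem IsDelta.bex {F : Γ → ZFSet.{u}} (hF : IsFun A F) {R : Γ → Elem A → Prop}
    (hR : IsDelta A fun p : Γ × Elem A => R p.1 p.2) :
    IsDelta A fun g => ∃ x : Elem A, x.1 ∈ F g ∧ R g x :=
  ⟨.bex hF hR.1, (IsSigma.ball hF (R := fun g x => ¬ R g x) hR.2).congr fun _ => by push Not; rfl⟩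

/-- The truth of a `Δ₀`-formula is a `Δ`-predicate when `Σ`-functions are substituted for its
variables. -/
theorem IsDelta.realize (φ : DeltaZero) : ∀ {Γ : Type (u + 1)} [Ctx A Γ] (e : ℕ → Γ → Elem A),
    (∀ k, IsFun A fun g => (e k g).1) → IsDelta A fun g => φ.Realize A fun k => e k g := by
  induction φ with
  | mem i j => exact fun e he => .mem (he i) (he j)
  | eq i j => exact fun e he => (IsDelta.eq (he i) (he j)).congr fun _ => Subtype.ext_iff
  | neg φ ih => exact fun e he => (ih e he).not
  | and φ ψ ih ih' => exact fun e he => (ih e he).and (ih' e he)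
  | ball j φ ih =>
    intro Γ _ e he
    refine IsDelta.ball (he j) (R := fun g x => φ.Realize A (consAssign x fun k => e k g)) ?_
    refine (ih (Γ := Γ × Elem A) (fun k p => consAssign p.2 (fun k => e k p.1) k) fun k => ?_)
    cases k with
    | zero => exact .basic (Or.inr ⟨_, Or.inl rfl, rfl⟩)
    | succ k => exact (he k).proj .fst

theorem IsSigma.comp {R : Δ → Prop} (hR : IsSigma A R) {F : Γ → Δ} (hF : AFun A F) :
    IsSigma A fun g => R (F g) := by
  obtain ⟨S, ⟨φ, e, he, hS⟩, hRS⟩ := hR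
  have h1 : IsSigma A fun p : Γ × Elem A => S (F p.1, p.2) := by
    refine (IsDelta.realize φ (Γ := Γ × Elem A) (fun k p => e k (F p.1, p.2)) fun k => ?_).1.congr
      fun p => hS _
    rcases basic_prod_elem (he k) with ⟨s, hs, h⟩ | h
    · rw [h]
      exact (hF s hs).proj .fst
    · rw [h]
      exact .basic (Or.inr ⟨_, Or.inl rfl, rfl⟩)
  exact (IsSigma.exists_elem (R := fun g x => S (F g, x)) h1).congr fun g => hRS _

theorem IsDelta.comp {R : Δ → Prop} (hR : IsDelta A R) {F : Γ → Δ} (hF : AFun A F) :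
    IsDelta A fun g => R (F g) := ⟨hR.1.comp hF, hR.2.comp hF⟩

theorem AFun.of_isProj {ρ : Γ → Δ} (h : IsProj A ρ) : AFun A ρ := fun t ht => .basic (h t ht)

@[fun_prop]
theorem AFun.id : AFun A fun g : Γ => g := .of_isProj .id

@[fun_prop]
theorem AFun.const (d : Δ) : AFun A fun _ : Γ => d := fun _ _ => .basic (Ctx.const_mem _)

theorem IsFun.comp {F : Δ → ZFSet.{u}} (hF : IsFun A F) {G : Γ → Δ} (hG : AFun A G) :
    IsFun A fun g => F (G g) where
  mem _ := hF.mem _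
  graph := hF.graph.comp (F := fun p : Γ × Elem A => (G p.1, p.2))
    (.prodMk (fun t ht => (hG t ht).proj .fst) (.of_isProj .snd))

@[fun_prop]
theorem AFun.comp {F : Γ' → Δ} (hF : AFun A F) {G : Γ → Γ'} (hG : AFun A G) :
    AFun A fun g => F (G g) := fun t ht => (hF t ht).comp hG

@[fun_prop]
theorem AFun.fst {F : Γ → Γ' × Δ} (hF : AFun A F) : AFun A fun g => (F g).1 :=
  AFun.comp (.of_isProj .fst) hF

@[fun_prop]
theorem AFun.snd {F : Γ → Γ' × Δ} (hF : AFun A F) : AFun A fun g => (F g).2 :=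
  AFun.comp (.of_isProj .snd) hF

theorem IsFun.const {a : ZFSet.{u}} (ha : a ∈ A) : IsFun A fun _ : Γ => a :=
  .basic (Ctx.const_mem ⟨a, ha⟩)

theorem AFun.of_enc {C : Type (u + 1)} [Coded A C] {F : Γ → C}
    (hF : IsFun A fun g => (Coded.enc (A := A) (F g)).1) : AFun A F := by
  rintro t (rfl | ⟨a, rfl⟩)
  · exact hF
  · exact .const a.2

end Admissible

/-! ### Quantifiers over coded types -/

namespace Admissible

variable {A : ZFSet.{u}} {Γ Γ' Γ'' Δ C : Type (u + 1)} [Ctx A Γ] [Ctx A Γ'] [Ctx A Γ''] [Ctx A Δ]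
  [Coded A C]

theorem IsProj.const (d : Δ) : IsProj A fun _ : Γ => d := fun _ _ => Ctx.const_mem _

/-- A `Σ`-predicate on codes extends to all elements of `A`. -/
theorem IsSigma.exists_extension {R : Γ → C → Prop} (hR : IsSigma A fun p : Γ × C => R p.1 p.2) :
    ∃ R' : Γ → Elem A → Prop, (IsSigma A fun p : Γ × Elem A => R' p.1 p.2) ∧
      ∀ g c, R' g (Coded.enc c) ↔ R g c := by
  obtain ⟨S, ⟨φ, e, he, hS⟩, hRS⟩ := hR
  have h : ∀ k, ∃ t : (Γ × Elem A) × Elem A → Elem A, t ∈ Ctx.basic ∧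
      ∀ g c w, t ((g, Coded.enc c), w) = e k ((g, c), w) := by
    intro k
    rcases basic_prod_elem (he k) with ⟨s, (⟨s, hs, rfl⟩ | ⟨s, rfl | ⟨a, rfl⟩, rfl⟩), h⟩ | h
    · exact ⟨_, Or.inl ⟨_, Or.inl ⟨s, hs, rfl⟩, rfl⟩, fun g c w => by rw [h]; rfl⟩
    · exact ⟨_, Or.inl ⟨_, Or.inr ⟨_, Or.inl rfl, rfl⟩, rfl⟩, fun g c w => by rw [h]; rfl⟩
    · exact ⟨_, Ctx.const_mem a, fun g c w => by rw [h]; rfl⟩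
    · exact ⟨_, Or.inr ⟨_, Or.inl rfl, rfl⟩, fun g c w => by rw [h]; rfl⟩
  choose t ht h using h
  refine ⟨fun g x => ∃ w, φ.Realize A fun k => t k ((g, x), w),
    ⟨fun q => φ.Realize A fun k => t k q, ⟨φ, t, ht, fun _ => Iff.rfl⟩, fun _ => Iff.rfl⟩,
    fun g c => ?_⟩
  refine Iff.trans (exists_congr fun w => ?_) (hRS (g, c)).symm
  rw [hS]
  simp only [h]

variable [hA : Fact (IsAdmissible A)]

theorem IsSigma.ball_enc {F : Γ → ZFSet.{u}} (hF : IsFun A F)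
    (hC : ∀ g, ∀ x ∈ F g, ∃ c : C, (Coded.enc (A := A) c).1 = x) {R : Γ → C → Prop}
    (hR : IsSigma A fun p : Γ × C => R p.1 p.2) :
    IsSigma A fun g => ∀ c : C, (Coded.enc (A := A) c).1 ∈ F g → R g c := by
  obtain ⟨R', hR', h⟩ := hR.exists_extension
  refine (IsSigma.ball hF hR').congr fun g => ⟨fun hg x hx => ?_, fun hg c hc => ?_⟩
  · obtain ⟨c, hc⟩ := hC g x.1 hx
    obtain rfl : Coded.enc c = x := Subtype.ext hc
    exact (h g c).2 (hg c hx)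
  · exact (h g c).1 (hg _ hc)

theorem IsSigma.bex_enc {F : Γ → ZFSet.{u}} (hF : IsFun A F)
    (hC : ∀ g, ∀ x ∈ F g, ∃ c : C, (Coded.enc (A := A) c).1 = x) {R : Γ → C → Prop}
    (hR : IsSigma A fun p : Γ × C => R p.1 p.2) :
    IsSigma A fun g => ∃ c : C, (Coded.enc (A := A) c).1 ∈ F g ∧ R g c := by
  obtain ⟨R', hR', h⟩ := hR.exists_extension
  refine (IsSigma.bex hF hR').congr fun g => ⟨?_, ?_⟩
  · rintro ⟨c, hc, hg⟩
    exact ⟨_, hc, (h g c).2 hg⟩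
  · rintro ⟨x, hx, hg⟩
    obtain ⟨c, hc⟩ := hC g x.1 hx
    obtain rfl : Coded.enc c = x := Subtype.ext hc
    exact ⟨c, hx, (h g c).1 hg⟩

theorem IsDelta.ball_enc {F : Γ → ZFSet.{u}} (hF : IsFun A F)
    (hC : ∀ g, ∀ x ∈ F g, ∃ c : C, (Coded.enc (A := A) c).1 = x) {R : Γ → C → Prop}
    (hR : IsDelta A fun p : Γ × C => R p.1 p.2) :
    IsDelta A fun g => ∀ c : C, (Coded.enc (A := A) c).1 ∈ F g → R g c :=
  ⟨.ball_enc hF hC hR.1,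
    (IsSigma.bex_enc hF hC (R := fun g c => ¬ R g c) hR.2).congr fun _ => by push Not; rfl⟩

theorem IsDelta.bex_enc {F : Γ → ZFSet.{u}} (hF : IsFun A F)
    (hC : ∀ g, ∀ x ∈ F g, ∃ c : C, (Coded.enc (A := A) c).1 = x) {R : Γ → C → Prop}
    (hR : IsDelta A fun p : Γ × C => R p.1 p.2) :
    IsDelta A fun g => ∃ c : C, (Coded.enc (A := A) c).1 ∈ F g ∧ R g c :=
  ⟨.bex_enc hF hC hR.1,
    (IsSigma.ball_enc hF hC (R := fun g c => ¬ R g c) hR.2).congr fun _ => by push Not; rfl⟩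

/-! ### Operations on sets -/

/-- Separation for `Δ`-predicates. -/
theorem IsDelta.exists_sep {R : Γ → ZFSet.{u} → Prop}
    (hR : IsDelta A fun p : Γ × Elem A => R p.1 p.2.1) (g : Γ) {a : ZFSet.{u}} (ha : a ∈ A) :
    ∃ b ∈ A, ∀ x, x ∈ b ↔ x ∈ a ∧ R g x := by
  obtain ⟨⟨S, hS, hRS⟩, T, hT, hRT⟩ := hR
  obtain ⟨b, hb⟩ := (hS.or hT).collection (R := fun g x w => S ((g, x), w) ∨ T ((g, x), w)) g
    ⟨a, ha⟩ (by
      intro x _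
      by_cases h : R g x.1
      · obtain ⟨w, hw⟩ := (hRS (g, x)).1 h
        exact ⟨w, Or.inl hw⟩
      · obtain ⟨w, hw⟩ := (hRT (g, x)).1 h
        exact ⟨w, Or.inr hw⟩)
  have h1 : IsDelta0 A fun p : Γ × Elem A => ∃ w : Elem A, w.1 ∈ b.1 ∧ S (p, w) :=
    .bex (R := fun p w => S (p, w)) (Ctx.const_mem b) hS
  obtain ⟨c, hc⟩ := h1.separation (R := fun g x => ∃ w : Elem A, w.1 ∈ b.1 ∧ S ((g, x), w)) g ⟨a, ha⟩
  refine ⟨c.1, c.2, fun x => ⟨fun hx => ?_, ?_⟩⟩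
  · obtain ⟨hxa, w, -, hw⟩ := (hc ⟨x, mem_of_mem hx c.2⟩).1 hx
    exact ⟨hxa, (hRS (g, ⟨x, _⟩)).2 ⟨w, hw⟩⟩
  · rintro ⟨hxa, hx⟩
    refine (hc ⟨x, mem_of_mem hxa ha⟩).2 ⟨hxa, ?_⟩
    obtain ⟨w, hwb, hw | hw⟩ := hb ⟨x, mem_of_mem hxa ha⟩ hxa
    · exact ⟨w, hwb, hw⟩
    · exact absurd hx ((hRT (g, ⟨x, _⟩)).2 ⟨w, hw⟩)

/-- Replacement for `Σ`-predicates. -/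
theorem IsSigma.exists_image {R : Γ → Elem A → Elem A → Prop}
    (hR : IsSigma A fun p : (Γ × Elem A) × Elem A => R p.1.1 p.1.2 p.2) (g : Γ) {a : ZFSet.{u}}
    (ha : a ∈ A) (h : ∀ x : Elem A, x.1 ∈ a → ∃ y, ∀ y', R g x y' ↔ y' = y) :
    ∃ b ∈ A, ∀ y, y ∈ b ↔ ∃ (x : Elem A) (hy : y ∈ A), x.1 ∈ a ∧ R g x ⟨y, hy⟩ := by
  obtain ⟨b, hb⟩ := hR.collection g ⟨a, ha⟩ fun x hx => (h x hx).imp fun y hy => (hy y).2 rfl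
  have h1 : IsSigma A fun y : Elem A => ∃ x : Elem A, x.1 ∈ a ∧ R g x y :=
    .bex (.const ha) (hR.proj (((IsProj.const g).prodMk .snd).prodMk .fst))
  have h2 : IsSigma A fun y : Elem A => ∀ x : Elem A, x.1 ∈ a → ∃ y', ¬ y' = y ∧ R g x y' := by
    refine .ball (.const ha) (.exists_elem (.and ?_ ?_))
    · exact ((IsDelta.eq (.val (by fun_prop)) (.val (by fun_prop))).congr
        fun p : (Elem A × Elem A) × Elem A => Subtype.ext_iff (a1 := p.2) (a2 := p.1.1)).2
    · exact hR.proj (((IsProj.const g).prodMk (.comp .snd .fst)).prodMk .snd)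
  have h3 : IsDelta A fun y : Elem A => ∃ x : Elem A, x.1 ∈ a ∧ R g x y := by
    refine ⟨h1, h2.congr fun y => ?_⟩
    push Not
    refine forall_congr' fun x => forall_congr' fun hx => ?_
    obtain ⟨z, hz⟩ := h x hx
    simp only [hz]
    constructor
    · exact fun h => ⟨z, fun h' => h h'.symm, rfl⟩
    · rintro ⟨_, h, rfl⟩ h'
      exact h h'.symm
  obtain ⟨c, hc, hcb⟩ := IsDelta.exists_sep (Γ := PUnit)
    (R := fun _ y => ∃ hy : y ∈ A, ∃ x : Elem A, x.1 ∈ a ∧ R g x ⟨y, hy⟩)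
    ((h3.comp (F := fun p : PUnit × Elem A => p.2) (by fun_prop)).congr
      fun p => ⟨fun h => h.2, fun h => ⟨p.2.2, h⟩⟩) PUnit.unit b.2
  refine ⟨c, hc, fun y => (hcb y).trans ⟨?_, ?_⟩⟩
  · rintro ⟨-, hy, x, hx⟩
    exact ⟨x, hy, hx⟩
  · rintro ⟨x, hy, hxa, hx⟩
    refine ⟨?_, hy, x, hxa, hx⟩
    obtain ⟨y', hy'b, hy'⟩ := hb x hxa
    obtain ⟨z, hz⟩ := h x hxa
    rwa [(hz _).1 hy', ← (hz _).1 hx] at hy'b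

namespace IsFun

theorem of_sep {F G : Γ → ZFSet.{u}} (hG : IsFun A G) {R : Γ → ZFSet.{u} → Prop}
    (hR : IsDelta A fun p : Γ × Elem A => R p.1 p.2.1) (h : ∀ g z, z ∈ F g ↔ z ∈ G g ∧ R g z) :
    IsFun A F where
  mem g := by
    obtain ⟨b, hb, hbF⟩ := hR.exists_sep g (hG.mem g)
    rwa [show F g = b from ZFSet.ext fun z => (h g z).trans (hbF z).symm]
  graph := by
    have h1 : IsDelta A fun p : Γ × Elem A =>
        (∀ x : Elem A, x.1 ∈ p.2.1 → x.1 ∈ G p.1 ∧ R p.1 x.1) ∧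
          ∀ x : Elem A, x.1 ∈ G p.1 → R p.1 x.1 → x.1 ∈ p.2.1 := by
      have h2 : IsDelta A fun p : (Γ × Elem A) × Elem A => R p.1.1 p.2.1 :=
        hR.comp (F := fun p : (Γ × Elem A) × Elem A => (p.1.1, p.2)) (by fun_prop)
      refine .and (.ball (.val (by fun_prop)) (.and (.mem (.val (by fun_prop))
        (hG.comp (by fun_prop))) h2)) (.ball (hG.comp (by fun_prop)) (h2.imp
          (.mem (.val (by fun_prop)) (.val (by fun_prop)))))
    refine h1.1.congr fun p => ⟨fun hp => ?_, fun hp => ZFSet.ext fun z => ?_⟩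
    · rw [hp]
      exact ⟨fun x hx => (h _ _).1 hx, fun x hx hR => (h _ _).2 ⟨hx, hR⟩⟩
    · rw [h]
      exact ⟨fun hz => hp.1 ⟨z, mem_of_mem hz p.2.2⟩ hz,
        fun hz => hp.2 ⟨z, mem_of_mem hz.1 (hG.mem _)⟩ hz.1 hz.2⟩

theorem of_image {F G : Γ → ZFSet.{u}} (hG : IsFun A G) {K : Γ → Elem A → ZFSet.{u}}
    (hK : IsFun A fun p : Γ × Elem A => K p.1 p.2)
    (h : ∀ g z, z ∈ F g ↔ ∃ x : Elem A, x.1 ∈ G g ∧ z = K g x) : IsFun A F where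
  mem g := by
    obtain ⟨b, hb, hbF⟩ := IsSigma.exists_image (R := fun g x y => y.1 = K g x) hK.graph g
      (hG.mem g) fun x _ => ⟨⟨K g x, hK.mem (g, x)⟩, fun y => ⟨fun h => Subtype.ext h,
        fun h => congrArg Subtype.val h⟩⟩
    rwa [show F g = b from ZFSet.ext fun z => ?_]
    rw [h, hbF]
    exact ⟨fun ⟨x, hx, hz⟩ => ⟨x, hz ▸ hK.mem (g, x), hx, hz⟩, fun ⟨x, _, hx, hz⟩ => ⟨x, hx, hz⟩⟩
  graph := by
    have h1 : IsSigma A fun p : Γ × Elem A =>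
        (∀ z : Elem A, z.1 ∈ p.2.1 → ∃ x : Elem A, x.1 ∈ G p.1 ∧ z.1 = K p.1 x) ∧
          ∀ x : Elem A, x.1 ∈ G p.1 → K p.1 x ∈ p.2.1 := by
      refine .and (.ball (.val (by fun_prop)) (.bex (hG.comp (by fun_prop)) ?_))
        (.ball (hG.comp (by fun_prop)) ?_)
      · exact (IsDelta.eq (.val (by fun_prop)) (hK.comp (G := fun p :
          ((Γ × Elem A) × Elem A) × Elem A => (p.1.1.1, p.2)) (by fun_prop))).1
      · exact (IsDelta.mem (hK.comp (G := fun p :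
          (Γ × Elem A) × Elem A => (p.1.1, p.2)) (by fun_prop)) (.val (by fun_prop))).1
    refine h1.congr fun p => ⟨fun hp => ?_, fun hp => ZFSet.ext fun z => ?_⟩
    · rw [hp]
      exact ⟨fun x hx => (h _ _).1 hx, fun x hx => (h _ _).2 ⟨x, hx, rfl⟩⟩
    · rw [h]
      refine ⟨fun hz => hp.1 ⟨z, mem_of_mem hz p.2.2⟩ hz, ?_⟩
      rintro ⟨x, hx, rfl⟩
      exact hp.2 x hx

theorem sUnion {G : Γ → ZFSet.{u}} (hG : IsFun A G) : IsFun A fun g => ZFSet.sUnion (G g) where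
  mem g := by
    obtain ⟨b, hb, h⟩ := hA.out.union _ (hG.mem g)
    have h1 : IsDelta A fun p : PUnit × Elem A => ∃ y : Elem A, y.1 ∈ G g ∧ p.2.1 ∈ y.1 :=
      .bex (.const (hG.mem g)) (.mem (.val (by fun_prop)) (.val (by fun_prop)))
    obtain ⟨c, hc, hcb⟩ := IsDelta.exists_sep (Γ := PUnit)
      (R := fun _ x => ∃ y : Elem A, y.1 ∈ G g ∧ x ∈ y.1) h1 PUnit.unit hb
    rwa [show ZFSet.sUnion (G g) = c from ZFSet.ext fun z => ?_]
    rw [hcb, ZFSet.mem_sUnion]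
    exact ⟨fun ⟨y, hy, hz⟩ => ⟨h y hy z hz, ⟨y, mem_of_mem hy (hG.mem g)⟩, hy, hz⟩,
      fun ⟨_, y, hy, hz⟩ => ⟨y.1, hy, hz⟩⟩
  graph := by
    have h1 : IsDelta A fun p : Γ × Elem A =>
        (∀ z : Elem A, z.1 ∈ p.2.1 → ∃ x : Elem A, x.1 ∈ G p.1 ∧ z.1 ∈ x.1) ∧
          ∀ x : Elem A, x.1 ∈ G p.1 → ∀ z : Elem A, z.1 ∈ x.1 → z.1 ∈ p.2.1 :=
      .and (.ball (.val (by fun_prop)) (.bex (hG.comp (by fun_prop))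
        (.mem (.val (by fun_prop)) (.val (by fun_prop)))))
        (.ball (hG.comp (by fun_prop)) (.ball (.val (by fun_prop))
        (.mem (.val (by fun_prop)) (.val (by fun_prop)))))
    refine h1.1.congr fun p => ⟨fun hp => ?_, fun hp => ZFSet.ext fun z => ?_⟩
    · rw [hp]
      refine ⟨fun z hz => ?_, fun x hx z hz => ZFSet.mem_sUnion_of_mem hz hx⟩
      obtain ⟨y, hy, hz⟩ := ZFSet.mem_sUnion.1 hz
      exact ⟨⟨y, mem_of_mem hy (hG.mem _)⟩, hy, hz⟩
    · rw [ZFSet.mem_sUnion]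
      constructor
      · intro hz
        obtain ⟨x, hx, hz⟩ := hp.1 ⟨z, mem_of_mem hz p.2.2⟩ hz
        exact ⟨x.1, hx, hz⟩
      · rintro ⟨y, hy, hz⟩
        have hyA := mem_of_mem hy (hG.mem _)
        exact hp.2 ⟨y, hyA⟩ hy ⟨z, mem_of_mem hz hyA⟩ hz

theorem insert_singleton {F G : Γ → ZFSet.{u}} (hF : IsFun A F) (hG : IsFun A G) :
    IsFun A fun g => ({F g, G g} : ZFSet.{u}) where
  mem g := by
    obtain ⟨b, hb, h1, h2⟩ := hA.out.pairing _ (hF.mem g) _ (hG.mem g)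
    have h : IsDelta A fun p : PUnit × Elem A => p.2.1 = F g ∨ p.2.1 = G g :=
      .or (.eq (.val (by fun_prop)) (.const (hF.mem g))) (.eq (.val (by fun_prop))
        (.const (hG.mem g)))
    obtain ⟨c, hc, hcb⟩ := IsDelta.exists_sep (Γ := PUnit)
      (R := fun _ x => x = F g ∨ x = G g) h PUnit.unit hb
    rwa [show {F g, G g} = c from ZFSet.ext fun z => ?_]
    rw [hcb, ZFSet.mem_pair]
    refine ⟨fun hz => ⟨?_, hz⟩, fun hz => hz.2⟩
    rcases hz with rfl | rfl <;> assumption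
  graph := by
    have h1 : IsDelta A fun p : Γ × Elem A => (∀ z : Elem A, z.1 ∈ p.2.1 → z.1 = F p.1 ∨
        z.1 = G p.1) ∧ F p.1 ∈ p.2.1 ∧ G p.1 ∈ p.2.1 :=
      .and (.ball (.val (by fun_prop)) (.or (.eq (.val (by fun_prop)) (hF.comp (by fun_prop)))
        (.eq (.val (by fun_prop)) (hG.comp (by fun_prop)))))
        (.and (.mem (hF.comp (by fun_prop)) (.val (by fun_prop)))
          (.mem (hG.comp (by fun_prop)) (.val (by fun_prop))))
    refine h1.1.congr fun p => ⟨fun hp => ?_, fun hp => ZFSet.ext fun z => ?_⟩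
    · rw [hp]
      simp
    · rw [ZFSet.mem_pair]
      refine ⟨fun hz => hp.1 ⟨z, mem_of_mem hz p.2.2⟩ hz, ?_⟩
      rintro (rfl | rfl)
      exacts [hp.2.1, hp.2.2]

theorem singleton {F : Γ → ZFSet.{u}} (hF : IsFun A F) :
    IsFun A fun g => ({F g} : ZFSet.{u}) :=
  (hF.insert_singleton hF).congr fun _ => (ZFSet.pair_eq_singleton _).symm

theorem union {F G : Γ → ZFSet.{u}} (hF : IsFun A F) (hG : IsFun A G) :
    IsFun A fun g => F g ∪ G g := (hF.insert_singleton hG).sUnion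

theorem insert {F G : Γ → ZFSet.{u}} (hF : IsFun A F) (hG : IsFun A G) :
    IsFun A fun g => insert (F g) (G g) :=
  (hF.singleton.union hG).congr fun _ => ZFSet.insert_eq _ _

theorem pair {F G : Γ → ZFSet.{u}} (hF : IsFun A F) (hG : IsFun A G) :
    IsFun A fun g => ZFSet.pair (F g) (G g) := hF.singleton.insert_singleton (hF.insert_singleton hG)

theorem of_biUnion {F G : Γ → ZFSet.{u}} (hG : IsFun A G) {K : Γ → Elem A → ZFSet.{u}}
    (hK : IsFun A fun p : Γ × Elem A => K p.1 p.2)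
    (h : ∀ g z, z ∈ F g ↔ ∃ x : Elem A, x.1 ∈ G g ∧ z ∈ K g x) : IsFun A F := by
  have hs : ∀ g, Small.{u} {x : Elem A // x.1 ∈ G g} := fun g =>
    small_of_injective (β := {x // x ∈ G g}) (f := fun x => ⟨x.1.1, x.2⟩)
      fun x y hxy => Subtype.ext (Subtype.ext (Subtype.mk.inj hxy))
  have h1 : IsFun A fun g => ZFSet.range fun x : {x : Elem A // x.1 ∈ G g} => K g x.1 :=
    of_image hG hK fun g z => by simp [eq_comm]
  refine h1.sUnion.congr fun g => ZFSet.ext fun z => ?_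
  rw [h, ZFSet.mem_sUnion]
  constructor
  · rintro ⟨x, hx, hz⟩
    exact ⟨_, ZFSet.mem_range.2 ⟨⟨x, hx⟩, rfl⟩, hz⟩
  · rintro ⟨y, hy, hz⟩
    obtain ⟨⟨x, hx⟩, rfl⟩ := ZFSet.mem_range.1 hy
    exact ⟨x, hx, hz⟩

theorem prod {F G : Γ → ZFSet.{u}} (hF : IsFun A F) (hG : IsFun A G) :
    IsFun A fun g => ZFSet.prod (F g) (G g) := by
  have h1 : IsFun A fun p : Γ × Elem A => ZFSet.prod {p.2.1} (G p.1) :=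
    of_image (K := fun p y => ZFSet.pair p.2.1 y.1) (hG.proj .fst)
      (.pair (.val (by fun_prop)) (.val (by fun_prop))) fun p z => by
        simp only [ZFSet.mem_prod, ZFSet.mem_singleton, exists_eq_left]
        exact ⟨fun ⟨y, hy, h⟩ => ⟨⟨y, mem_of_mem hy (hG.mem _)⟩, hy, h⟩, fun ⟨y, h⟩ => ⟨y.1, h⟩⟩
  refine of_biUnion (K := fun g x => ZFSet.prod {x.1} (G g)) hF h1 fun g z => ?_
  simp only [ZFSet.mem_prod, ZFSet.mem_singleton, exists_eq_left]
  exact ⟨fun ⟨x, hx, h⟩ => ⟨⟨x, mem_of_mem hx (hF.mem _)⟩, hx, h⟩, fun ⟨x, h⟩ => ⟨x.1, h⟩⟩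

end IsFun

end Admissible

/-! ### Definitions by `Σ`-recursion -/

namespace Admissible

variable {A : ZFSet.{u}} {Γ C : Type (u + 1)} [Ctx A Γ] [Coded A C]

variable (A) in
/-- The set `f` is the graph of the function `F` on the predecessors of `c` with respect to `r`. -/
def IsGraphBelow (r : C → C → Prop) (F : C → ZFSet.{u}) (c : C) (f : ZFSet.{u}) : Prop :=
  ∀ z, z ∈ f ↔ ∃ c', r c' c ∧ z = ZFSet.pair (Coded.enc (A := A) c').1 (F c')

/-- All elements of `f` are pairs whose first components are codes in `P`, and each element of
`P` occurs as a first component. -/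
def HasDomain (C : Type (u + 1)) [Coded A C] (P f : ZFSet.{u}) : Prop :=
  (∀ z : Elem A, z.1 ∈ f → ∃ c : C, (Coded.enc (A := A) c).1 ∈ P ∧
    ∃ y : Elem A, z.1 = ZFSet.pair (Coded.enc (A := A) c).1 y.1) ∧
  ∀ c : C, (Coded.enc (A := A) c).1 ∈ P →
    ∃ y : Elem A, ZFSet.pair (Coded.enc (A := A) c).1 y.1 ∈ f

/-- Each element of `f` is justified by the step relation of the recursion, applied to the
restriction of `f` to predecessors. -/
def IsApprox (P : C → ZFSet.{u}) (Step : C → Elem A → Elem A → Prop) (c : C) (f : Elem A) : Prop :=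
  HasDomain (A := A) C (P c) f.1 ∧ ∀ z : Elem A, z.1 ∈ f.1 → ∃ c' : C,
    (Coded.enc (A := A) c').1 ∈ P c ∧ ∃ y f' : Elem A,
      z.1 = ZFSet.pair (Coded.enc (A := A) c').1 y.1 ∧ (∀ x : Elem A, x.1 ∈ f'.1 → x.1 ∈ f.1) ∧
        HasDomain (A := A) C (P c') f'.1 ∧ Step c' f' y

variable [hA : Fact (IsAdmissible A)]

theorem isSigma_hasDomain {P F : Γ → ZFSet.{u}} (hP : IsFun A P) (hF : IsFun A F)
    (hC : ∀ g, ∀ x ∈ P g, ∃ c : C, (Coded.enc (A := A) c).1 = x) :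
    IsSigma A fun g => HasDomain (A := A) C (P g) (F g) := by
  refine .and (.ball hF (.bex_enc (hP.proj .fst) (fun g => hC g.1) (.exists_elem ?_)))
    (.ball_enc hP hC (.exists_elem ?_))
  · exact (IsDelta.eq (.val (by fun_prop)) (.pair (.enc (by fun_prop)) (.val (by fun_prop)))).1
  · exact (IsDelta.mem (.pair (.enc (by fun_prop)) (.val (by fun_prop)))
      (hF.comp (G := fun p : (Γ × C) × Elem A => p.1.1) (by fun_prop))).1

theorem isSigma_isApprox {P : Γ → C → ZFSet.{u}} (hP : IsFun A fun p : Γ × C => P p.1 p.2)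
    (hC : ∀ g c, ∀ x ∈ P g c, ∃ c' : C, (Coded.enc (A := A) c').1 = x)
    {Step : Γ → C → Elem A → Elem A → Prop}
    (hS : IsSigma A fun p : ((Γ × C) × Elem A) × Elem A => Step p.1.1.1 p.1.1.2 p.1.2 p.2) :
    IsSigma A fun p : (Γ × C) × Elem A => IsApprox (P p.1.1) (Step p.1.1) p.1.2 p.2 := by
  refine .and (isSigma_hasDomain (hP.comp (G := fun p : (Γ × C) × Elem A => p.1) (by fun_prop))
    (.val (by fun_prop)) fun g => hC _ _) (.ball (.val (by fun_prop)) (.bex_enc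
      (hP.comp (G := fun p : ((Γ × C) × Elem A) × Elem A => p.1.1) (by fun_prop))
      (fun g => hC _ _) (.exists_elem (.exists_elem (.and ?_ (.and ?_ (.and ?_ ?_)))))))
  · exact (IsDelta.eq (.val (by fun_prop)) (.pair (.enc (by fun_prop)) (.val (by fun_prop)))).1
  · exact .ball (.val (by fun_prop)) (IsDelta.mem (.val (by fun_prop)) (.val (by fun_prop))).1
  · exact isSigma_hasDomain (hP.comp (G := fun p : ((((((Γ × C) × Elem A) × Elem A) × C) × Elem A) ×
      Elem A) => (p.1.1.1.1.1.1, p.1.1.2)) (by fun_prop)) (.val (by fun_prop)) fun g => hC _ _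
  · exact hS.comp (F := fun p : ((((((Γ × C) × Elem A) × Elem A) × C) × Elem A) ×
      Elem A) => (((p.1.1.1.1.1.1, p.1.1.2), p.2), p.1.2)) (by fun_prop)

/-- The principle of `Σ`-recursion along a well-founded transitive relation `r` on a coded type,
with parameters: a function `F` is a `Σ`-function if its value at `c` is determined by a
`Σ`-definable relation `Step` from its restriction to the set of predecessors of `c`. -/
theorem IsFun.recursion (henc : Function.Injective (Coded.enc (A := A) (C := C)))
    {r : Γ → C → C → Prop} (hwf : ∀ g, WellFounded (r g))
    (htrans : ∀ g a b c, r g a b → r g b c → r g a c)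
    {P : Γ → C → ZFSet.{u}} (hP : IsFun A fun p : Γ × C => P p.1 p.2)
    (hPr : ∀ g c x, x ∈ P g c ↔ ∃ c', r g c' c ∧ (Coded.enc (A := A) c').1 = x)
    {F : Γ → C → ZFSet.{u}} {Step : Γ → C → Elem A → Elem A → Prop}
    (hS : IsSigma A fun p : ((Γ × C) × Elem A) × Elem A => Step p.1.1.1 p.1.1.2 p.1.2 p.2)
    (h : ∀ g c (f : Elem A), IsGraphBelow A (r g) (F g) c f.1 →
      F g c ∈ A ∧ ∀ y : Elem A, Step g c f y ↔ y.1 = F g c) :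
    IsFun A fun p : Γ × C => F p.1 p.2 := by
  have hPenc : ∀ g c c', (Coded.enc (A := A) c').1 ∈ P g c ↔ r g c' c := by
    intro g c c'
    rw [hPr]
    constructor
    · rintro ⟨c'', hc, he⟩
      rwa [← henc (Subtype.ext he)]
    · exact fun hc => ⟨c', hc, rfl⟩
  have hC : ∀ g c, ∀ x ∈ P g c, ∃ c' : C, (Coded.enc (A := A) c').1 = x := fun g c x hx =>
    ((hPr g c x).1 hx).imp fun _ h => h.2
  have hApprox := isSigma_isApprox hP hC hS
  have hgraph : ∀ g c (f : Elem A), IsApprox (P g) (Step g) c f →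
      IsGraphBelow A (r g) (F g) c f.1 := by
    rintro g c f ⟨hdom, hf⟩
    -- along `r`, the values of an approximation agree with those of `F`
    have hval : ∀ c', r g c' c → ∀ y, ZFSet.pair (Coded.enc (A := A) c').1 y ∈ f.1 → y = F g c' := by
      intro c'
      induction c' using (hwf g).induction with
      | h c' ih =>
      intro hc' y hy
      obtain ⟨c'', hc'', y', f', hz, hsub, hdom', hstep⟩ := hf ⟨_, mem_of_mem hy f.2⟩ hy
      obtain ⟨he, rfl⟩ := ZFSet.pair_injective hz
      obtain rfl := henc (Subtype.ext he)
      refine ((h g c' f' fun z => ⟨fun hz => ?_, ?_⟩).2 y').1 hstep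
      · obtain ⟨d, hd, w, hw⟩ := hdom'.1 ⟨z, mem_of_mem hz f'.2⟩ hz
        have hd' := (hPenc _ _ _).1 hd
        refine ⟨d, hd', ?_⟩
        have hw' : z = _ := hw
        rw [hw', ← ih d hd' (htrans g _ _ _ hd' hc') w.1 ?_]
        rw [← hw']
        exact hsub ⟨z, mem_of_mem hz f'.2⟩ hz
      · rintro ⟨d, hd, rfl⟩
        obtain ⟨w, hw⟩ := hdom'.2 d ((hPenc _ _ _).2 hd)
        rwa [← ih d hd (htrans g _ _ _ hd hc') w.1 (hsub ⟨_, mem_of_mem hw f'.2⟩ hw)]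
    intro z
    constructor
    · intro hz
      obtain ⟨d, hd, w, hw⟩ := hdom.1 ⟨z, mem_of_mem hz f.2⟩ hz
      have hd' := (hPenc _ _ _).1 hd
      have hw' : z = _ := hw
      refine ⟨d, hd', ?_⟩
      rw [hw', ← hval d hd' w.1 (hw' ▸ hz)]
    · rintro ⟨d, hd, rfl⟩
      obtain ⟨w, hw⟩ := hdom.2 d ((hPenc _ _ _).2 hd)
      rwa [← hval d hd w.1 hw]
  have hdomain : ∀ g c f, (∀ c', r g c' c → F g c' ∈ A) → IsGraphBelow A (r g) (F g) c f →
      HasDomain (A := A) C (P g c) f := by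
    intro g c f hFA hf
    refine ⟨fun z hz => ?_, fun d hd => ?_⟩
    · obtain ⟨d, hd, hz⟩ := (hf _).1 hz
      exact ⟨d, (hPenc _ _ _).2 hd, ⟨_, hFA d hd⟩, hz⟩
    · have hd' := (hPenc _ _ _).1 hd
      exact ⟨⟨_, hFA d hd'⟩, (hf _).2 ⟨d, hd', rfl⟩⟩
  -- the approximation at `c` arises by replacement from the ones at the predecessors of `c`
  have hex : ∀ g c, F g c ∈ A ∧ ∃ f : Elem A, IsApprox (P g) (Step g) c f := by
    intro g c
    induction c using (hwf g).induction with
    | h c ih =>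
    have hQ : IsSigma A fun p : (Γ × Elem A) × C => ∃ f y : Elem A,
        IsApprox (P p.1.1) (Step p.1.1) p.2 f ∧ Step p.1.1 p.2 f y ∧
          p.1.2.1 = ZFSet.pair (Coded.enc (A := A) p.2).1 y.1 := by
      refine .exists_elem (.exists_elem (.and ?_ (.and ?_ ?_)))
      · exact hApprox.comp (F := fun p : (((Γ × Elem A) × C) × Elem A) × Elem A =>
          ((p.1.1.1.1, p.1.1.2), p.1.2)) (by fun_prop)
      · exact hS.comp (F := fun p : (((Γ × Elem A) × C) × Elem A) × Elem A =>
          (((p.1.1.1.1, p.1.1.2), p.1.2), p.2)) (by fun_prop)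
      · exact (IsDelta.eq (.val (by fun_prop))
          (.pair (.enc (by fun_prop)) (.val (by fun_prop)))).1
    obtain ⟨R, hR, hRQ⟩ := IsSigma.exists_extension (R := fun (p : Γ × Elem A) c => ∃ f y : Elem A,
        IsApprox (P p.1) (Step p.1) c f ∧ Step p.1 c f y ∧
          p.2.1 = ZFSet.pair (Coded.enc (A := A) c).1 y.1) hQ
    have hRd : ∀ d, r g d c → ∀ z : Elem A, R (g, z) (Coded.enc d) ↔
        z.1 = ZFSet.pair (Coded.enc (A := A) d).1 (F g d) := by
      intro d hd z
      rw [hRQ]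
      obtain ⟨hFA, f, hf⟩ := ih d hd
      constructor
      · rintro ⟨f, y, hf, hy, hz⟩
        rw [hz, ← ((h g d f (hgraph g d f hf)).2 y).1 hy]
      · exact fun hz => ⟨f, ⟨_, hFA⟩, hf, ((h g d f (hgraph g d f hf)).2 _).2 rfl, hz⟩
    obtain ⟨b, hb, hbR⟩ := IsSigma.exists_image (R := fun g x z => R (g, z) x)
      (hR.comp (F := fun p : (Γ × Elem A) × Elem A => ((p.1.1, p.2), p.1.2)) (by fun_prop)) g
      (hP.mem (g, c)) (by
        intro x hx
        obtain ⟨d, hd, hdx⟩ := (hPr g c x.1).1 hx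
        obtain rfl : Coded.enc d = x := Subtype.ext hdx
        refine ⟨⟨_, (IsFun.pair (.const (Coded.enc (A := A) d).2)
          (.const (ih d hd).1)).mem PUnit.unit⟩, fun z => (hRd d hd z).trans ?_⟩
        exact ⟨fun h => Subtype.ext h, fun h => congrArg Subtype.val h⟩)
    have hbg : IsGraphBelow A (r g) (F g) c b := by
      intro z
      rw [hbR]
      constructor
      · rintro ⟨x, hz, hx, hR⟩
        obtain ⟨d, hd, hdx⟩ := (hPr g c x.1).1 hx
        obtain rfl : Coded.enc d = x := Subtype.ext hdx
        exact ⟨d, hd, (hRd d hd _).1 hR⟩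
      · rintro ⟨d, hd, rfl⟩
        exact ⟨Coded.enc d, (IsFun.pair (.const (Coded.enc (A := A) d).2)
          (.const (ih d hd).1)).mem PUnit.unit, (hPenc _ _ _).2 hd, (hRd d hd _).2 rfl⟩
    refine ⟨(h g c ⟨b, hb⟩ hbg).1, ⟨b, hb⟩, hdomain g c b (fun d hd => (ih d hd).1) hbg, ?_⟩
    intro z hz
    obtain ⟨d, hd, hz'⟩ := (hbg _).1 hz
    obtain ⟨hFA, f, hf⟩ := ih d hd
    refine ⟨d, (hPenc _ _ _).2 hd, ⟨_, hFA⟩, f, hz', fun x hx => ?_, hf.1,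
      ((h g d f (hgraph g d f hf)).2 _).2 rfl⟩
    obtain ⟨e, he, hx⟩ := (hgraph g d f hf _).1 hx
    exact (hbg _).2 ⟨e, htrans g _ _ _ he hd, hx⟩
  refine ⟨fun p => (hex p.1 p.2).1, ?_⟩
  have h1 : IsSigma A fun p : (Γ × C) × Elem A => ∃ f : Elem A,
      IsApprox (P p.1.1) (Step p.1.1) p.1.2 f ∧ Step p.1.1 p.1.2 f p.2 := by
    refine .exists_elem (.and ?_ ?_)
    · exact hApprox.comp (F := fun p : ((Γ × C) × Elem A) × Elem A => (p.1.1, p.2)) (by fun_prop)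
    · exact hS.comp (F := fun p : ((Γ × C) × Elem A) × Elem A => ((p.1.1, p.2), p.1.2))
        (by fun_prop)
  refine h1.congr fun p => ⟨fun hp => ?_, ?_⟩
  · obtain ⟨-, f, hf⟩ := hex p.1.1 p.1.2
    exact ⟨f, hf, ((h _ _ f (hgraph _ _ f hf)).2 _).2 hp⟩
  · rintro ⟨f, hf, hp⟩
    exact ((h _ _ f (hgraph _ _ f hf)).2 _).1 hp

end Admissible

/-! ### Ordinals and natural numbers in an admissible set -/

namespace Admissible

variable {A : ZFSet.{u}} {Γ Δ C C' : Type (u + 1)} [Ctx A Γ] [Ctx A Δ] [Coded A C] [Coded A C']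

variable (A) in
/-- The ordinals in `A`. -/
def Ord : Type (u + 1) := {α : Ordinal.{u} // α.toZFSet ∈ A}

noncomputable instance : Coded A (Ord A) := ⟨fun α => ⟨α.1.toZFSet, α.2⟩⟩

theorem enc_ord (α : Ord A) : (Coded.enc (A := A) α).1 = α.1.toZFSet := rfl

theorem Ord.exists_iff {x : Elem A} : (∃ α : Ord A, Coded.enc α = x) ↔ x.1.IsOrdinal := by
  rw [ZFSet.isOrdinal_iff_mem_range_toZFSet]
  constructor
  · rintro ⟨α, rfl⟩
    exact ⟨α.1, rfl⟩
  · rintro ⟨α, hα⟩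
    exact ⟨⟨α, hα ▸ x.2⟩, Subtype.ext hα⟩

/-- The natural numbers, in the universe of the coded types. -/
structure Idx : Type (u + 1) where
  /-- the natural number -/
  val : ℕ

variable [hA : Fact (IsAdmissible A)]

theorem IsFun.of_pair_left {F G : Γ → ZFSet.{u}} (h : IsFun A fun g => ZFSet.pair (F g) (G g)) :
    IsFun A F where
  mem g := mem_of_mem (ZFSet.mem_singleton.2 rfl) (mem_of_mem (ZFSet.mem_pair.2 (Or.inl rfl))
    (h.mem g))
  graph := by
    have h1 : IsSigma A fun p : Γ × Elem A => ∃ z : Elem A,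
        ZFSet.pair p.2.1 z.1 = ZFSet.pair (F p.1) (G p.1) :=
      .exists_elem (IsDelta.eq (.pair (.val (by fun_prop)) (.val (by fun_prop)))
        (h.comp (by fun_prop))).1
    refine h1.congr fun p => ⟨fun hp => ⟨⟨G p.1, ?_⟩, by rw [hp]⟩, ?_⟩
    · exact mem_of_mem (ZFSet.mem_pair.2 (Or.inr rfl)) (mem_of_mem (ZFSet.mem_pair.2 (Or.inr rfl))
        (h.mem p.1))
    · rintro ⟨z, hz⟩
      exact (ZFSet.pair_injective hz).1

theorem IsFun.of_pair_right {F G : Γ → ZFSet.{u}} (h : IsFun A fun g => ZFSet.pair (F g) (G g)) :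
    IsFun A G where
  mem g := mem_of_mem (ZFSet.mem_pair.2 (Or.inr rfl)) (mem_of_mem (ZFSet.mem_pair.2 (Or.inr rfl))
    (h.mem g))
  graph := by
    have h1 : IsSigma A fun p : Γ × Elem A => ∃ z : Elem A,
        ZFSet.pair z.1 p.2.1 = ZFSet.pair (F p.1) (G p.1) :=
      .exists_elem (IsDelta.eq (.pair (.val (by fun_prop)) (.val (by fun_prop)))
        (h.comp (by fun_prop))).1
    refine h1.congr fun p => ⟨fun hp => ⟨⟨F p.1, h.of_pair_left.mem p.1⟩, by rw [hp]⟩, ?_⟩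
    rintro ⟨z, hz⟩
    exact (ZFSet.pair_injective hz).2

theorem pair_mem_iff {x y : ZFSet.{u}} : ZFSet.pair x y ∈ A ↔ x ∈ A ∧ y ∈ A := by
  constructor
  · intro h
    have h1 : IsFun A fun _ : PUnit.{u + 2} => ZFSet.pair x y := .const h
    exact ⟨h1.of_pair_left.mem PUnit.unit, h1.of_pair_right.mem PUnit.unit⟩
  · exact fun h => (IsFun.pair (.const (Γ := PUnit) h.1) (.const h.2)).mem PUnit.unit

theorem IsFun.of_biUnion_enc {F G : Γ → ZFSet.{u}} (hG : IsFun A G)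
    (hC : ∀ g, ∀ x ∈ G g, ∃ c : C, (Coded.enc (A := A) c).1 = x) {K : Γ → C → ZFSet.{u}}
    (hK : IsFun A fun p : Γ × C => K p.1 p.2)
    (h : ∀ g z, z ∈ F g ↔ ∃ c : C, (Coded.enc (A := A) c).1 ∈ G g ∧ z ∈ K g c) : IsFun A F where
  mem g := by
    obtain ⟨R, hR, hRK⟩ := IsSigma.exists_extension (Γ := Γ × Elem A) (C := C)
      (R := fun p c => p.2.1 = K p.1 c) (hK.graph.comp (F := fun p : (Γ × Elem A) × C =>
        ((p.1.1, p.2), p.1.2)) (by fun_prop))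
    have hun : ∀ x : Elem A, x.1 ∈ G g → ∃ y, ∀ y', R (g, y') x ↔ y' = y := by
      intro x hx
      obtain ⟨c, hc⟩ := hC g x.1 hx
      obtain rfl : Coded.enc c = x := Subtype.ext hc
      exact ⟨⟨K g c, hK.mem (g, c)⟩, fun y => by rw [hRK, Subtype.ext_iff]⟩
    obtain ⟨b, hb, hbR⟩ := IsSigma.exists_image (R := fun g x y => R (g, y) x)
      (hR.comp (F := fun p : (Γ × Elem A) × Elem A => ((p.1.1, p.2), p.1.2)) (by fun_prop)) g
      (hG.mem g) hun
    have hs : ZFSet.sUnion b ∈ A := (IsFun.sUnion (.const (Γ := PUnit) hb)).mem PUnit.unit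
    rwa [show F g = ZFSet.sUnion b from ZFSet.ext fun z => ?_]
    rw [h, ZFSet.mem_sUnion]
    constructor
    · rintro ⟨c, hc, hz⟩
      exact ⟨K g c, (hbR _).2 ⟨Coded.enc c, hK.mem (g, c), hc, (hRK _ _).2 rfl⟩, hz⟩
    · rintro ⟨y, hy, hz⟩
      obtain ⟨x, hyA, hx, hxy⟩ := (hbR y).1 hy
      obtain ⟨c, hc⟩ := hC g x.1 hx
      obtain rfl : Coded.enc c = x := Subtype.ext hc
      have hyc : y = K g c := (hRK _ _).1 hxy
      exact ⟨c, hx, hyc ▸ hz⟩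
  graph := by
    have h1 : IsSigma A fun p : Γ × Elem A =>
        (∀ z : Elem A, z.1 ∈ p.2.1 → ∃ c : C, (Coded.enc (A := A) c).1 ∈ G p.1 ∧ z.1 ∈ K p.1 c) ∧
          ∀ c : C, (Coded.enc (A := A) c).1 ∈ G p.1 →
            ∀ z : Elem A, z.1 ∈ K p.1 c → z.1 ∈ p.2.1 := by
      refine .and (.ball (.val (by fun_prop)) (.bex_enc (hG.comp (by fun_prop)) (fun _ => hC _) ?_))
        (.ball_enc (hG.comp (by fun_prop)) (fun _ => hC _) (.ball ?_ ?_))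
      · exact (IsDelta.mem (.val (by fun_prop)) (hK.comp (G := fun p :
          ((Γ × Elem A) × Elem A) × C => (p.1.1.1, p.2)) (by fun_prop))).1
      · exact hK.comp (G := fun p : (Γ × Elem A) × C => (p.1.1, p.2)) (by fun_prop)
      · exact (IsDelta.mem (.val (by fun_prop)) (.val (by fun_prop))).1
    refine h1.congr fun p => ⟨fun hp => ?_, fun hp => ZFSet.ext fun z => ?_⟩
    · rw [hp]
      exact ⟨fun z hz => (h _ _).1 hz, fun c hc z hz => (h _ _).2 ⟨c, hc, hz⟩⟩
    · rw [h]
      refine ⟨fun hz => hp.1 ⟨z, mem_of_mem hz p.2.2⟩ hz, ?_⟩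
      rintro ⟨c, hc, hz⟩
      exact hp.2 c hc ⟨z, mem_of_mem hz (hK.mem (p.1, c))⟩ hz

theorem IsFun.of_image_enc {F G : Γ → ZFSet.{u}} (hG : IsFun A G)
    (hC : ∀ g, ∀ x ∈ G g, ∃ c : C, (Coded.enc (A := A) c).1 = x) {K : Γ → C → ZFSet.{u}}
    (hK : IsFun A fun p : Γ × C => K p.1 p.2)
    (h : ∀ g z, z ∈ F g ↔ ∃ c : C, (Coded.enc (A := A) c).1 ∈ G g ∧ z = K g c) : IsFun A F :=
  .of_biUnion_enc (K := fun g c => {K g c}) hG hC hK.singleton fun g z => by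
    simp only [h, ZFSet.mem_singleton]

/-- The range of a function, given as a set of pairs. -/
def rangeSet (f : ZFSet.{u}) : ZFSet.{u} :=
  ZFSet.sep (fun y => ∃ x, ZFSet.pair x y ∈ f) (ZFSet.sUnion (ZFSet.sUnion f))

theorem mem_rangeSet {f y : ZFSet.{u}} : y ∈ rangeSet f ↔ ∃ x, ZFSet.pair x y ∈ f := by
  rw [rangeSet, ZFSet.mem_sep, and_iff_right_iff_imp]
  rintro ⟨x, hx⟩
  exact ZFSet.mem_sUnion_of_mem (ZFSet.mem_pair.2 (Or.inr rfl))
    (ZFSet.mem_sUnion_of_mem (ZFSet.mem_pair.2 (Or.inr rfl)) hx)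

theorem IsFun.rangeSet {F : Γ → ZFSet.{u}} (hF : IsFun A F) :
    IsFun A fun g => rangeSet (F g) := by
  refine .of_sep (R := fun g y => ∃ x : Elem A, x.1 ∈ ZFSet.sUnion (ZFSet.sUnion (F g)) ∧
    ZFSet.pair x.1 y ∈ F g) hF.sUnion.sUnion (.bex (hF.sUnion.sUnion.comp (by fun_prop)) (.mem
      (.pair (.val (by fun_prop)) (.val (by fun_prop))) (hF.comp (by fun_prop)))) fun g z => ?_
  rw [Admissible.rangeSet, ZFSet.mem_sep]
  refine and_congr_right fun _ => ⟨?_, fun ⟨x, _, hx⟩ => ⟨x.1, hx⟩⟩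
  rintro ⟨x, hx⟩
  exact ⟨⟨x, (pair_mem_iff.1 (mem_of_mem hx (hF.mem g))).1⟩, ZFSet.mem_sUnion_of_mem
    (ZFSet.mem_singleton.2 rfl) (ZFSet.mem_sUnion_of_mem (ZFSet.mem_pair.2 (Or.inl rfl)) hx), hx⟩

theorem add_one_mem {α : Ordinal.{u}} (h : α.toZFSet ∈ A) : (α + 1).toZFSet ∈ A := by
  rw [Ordinal.toZFSet_add_one]
  exact (IsFun.insert (.const (Γ := PUnit) h) (.const h)).mem PUnit.unit

/-- The successor of an ordinal in `A`. -/
def Ord.addOne (α : Ord A) : Ord A := ⟨α.1 + 1, add_one_mem α.2⟩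

theorem empty_mem : (∅ : ZFSet.{u}) ∈ A := by
  obtain ⟨x, hx⟩ := hA.out.nonempty
  refine (IsFun.of_sep (Γ := PUnit) (F := fun _ => ∅) (R := fun _ y => ¬ y = y) (.const hx)
    (.not (.eq (.val (by fun_prop)) (.val (by fun_prop)))) fun _ z => ?_).mem PUnit.unit
  simp

theorem natCast_mem (n : ℕ) : (n : Ordinal.{u}).toZFSet ∈ A := by
  induction n with
  | zero => simpa using empty_mem
  | succ n ih => simpa using add_one_mem ih

noncomputable instance : Coded A Idx.{u} := ⟨fun n => ⟨(n.val : Ordinal.{u}).toZFSet, natCast_mem _⟩⟩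

theorem enc_idx (n : Idx.{u}) : (Coded.enc (A := A) n).1 = (n.val : Ordinal.{u}).toZFSet := rfl

theorem enc_idx_injective : Function.Injective (Coded.enc (A := A) (C := Idx.{u})) := by
  rintro ⟨m⟩ ⟨n⟩ h
  have : (m : Ordinal.{u}) = n := Ordinal.toZFSet_injective (congrArg Subtype.val h)
  rw [Nat.cast_inj.1 this]

theorem Ord.exists_of_mem {α : Ordinal.{u}} (hα : α.toZFSet ∈ A) {x : ZFSet.{u}}
    (hx : x ∈ α.toZFSet) : ∃ β : Ord A, (Coded.enc (A := A) β).1 = x := by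
  obtain ⟨β, hβ, rfl⟩ := Ordinal.mem_toZFSet_iff.1 hx
  exact ⟨⟨β, mem_of_mem hx hα⟩, rfl⟩

theorem Ord.mem_of_le {α β : Ordinal.{u}} (hα : α.toZFSet ∈ A) (h : β ≤ α) : β.toZFSet ∈ A := by
  rcases h.eq_or_lt with rfl | h
  · exact hα
  · exact mem_of_mem (Ordinal.toZFSet_mem_toZFSet_iff.2 h) hα

theorem Idx.exists_of_mem {n : ℕ} {x : ZFSet.{u}} (hx : x ∈ (n : Ordinal.{u}).toZFSet) :
    ∃ m : Idx.{u}, m.val < n ∧ (Coded.enc (A := A) m).1 = x := by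
  obtain ⟨β, hβ, rfl⟩ := Ordinal.mem_toZFSet_iff.1 hx
  obtain ⟨m, rfl⟩ := Ordinal.lt_omega0.1 (hβ.trans (Ordinal.natCast_lt_omega0 n))
  exact ⟨⟨m⟩, Nat.cast_lt.1 hβ, rfl⟩

theorem enc_idx_mem_iff {m n : Idx.{u}} :
    (Coded.enc (A := A) m).1 ∈ (Coded.enc (A := A) n).1 ↔ m.val < n.val := by
  rw [enc_idx, enc_idx, Ordinal.toZFSet_mem_toZFSet_iff, Nat.cast_lt]

theorem IsDelta.lt {F G : Γ → Ord A} (hF : AFun A F) (hG : AFun A G) :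
    IsDelta A fun g => (F g).1 < (G g).1 :=
  (IsDelta.mem (.enc hF) (.enc hG)).congr fun _ => Ordinal.toZFSet_mem_toZFSet_iff.symm

theorem IsDelta.eq_idx {F G : Γ → Idx.{u}} (hF : AFun A F) (hG : AFun A G) :
    IsDelta A fun g => (F g).val = (G g).val :=
  (IsDelta.eq (.enc hF) (.enc hG)).congr fun g => by
    rw [enc_idx, enc_idx, Ordinal.toZFSet_injective.eq_iff, Nat.cast_inj]

@[fun_prop]
theorem AFun.ord_add_one {F : Γ → Ord A} (hF : AFun A F) :
    AFun A fun g => (F g).addOne :=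
  .of_enc ((IsFun.insert (.enc hF) (.enc hF)).congr fun _ => Ordinal.toZFSet_add_one _)

@[fun_prop]
theorem AFun.idx_add_one {F : Γ → Idx.{u}} (hF : AFun A F) :
    AFun A fun g => (⟨(F g).val + 1⟩ : Idx.{u}) :=
  .of_enc ((IsFun.insert (.enc hF) (.enc hF)).congr fun _ => by
    rw [enc_idx, enc_idx, Nat.cast_add_one, Ordinal.toZFSet_add_one])

theorem IsDelta.isOrdinal {F : Γ → ZFSet.{u}} (hF : IsFun A F) :
    IsDelta A fun g => (F g).IsOrdinal := by
  have h1 : IsDelta A fun g => (∀ y : Elem A, y.1 ∈ F g → ∀ z : Elem A, z.1 ∈ y.1 → z.1 ∈ F g) ∧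
      ∀ y : Elem A, y.1 ∈ F g → ∀ z : Elem A, z.1 ∈ y.1 → ∀ w : Elem A, w.1 ∈ z.1 →
        w.1 ∈ y.1 :=
    .and (.ball hF (.ball (.val (by fun_prop)) (.mem (.val (by fun_prop)) (hF.comp (by fun_prop)))))
      (.ball hF (.ball (.val (by fun_prop)) (.ball (.val (by fun_prop)) (.mem (.val (by fun_prop))
        (.val (by fun_prop))))))
  refine h1.congr fun g => ?_
  have hFA := hF.mem g
  rw [ZFSet.isOrdinal_iff_forall_mem_isTransitive]
  constructor
  · rintro ⟨h1, h2⟩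
    exact ⟨fun y hy z hz => h1 y.1 hy hz, fun y hy z hz w hw => h2 y.1 hy z.1 hz hw⟩
  · rintro ⟨h1, h2⟩
    refine ⟨fun y hy z hz => ?_, fun y hy z hz w hw => ?_⟩
    · have hyA := mem_of_mem hy hFA
      exact h1 ⟨y, hyA⟩ hy ⟨z, mem_of_mem hz hyA⟩ hz
    · have hyA := mem_of_mem hy hFA
      have hzA := mem_of_mem hz hyA
      exact h2 ⟨y, hyA⟩ hy ⟨z, hzA⟩ hz ⟨w, mem_of_mem hw hzA⟩ hw

theorem IsSigma.exists_ord {R : Γ → Ord A → Prop} (hR : IsSigma A fun p : Γ × Ord A => R p.1 p.2) :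
    IsSigma A fun g => ∃ α : Ord A, R g α := by
  obtain ⟨R', hR', h⟩ := hR.exists_extension
  refine (IsSigma.exists_elem (R := fun g x => x.1.IsOrdinal ∧ R' g x) (.and
    (IsDelta.isOrdinal (.val (F := fun p : Γ × Elem A => p.2)
    (by fun_prop))).1 hR')).congr fun g => ⟨?_, ?_⟩
  · rintro ⟨α, hα⟩
    exact ⟨_, Ord.exists_iff.1 ⟨α, rfl⟩, (h _ _).2 hα⟩
  · rintro ⟨x, hx, hg⟩
    obtain ⟨α, rfl⟩ := Ord.exists_iff.2 hx
    exact ⟨α, (h _ _).1 hg⟩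

/-- A function into the ordinals is a `Σ`-function if its graph is a `Σ`-predicate. -/
theorem AFun.of_graph_ord {F : Γ → Ord A} (h : IsSigma A fun p : Γ × Ord A => p.2 = F p.1) :
    AFun A F := by
  refine .of_enc ⟨fun g => (Coded.enc (A := A) (F g)).2, ?_⟩
  have h1 : IsSigma A fun p : Γ × Elem A => ∃ α : Ord A, α = F p.1 ∧
      (Coded.enc (A := A) α).1 = p.2.1 :=
    .exists_ord (R := fun (p : Γ × Elem A) α => α = F p.1 ∧ (Coded.enc (A := A) α).1 = p.2.1) (.and (h.comp (F := fun p : (Γ × Elem A) × Ord A => (p.1.1, p.2)) (by fun_prop)) (IsDelta.eq (.enc (by fun_prop)) (.val (by fun_prop))).1)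
  exact h1.congr fun p => ⟨fun h => ⟨_, rfl, h.symm⟩, fun ⟨α, hα, h⟩ => hα ▸ h.symm⟩

/-- The least ordinal that satisfies a `Δ`-predicate is given by a `Σ`-function. -/
theorem AFun.of_least {R : Γ → Ord A → Prop} (hR : IsDelta A fun p : Γ × Ord A => R p.1 p.2)
    {F : Γ → Ord A} (hF : ∀ g, R g (F g)) (hF' : ∀ g α, R g α → (F g).1 ≤ α.1) : AFun A F := by
  refine .of_graph_ord ?_
  have h1 : IsSigma A fun p : Γ × Ord A => R p.1 p.2 ∧ ∀ β : Ord A,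
      (Coded.enc (A := A) β).1 ∈ (Coded.enc (A := A) p.2).1 → ¬ R p.1 β :=
    hR.1.and (.ball_enc (.enc (by fun_prop)) (fun p x => Ord.exists_of_mem p.2.2)
      (hR.2.comp (F := fun p : (Γ × Ord A) × Ord A => (p.1.1, p.2)) (by fun_prop)))
  refine h1.congr fun p => ⟨fun h => ?_, ?_⟩
  · rw [h]
    exact ⟨hF _, fun β hβ hR => (hF' _ β hR).not_gt (Ordinal.toZFSet_mem_toZFSet_iff.1 hβ)⟩
  · rintro ⟨h1, h2⟩
    refine Subtype.ext (le_antisymm (not_lt.1 fun h => ?_) (hF' _ _ h1))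
    exact h2 _ (Ordinal.toZFSet_mem_toZFSet_iff.2 h) (hF _)

/-- The collection axiom, for the choice of ordinals. -/
theorem IsSigma.exists_bound {R : Γ → C → Ord A → Prop}
    (hR : IsSigma A fun p : (Γ × C) × Ord A => R p.1.1 p.1.2 p.2) (g : Γ) {a : ZFSet.{u}}
    (ha : a ∈ A) (hC : ∀ x ∈ a, ∃ c : C, (Coded.enc (A := A) c).1 = x)
    (h : ∀ c : C, (Coded.enc (A := A) c).1 ∈ a → ∃ α, R g c α) :
    ∃ β : Ord A, ∀ c : C, (Coded.enc (A := A) c).1 ∈ a → ∃ α, α.1 < β.1 ∧ R g c α := by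
  obtain ⟨R', hR', hRR'⟩ := IsSigma.exists_extension (Γ := Γ × C) (C := Ord A)
    (R := fun p α => R p.1 p.2 α) hR
  obtain ⟨R'', hR'', hRR''⟩ := IsSigma.exists_extension (Γ := Γ × Elem A) (C := C)
    (R := fun p c => R' (p.1, c) p.2) (hR'.comp (F := fun p : (Γ × Elem A) × C =>
      ((p.1.1, p.2), p.1.2)) (by fun_prop))
  obtain ⟨b, hb⟩ := IsSigma.collection (R := fun g x y => y.1.IsOrdinal ∧ R'' (g, y) x)
    (.and (IsDelta.isOrdinal (.val (F := fun p : (Γ × Elem A) × Elem A => p.2) (by fun_prop))).1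
      (hR''.comp (F := fun p : (Γ × Elem A) × Elem A => ((p.1.1, p.2), p.1.2)) (by fun_prop)))
    g ⟨a, ha⟩ (by
      intro x hx
      obtain ⟨c, hc⟩ := hC x.1 hx
      obtain rfl : Coded.enc c = x := Subtype.ext hc
      obtain ⟨α, hα⟩ := h c hx
      exact ⟨Coded.enc α, Ord.exists_iff.1 ⟨α, rfl⟩, (hRR'' _ _).2 ((hRR' _ _).2 hα)⟩)
  -- the union of the ordinals in the collecting set is an ordinal bound
  have h1 : IsFun A fun _ : PUnit => ZFSet.sep ZFSet.IsOrdinal b.1 :=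
    .of_sep (R := fun _ y => y.IsOrdinal) (.const b.2)
      (.isOrdinal (.val (by fun_prop))) fun _ z => ZFSet.mem_sep
  have h2 := h1.sUnion.mem PUnit.unit
  have h3 : (ZFSet.sUnion (ZFSet.sep ZFSet.IsOrdinal b.1)).IsOrdinal := by
    rw [ZFSet.isOrdinal_iff_forall_mem_isOrdinal]
    refine ⟨ZFSet.IsTransitive.sUnion' fun y hy => (ZFSet.mem_sep.1 hy).2.isTransitive, ?_⟩
    intro y hy
    obtain ⟨z, hz, hyz⟩ := ZFSet.mem_sUnion.1 hy
    exact (ZFSet.mem_sep.1 hz).2.mem hyz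
  obtain ⟨β, hβ⟩ := (Ord.exists_iff (x := ⟨_, h2⟩)).2 h3
  refine ⟨β.addOne, fun c hc => ?_⟩
  obtain ⟨y, hyb, hy, hR⟩ := hb (Coded.enc c) hc
  obtain ⟨α, rfl⟩ := Ord.exists_iff.2 hy
  refine ⟨α, Order.lt_add_one_iff.2 ?_, (hRR' (g, c) α).1 ((hRR'' (g, Coded.enc α) c).1 hR)⟩
  rw [← Ordinal.toZFSet_subset_toZFSet_iff]
  intro z hz
  have hβ' : β.1.toZFSet = _ := congrArg Subtype.val hβ
  rw [hβ']
  exact ZFSet.mem_sUnion_of_mem hz (ZFSet.mem_sep.2 ⟨hyb, hy⟩)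

/-- Primitive recursion for `Σ`-functions, with parameters and values in a coded type. -/
theorem AFun.nat_rec {F : Γ × Idx.{u} → C} {B : Γ → C} {H : (Γ × Idx.{u}) × C → C}
    (hB : AFun A B) (hH : AFun A H) (h0 : ∀ g, F (g, ⟨0⟩) = B g)
    (hs : ∀ g n, F (g, ⟨n + 1⟩) = H ((g, ⟨n⟩), F (g, ⟨n⟩))) : AFun A F := by
  obtain ⟨R, hR, hRH⟩ := IsSigma.exists_extension (Γ := (Γ × Idx.{u}) × Elem A) (C := C)
    (R := fun p c => p.2.1 = (Coded.enc (A := A) (H (p.1, c))).1)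
    (IsDelta.eq (.val (by fun_prop)) (.enc (by fun_prop))).1
  refine .of_enc (IsFun.recursion (F := fun g n => (Coded.enc (A := A) (F (g, n))).1)
    enc_idx_injective
    (r := fun _ m n => m.val < n.val) (fun _ => (measure Idx.val).wf)
    (fun _ _ _ _ => lt_trans) (P := fun _ n => (Coded.enc (A := A) n).1) (.enc (by fun_prop)) ?_
    (Step := fun g n f y => (n.val = 0 ∧ y.1 = (Coded.enc (A := A) (B g)).1) ∨
      ∃ m : Idx.{u}, (Coded.enc (A := A) m).1 ∈ (Coded.enc (A := A) n).1 ∧ m.val + 1 = n.val ∧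
        ∃ v : Elem A, ZFSet.pair (Coded.enc (A := A) m).1 v.1 ∈ f.1 ∧ R ((g, m), y) v) ?_ ?_)
  · intro _ n x
    constructor
    · exact fun hx => Idx.exists_of_mem hx
    · rintro ⟨m, hm, rfl⟩
      exact enc_idx_mem_iff.2 hm
  · refine .or (.and (IsDelta.eq_idx (G := fun _ => ⟨0⟩) (by fun_prop) (by fun_prop)).1
      (IsDelta.eq (.val (by fun_prop)) (.enc (by fun_prop))).1)
      (.bex_enc (.enc (by fun_prop)) (fun p x hx => (Idx.exists_of_mem hx).imp fun _ h => h.2)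
      (.and ?_ (.exists_elem (.and (IsDelta.mem (.pair (.enc (by fun_prop)) (.val (by fun_prop)))
        (.val (by fun_prop))).1 ?_))))
    · exact (IsDelta.eq_idx (F := fun p : (((Γ × Idx.{u}) × Elem A) × Elem A) × Idx.{u} =>
        ⟨p.2.val + 1⟩) (G := fun p => p.1.1.1.2) (by fun_prop) (by fun_prop)).1
    · exact hR.comp (F := fun p : ((((Γ × Idx.{u}) × Elem A) × Elem A) × Idx.{u}) × Elem A =>
        (((p.1.1.1.1.1, p.1.2), p.1.1.2), p.2)) (by fun_prop)
  · rintro g ⟨n⟩ f hf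
    refine ⟨(Coded.enc (A := A) _).2, fun y => ?_⟩
    cases n with
    | zero =>
      simp only [h0]
      constructor
      · rintro (⟨-, h⟩ | ⟨m, -, h, -⟩)
        · exact h
        · omega
      · exact fun h => Or.inl ⟨trivial, h⟩
    | succ n =>
      simp only [hs]
      constructor
      · rintro (⟨h, -⟩ | ⟨⟨m⟩, -, h, v, hv, hR⟩)
        · omega
        · obtain rfl : m = n := by simpa using h
          obtain ⟨m', hm', he⟩ := (hf _).1 hv
          obtain ⟨h1, h2⟩ := ZFSet.pair_injective he
          obtain rfl := enc_idx_injective (Subtype.ext h1)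
          obtain rfl : v = Coded.enc (F (g, ⟨m⟩)) := Subtype.ext h2
          exact (hRH _ _).1 hR
      · intro hy
        refine Or.inr ⟨⟨n⟩, enc_idx_mem_iff.2 (Nat.lt_succ_self n), rfl, Coded.enc (F (g, ⟨n⟩)),
          (hf _).2 ⟨⟨n⟩, Nat.lt_succ_self n, rfl⟩, (hRH _ _).2 hy⟩

end Admissible

/-! ### Codes of morphisms and terms -/

namespace Admissible

open PreDilator

variable {D : PreDilator.{u}}

/-- The strictly increasing functions between natural numbers, in the universe of the coded
types. They are coded with the help of the functor `D`. -/
structure Mor (D : PreDilator.{u}) : Type (u + 1) where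
  /-- the domain -/
  dom : ℕ
  /-- the codomain -/
  cod : ℕ
  /-- the function -/
  emb : Fin dom ↪o Fin cod

/-- The graph of a function between natural numbers. -/
noncomputable def Mor.graph (f : Mor D) : ZFSet.{u} :=
  ZFSet.range fun i : Fin f.dom =>
    ZFSet.pair (Ordinal.toZFSet (i : ℕ)) (Ordinal.toZFSet (f.emb i : ℕ))

theorem Mor.pair_mem_graph {f : Mor D} {i : Fin f.dom} {z : ZFSet.{u}} :
    ZFSet.pair (Ordinal.toZFSet (i : ℕ)) z ∈ f.graph ↔ z = Ordinal.toZFSet (f.emb i : ℕ) := by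
  rw [Mor.graph, ZFSet.mem_range]
  constructor
  · rintro ⟨j, hj⟩
    obtain ⟨h1, rfl⟩ := ZFSet.pair_injective hj
    have h2 := Nat.cast_inj.1 (Ordinal.toZFSet_injective h1)
    rw [Fin.ext h2]
  · rintro rfl
    exact ⟨i, rfl⟩

/-- The graph of `D(f)`. -/
noncomputable def Mor.mapGraph (f : Mor D) : ZFSet.{u} :=
  ZFSet.range fun x : Set.Iio (D.obj f.dom) =>
    ZFSet.pair x.1.toZFSet (D.map f.emb x).1.toZFSet

theorem Mor.pair_mem_mapGraph {f : Mor D} {x : Set.Iio (D.obj f.dom)} {z : ZFSet.{u}} :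
    ZFSet.pair x.1.toZFSet z ∈ f.mapGraph ↔ z = (D.map f.emb x).1.toZFSet := by
  rw [Mor.mapGraph, ZFSet.mem_range]
  constructor
  · rintro ⟨y, hy⟩
    obtain ⟨h1, rfl⟩ := ZFSet.pair_injective hy
    rw [Subtype.ext (Ordinal.toZFSet_injective h1)]
  · rintro rfl
    exact ⟨x, rfl⟩

variable (D) in
/-- The code of the action of `D` on objects. -/
noncomputable def objCode : ZFSet.{u} :=
  ZFSet.range fun n : ℕ => ZFSet.pair (Ordinal.toZFSet n) (D.obj n).toZFSet

variable (D) in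
/-- The code of the action of `D` on morphisms. -/
noncomputable def mapCode : ZFSet.{u} :=
  ZFSet.range fun p : (Σ m n : ℕ, Fin m ↪o Fin n) =>
    ZFSet.pair (codeNatMorphism p.2.2) (codeMorphism (D.map p.2.2))

theorem code_eq : D.code = ZFSet.pair (objCode D) (mapCode D) := rfl

theorem pair_mem_objCode {n : ℕ} {z : ZFSet.{u}} :
    ZFSet.pair (Ordinal.toZFSet n) z ∈ objCode D ↔ z = (D.obj n).toZFSet := by
  rw [objCode, ZFSet.mem_range]
  constructor
  · rintro ⟨m, hm⟩
    obtain ⟨h1, rfl⟩ := ZFSet.pair_injective hm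
    rw [Nat.cast_inj.1 (Ordinal.toZFSet_injective h1)]
  · rintro rfl
    exact ⟨n, rfl⟩

/-- The code of a finite sequence of ordinals. -/
noncomputable def seqCode {n : ℕ} (g : Fin n → Ordinal.{u}) : ZFSet.{u} :=
  ZFSet.range fun i : Fin n => ZFSet.pair (Ordinal.toZFSet (i : ℕ)) (g i).toZFSet

theorem pair_mem_seqCode {n : ℕ} {g : Fin n → Ordinal.{u}} {i : Fin n} {z : ZFSet.{u}} :
    ZFSet.pair (Ordinal.toZFSet (i : ℕ)) z ∈ seqCode g ↔ z = (g i).toZFSet := by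
  rw [seqCode, ZFSet.mem_range]
  constructor
  · rintro ⟨j, hj⟩
    obtain ⟨h1, rfl⟩ := ZFSet.pair_injective hj
    have h2 := Nat.cast_inj.1 (Ordinal.toZFSet_injective h1)
    rw [Fin.ext h2]
  · rintro rfl
    exact ⟨i, rfl⟩

theorem seqCode_injective {n : ℕ} : Function.Injective (seqCode (n := n)) := by
  intro g h hgh
  funext i
  have h1 := pair_mem_seqCode.2 (Eq.refl (g i).toZFSet)
  rw [hgh] at h1
  exact Ordinal.toZFSet_injective (pair_mem_seqCode.1 h1)

theorem seqCode_snoc {n : ℕ} (g : Fin (n + 1) → Ordinal.{u}) :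
    seqCode g = insert (ZFSet.pair (Ordinal.toZFSet n) (g (Fin.last n)).toZFSet)
      (seqCode fun i => g i.castSucc) := by
  ext z
  simp only [seqCode, ZFSet.mem_insert_iff, ZFSet.mem_range, Fin.exists_fin_succ', or_comm,
    Fin.val_castSucc, Fin.val_last, eq_comm]

/-- The code of a term. -/
noncomputable def termCode (t : D.Term) : ZFSet.{u} :=
  ZFSet.pair (Ordinal.toZFSet (t.sym.1.1 : ℕ))
    (ZFSet.pair t.sym.1.2.1.toZFSet (seqCode t.args))

theorem termCode_injective : Function.Injective (termCode (D := D)) := by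
  rintro ⟨⟨⟨m, σ⟩, h1⟩, g, hg⟩ ⟨⟨⟨n, τ⟩, h2⟩, k, hk⟩ h
  obtain ⟨h3, h⟩ := ZFSet.pair_injective h
  obtain ⟨h4, h⟩ := ZFSet.pair_injective h
  obtain rfl : m = n := Nat.cast_inj.1 (Ordinal.toZFSet_injective h3)
  obtain rfl : σ = τ := Subtype.ext (Ordinal.toZFSet_injective h4)
  obtain rfl : g = k := seqCode_injective h
  rfl

variable (A : ZFSet.{u})

variable (D) in
/-- The terms with arguments from `A`. -/
def Tm : Type (u + 1) := {t : D.Term // ∀ i, (t.args i).toZFSet ∈ A}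

variable {A} {Γ : Type (u + 1)} [Ctx A Γ]

variable [hA : Fact (IsAdmissible A)]

theorem Ord.bound_mem (t : Tm D A) : t.1.bound.toZFSet ∈ A := by
  rcases Nat.eq_zero_or_pos t.1.sym.1.1 with h | h
  · exact Ord.mem_of_le (natCast_mem 0) (Term.bound_le_iff.2 fun i => absurd i.2 (by omega))
  · refine Ord.mem_of_le (add_one_mem (t.2 ⟨t.1.sym.1.1 - 1, by omega⟩))
      (Term.bound_le_iff.2 fun i => Order.lt_add_one_iff.2 (t.1.strictMono.monotone ?_))
    rw [Fin.le_def]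
    have := i.2
    dsimp only
    omega

theorem seqCode_mem {n : ℕ} (g : Fin n → Ordinal.{u}) (hg : ∀ i, (g i).toZFSet ∈ A) :
    seqCode g ∈ A := by
  induction n with
  | zero =>
    rw [show seqCode g = ∅ from ZFSet.ext fun z => by simp [seqCode]]
    exact empty_mem
  | succ n ih =>
    rw [seqCode_snoc]
    exact (IsFun.insert (.const (Γ := PUnit) (pair_mem_iff.2 ⟨natCast_mem n, hg _⟩))
      (.const (ih _ fun i => hg _))).mem PUnit.unit

variable [hD : Fact (D.code ∈ A)]

theorem objCode_mem : objCode D ∈ A := (pair_mem_iff.1 (code_eq (D := D) ▸ hD.out)).1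

theorem mapCode_mem : mapCode D ∈ A := (pair_mem_iff.1 (code_eq (D := D) ▸ hD.out)).2

theorem obj_mem (n : ℕ) : (D.obj n).toZFSet ∈ A :=
  (pair_mem_iff.1 (mem_of_mem (pair_mem_objCode.2 rfl) (objCode_mem (D := D) (A := A)))).2

noncomputable instance (D : PreDilator.{u}) [Fact (D.code ∈ A)] : Coded A (Tm D A) :=
  ⟨fun t => ⟨termCode t.1, pair_mem_iff.2 ⟨natCast_mem _, pair_mem_iff.2
    ⟨mem_of_mem (Ordinal.toZFSet_mem_toZFSet_iff.2 t.1.sym.1.2.2) (obj_mem _),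
      seqCode_mem _ t.2⟩⟩⟩⟩

theorem enc_tm_injective : Function.Injective (Coded.enc (A := A) (C := Tm D A)) := fun _ _ h =>
  Subtype.ext (termCode_injective (congrArg Subtype.val h))

noncomputable instance : Coded A (Mor D) :=
  ⟨fun f => ⟨ZFSet.pair (codeNatMorphism f.emb) (codeMorphism (D.map f.emb)),
    mem_of_mem (ZFSet.mem_range.2 ⟨⟨f.dom, f.cod, f.emb⟩, rfl⟩) mapCode_mem⟩⟩

theorem Mor.enc_mem (f : Mor D) : (Coded.enc (A := A) f).1 ∈ mapCode D :=
  ZFSet.mem_range.2 ⟨⟨f.dom, f.cod, f.emb⟩, rfl⟩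

theorem Mor.exists_of_mem {x : ZFSet.{u}} (hx : x ∈ mapCode D) :
    ∃ f : Mor D, (Coded.enc (A := A) f).1 = x := by
  obtain ⟨⟨m, n, f⟩, rfl⟩ := ZFSet.mem_range.1 hx
  exact ⟨⟨m, n, f⟩, rfl⟩

theorem IsFun.mor {F : Γ → Mor D} (hF : AFun A F) : IsFun A fun g => ZFSet.pair
    (ZFSet.pair (ZFSet.pair (Ordinal.toZFSet ((F g).dom : ℕ)) (Ordinal.toZFSet ((F g).cod : ℕ)))
      (F g).graph)
    (ZFSet.pair (ZFSet.pair (D.obj (F g).dom).toZFSet (D.obj (F g).cod).toZFSet) (F g).mapGraph) :=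
  .enc hF

@[fun_prop]
theorem AFun.dom {F : Γ → Mor D} (hF : AFun A F) : AFun A fun g => (⟨(F g).dom⟩ : Idx.{u}) :=
  .of_enc (IsFun.mor hF).of_pair_left.of_pair_left.of_pair_left

@[fun_prop]
theorem AFun.cod {F : Γ → Mor D} (hF : AFun A F) : AFun A fun g => (⟨(F g).cod⟩ : Idx.{u}) :=
  .of_enc (IsFun.mor hF).of_pair_left.of_pair_left.of_pair_right

theorem IsFun.graphSet {F : Γ → Mor D} (hF : AFun A F) : IsFun A fun g => (F g).graph :=
  (IsFun.mor hF).of_pair_left.of_pair_right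

theorem IsFun.mapGraph {F : Γ → Mor D} (hF : AFun A F) : IsFun A fun g => (F g).mapGraph :=
  (IsFun.mor hF).of_pair_right.of_pair_right

@[fun_prop]
theorem AFun.arity {F : Γ → Tm D A} (hF : AFun A F) :
    AFun A fun g => (⟨(F g).1.sym.1.1⟩ : Idx.{u}) :=
  .of_enc (IsFun.enc hF).of_pair_left

theorem IsFun.symbol {F : Γ → Tm D A} (hF : AFun A F) :
    IsFun A fun g => (F g).1.sym.1.2.1.toZFSet := (IsFun.enc hF).of_pair_right.of_pair_left

theorem IsFun.seq {F : Γ → Tm D A} (hF : AFun A F) :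
    IsFun A fun g => seqCode (F g).1.args := (IsFun.enc hF).of_pair_right.of_pair_right

theorem IsDelta.eq_tm {F G : Γ → Tm D A} (hF : AFun A F) (hG : AFun A G) :
    IsDelta A fun g => F g = G g :=
  (IsDelta.eq (.enc hF) (.enc hG)).congr fun _ =>
    ⟨fun h => by rw [h], fun h => enc_tm_injective (Subtype.ext h)⟩

theorem IsFun.obj {F : Γ → Idx.{u}} (hF : AFun A F) :
    IsFun A fun g => (D.obj (F g).val).toZFSet where
  mem _ := obj_mem _
  graph := (IsDelta.mem (.pair (.enc (F := fun p : Γ × Elem A => F p.1) (by fun_prop))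
    (.val (F := fun p : Γ × Elem A => p.2) (by fun_prop))) (.const objCode_mem)).1.congr
      fun _ => pair_mem_objCode.symm

variable (D) in
/-- The set of all `σ` such that `(σ, n)` lies in the trace of `D`. -/
noncomputable def traceSet (n : ℕ) : ZFSet.{u} :=
  ZFSet.range fun σ : {σ : Set.Iio (D.obj n) // D.supp n σ = Finset.univ} => σ.1.1.toZFSet

/-- An element belongs to the trace if it does not come from a smaller number. -/
theorem supp_eq_univ_iff {n : ℕ} (σ : Set.Iio (D.obj n)) : D.supp n σ = Finset.univ ↔
    ∀ f : Mor D, f.cod = n → f.dom ≠ n → σ.1.toZFSet ∉ rangeSet f.mapGraph := by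
  constructor
  · rintro h ⟨m, _, f⟩ rfl hm hσ
    obtain ⟨x, hx⟩ := mem_rangeSet.1 hσ
    obtain ⟨τ, hτ⟩ := ZFSet.mem_range.1 hx
    obtain ⟨-, h2⟩ := ZFSet.pair_injective hτ
    obtain rfl := Subtype.ext (Ordinal.toZFSet_injective h2)
    rw [D.supp_map] at h
    have h3 := congrArg Finset.card h
    rw [Finset.card_map, Finset.card_univ, Fintype.card_fin] at h3
    have h4 := Finset.card_le_univ (D.supp m τ)
    rw [h3, Fintype.card_fin] at h4
    have h5 := Fintype.card_le_of_injective f f.injective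
    simp only [Fintype.card_fin] at h5
    exact hm (le_antisymm h5 h4)
  · intro h
    by_contra hne
    set s := D.supp n σ
    have hcard : s.card ≠ n := fun hs => hne ((Finset.card_eq_iff_eq_univ s).1 (by simpa using hs))
    refine h ⟨s.card, n, s.orderEmbOfFin rfl⟩ rfl hcard ?_
    obtain ⟨τ, hτ⟩ := D.support_condition (s.orderEmbOfFin rfl) σ (by simp [s])
    exact mem_rangeSet.2 ⟨τ.1.toZFSet, ZFSet.mem_range.2 ⟨τ, by rw [← hτ]⟩⟩

theorem IsFun.traceSet {F : Γ → Idx.{u}} (hF : AFun A F) :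
    IsFun A fun g => Admissible.traceSet D (F g).val := by
  have h1 : IsDelta A fun p : Γ × Elem A => ¬ ∃ f : Mor D, (Coded.enc (A := A) f).1 ∈ mapCode D ∧
      f.cod = (F p.1).val ∧ ¬ f.dom = (F p.1).val ∧ p.2.1 ∈ Admissible.rangeSet f.mapGraph := by
    refine .not (.bex_enc (.const mapCode_mem) (fun _ x hx => Mor.exists_of_mem hx)
      (.and ?_ (.and (.not ?_) (.mem (.val (by fun_prop)) (.rangeSet (.mapGraph (by fun_prop)))))))
    · exact .eq_idx (F := fun p : (Γ × Elem A) × Mor D => ⟨p.2.cod⟩)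
        (G := fun p : (Γ × Elem A) × Mor D => F p.1.1) (by fun_prop) (by fun_prop)
    · exact .eq_idx (F := fun p : (Γ × Elem A) × Mor D => ⟨p.2.dom⟩)
        (G := fun p : (Γ × Elem A) × Mor D => F p.1.1) (by fun_prop) (by fun_prop)
  refine .of_sep (R := fun g z => ¬ ∃ f : Mor D, (Coded.enc (A := A) f).1 ∈ mapCode D ∧
      f.cod = (F g).val ∧ ¬ f.dom = (F g).val ∧ z ∈ Admissible.rangeSet f.mapGraph) (.obj (D := D) hF) h1
      fun g z => ?_
  rw [Admissible.traceSet, ZFSet.mem_range]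
  constructor
  · rintro ⟨⟨σ, hσ⟩, rfl⟩
    refine ⟨Ordinal.toZFSet_mem_toZFSet_iff.2 σ.2, ?_⟩
    rintro ⟨f, -, h1, h2, h3⟩
    exact (supp_eq_univ_iff σ).1 hσ f h1 h2 h3
  · rintro ⟨hz, h⟩
    obtain ⟨σ, hσ, rfl⟩ := Ordinal.mem_toZFSet_iff.1 hz
    exact ⟨⟨⟨σ, hσ⟩, (supp_eq_univ_iff _).2 fun f h1 h2 h3 => h ⟨f, f.enc_mem, h1, h2, h3⟩⟩, rfl⟩

end Admissible

/-! ### The set of terms with bounded arguments -/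

namespace Admissible

open PreDilator

variable {A : ZFSet.{u}} {Γ : Type (u + 1)} [Ctx A Γ] {D : PreDilator.{u}}

instance (n : ℕ) (α : Ordinal.{u}) :
    Small.{u} {g : Fin n → Ordinal.{u} // StrictMono g ∧ ∀ i, g i < α} :=
  small_of_injective (β := Fin n → Set.Iio α) (f := fun g i => ⟨g.1 i, g.2.2 i⟩) fun _ _ hgh =>
    Subtype.ext (funext fun i => congrArg Subtype.val (congrFun hgh i))

/-- The set of codes of strictly increasing sequences of length `n` below `α`. -/
noncomputable def seqSet (n : ℕ) (α : Ordinal.{u}) : ZFSet.{u} :=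
  ZFSet.range fun g : {g : Fin n → Ordinal.{u} // StrictMono g ∧ ∀ i, g i < α} => seqCode g.1

theorem mem_seqSet {n : ℕ} {α : Ordinal.{u}} {z : ZFSet.{u}} : z ∈ seqSet n α ↔
    ∃ g : Fin n → Ordinal.{u}, (StrictMono g ∧ ∀ i, g i < α) ∧ seqCode g = z := by
  rw [seqSet, ZFSet.mem_range, Subtype.exists]
  simp only [exists_prop]

theorem seqSet_zero (α : Ordinal.{u}) : seqSet 0 α = {∅} := by
  ext z
  rw [mem_seqSet, ZFSet.mem_singleton]
  have h : ∀ g : Fin 0 → Ordinal.{u}, seqCode g = ∅ := fun g =>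
    ZFSet.ext fun z => by simp [seqCode]
  constructor
  · rintro ⟨g, -, rfl⟩
    exact h g
  · rintro rfl
    exact ⟨fun i => i.elim0, ⟨fun i => i.elim0, fun i => i.elim0⟩, h _⟩

/-- The set `β` exceeds all values of the sequence `c`, the length of which is `n`. -/
def SeqLt (n c β : ZFSet.{u}) : Prop := ∀ q ∈ c, ∃ i ∈ n, ∃ γ ∈ β, q = ZFSet.pair i γ

theorem seqLt_iff {n : ℕ} {g : Fin n → Ordinal.{u}} {β : Ordinal.{u}} :
    SeqLt (Ordinal.toZFSet n) (seqCode g) β.toZFSet ↔ ∀ i, g i < β := by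
  constructor
  · intro h i
    obtain ⟨_, -, γ, hγ, h⟩ := h _ (pair_mem_seqCode.2 (Eq.refl (g i).toZFSet))
    obtain ⟨-, rfl⟩ := ZFSet.pair_injective h
    exact Ordinal.toZFSet_mem_toZFSet_iff.1 hγ
  · intro h q hq
    obtain ⟨i, rfl⟩ := ZFSet.mem_range.1 hq
    exact ⟨_, Ordinal.toZFSet_mem_toZFSet_iff.2 (Nat.cast_lt.2 i.2), _,
      Ordinal.toZFSet_mem_toZFSet_iff.2 (h i), rfl⟩

/-- The set of all extensions of sequences `c ∈ x` of length `n` by a last entry from `α`. -/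
noncomputable def extSet (n α x : ZFSet.{u}) : ZFSet.{u} :=
  ZFSet.range fun p : {p : {c // c ∈ x} × {β // β ∈ α} // SeqLt n p.1.1 p.2.1} =>
    insert (ZFSet.pair n p.1.2.1) p.1.1.1

theorem mem_extSet {n α x z : ZFSet.{u}} : z ∈ extSet n α x ↔
    ∃ c ∈ x, ∃ β ∈ α, SeqLt n c β ∧ z = insert (ZFSet.pair n β) c := by
  rw [extSet, ZFSet.mem_range]
  constructor
  · rintro ⟨⟨⟨⟨c, hc⟩, β, hβ⟩, h⟩, rfl⟩
    exact ⟨c, hc, β, hβ, h, rfl⟩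
  · rintro ⟨c, hc, β, hβ, h, rfl⟩
    exact ⟨⟨⟨⟨c, hc⟩, β, hβ⟩, h⟩, rfl⟩

theorem seqSet_succ (n : ℕ) (α : Ordinal.{u}) :
    seqSet (n + 1) α = extSet (Ordinal.toZFSet n) α.toZFSet (seqSet n α) := by
  ext z
  rw [mem_seqSet, mem_extSet]
  constructor
  · rintro ⟨g, ⟨hg, hgα⟩, rfl⟩
    exact ⟨_, mem_seqSet.2 ⟨fun i => g i.castSucc, ⟨hg.comp Fin.strictMono_castSucc,
      fun i => hgα _⟩, rfl⟩, _, Ordinal.toZFSet_mem_toZFSet_iff.2 (hgα (Fin.last n)),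
      seqLt_iff.2 fun i => hg (Fin.castSucc_lt_last i), seqCode_snoc g⟩
  · rintro ⟨c, hc, β, hβ, h, rfl⟩
    obtain ⟨g, ⟨hg, hgα⟩, rfl⟩ := mem_seqSet.1 hc
    obtain ⟨β, hβ, rfl⟩ := Ordinal.mem_toZFSet_iff.1 hβ
    have h' := seqLt_iff.1 h
    refine ⟨Fin.snoc (α := fun _ => Ordinal.{u}) g β, ⟨?_, ?_⟩, ?_⟩
    · intro i j hij
      induction j using Fin.lastCases with
      | last =>
        induction i using Fin.lastCases with
        | last => exact absurd hij (lt_irrefl _)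
        | cast i => simpa using h' i
      | cast j =>
        induction i using Fin.lastCases with
        | last => exact absurd hij (Fin.le_last _).not_gt
        | cast i => simpa using hg (Fin.castSucc_lt_castSucc_iff.1 hij)
    · intro i
      induction i using Fin.lastCases with
      | last => simpa using hβ
      | cast i => simpa using hgα i
    · rw [seqCode_snoc]
      simp

/-- The set of codes of terms with arguments below `α`. -/
noncomputable def tmSet (D : PreDilator.{u}) (α : Ordinal.{u}) : ZFSet.{u} :=
  ZFSet.range fun t : D.Bar α => termCode t.1

variable [hA : Fact (IsAdmissible A)]

theorem IsDelta.seqLt {F G H : Γ → ZFSet.{u}} (hF : IsFun A F) (hG : IsFun A G)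
    (hH : IsFun A H) : IsDelta A fun g => SeqLt (F g) (G g) (H g) := by
  have h1 : IsDelta A fun g => ∀ q : Elem A, q.1 ∈ G g → ∃ i : Elem A, i.1 ∈ F g ∧
      ∃ γ : Elem A, γ.1 ∈ H g ∧ q.1 = ZFSet.pair i.1 γ.1 :=
    .ball hG (.bex (hF.comp (by fun_prop)) (.bex (hH.comp (by fun_prop))
      (.eq (.val (by fun_prop)) (.pair (.val (by fun_prop)) (.val (by fun_prop))))))
  refine h1.congr fun g => ⟨fun h q hq => ?_, fun h q hq => ?_⟩
  · obtain ⟨i, hi, γ, hγ, h⟩ := h q.1 hq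
    exact ⟨⟨i, mem_of_mem hi (hF.mem g)⟩, hi, ⟨γ, mem_of_mem hγ (hH.mem g)⟩, hγ, h⟩
  · obtain ⟨i, hi, γ, hγ, h⟩ := h ⟨q, mem_of_mem hq (hG.mem g)⟩ hq
    exact ⟨i.1, hi, γ.1, hγ, h⟩

theorem IsFun.extSet {F G H : Γ → ZFSet.{u}} (hF : IsFun A F) (hG : IsFun A G)
    (hH : IsFun A H) : IsFun A fun g => Admissible.extSet (F g) (G g) (H g) := by
  have h1 : IsFun A fun p : Γ × Elem A => ZFSet.sep (fun β => SeqLt (F p.1) p.2.1 β) (G p.1) :=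
    .of_sep (R := fun (p : Γ × Elem A) β => SeqLt (F p.1) p.2.1 β) (hG.comp (by fun_prop))
      (.seqLt (hF.comp (by fun_prop)) (.val (by fun_prop)) (.val (by fun_prop)))
      fun _ _ => ZFSet.mem_sep
  have h2 : IsFun A fun p : Γ × Elem A => Admissible.extSet (F p.1) (G p.1) {p.2.1} := by
    refine .of_image (K := fun p β => Insert.insert (ZFSet.pair (F p.1) β.1) p.2.1) h1
      (.insert (.pair (hF.comp (by fun_prop)) (.val (by fun_prop))) (.val (by fun_prop)))
      fun p z => ?_
    simp only [mem_extSet, ZFSet.mem_singleton, exists_eq_left, ZFSet.mem_sep]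
    constructor
    · rintro ⟨β, hβ, h1, h2⟩
      exact ⟨⟨β, mem_of_mem hβ (hG.mem _)⟩, ⟨hβ, h1⟩, h2⟩
    · rintro ⟨β, ⟨hβ, h1⟩, h2⟩
      exact ⟨β.1, hβ, h1, h2⟩
  refine .of_biUnion (K := fun g c => Admissible.extSet (F g) (G g) {c.1}) hH h2 fun g z => ?_
  simp only [mem_extSet, ZFSet.mem_singleton, exists_eq_left]
  exact ⟨fun ⟨c, hc, h⟩ => ⟨⟨c, mem_of_mem hc (hH.mem g)⟩, hc, h⟩, fun ⟨c, hc, h⟩ => ⟨c.1, hc, h⟩⟩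

theorem seqSet_mem (n : ℕ) {α : Ordinal.{u}} (hα : α.toZFSet ∈ A) : seqSet n α ∈ A := by
  induction n with
  | zero =>
    rw [seqSet_zero]
    exact (IsFun.singleton (.const (Γ := PUnit) empty_mem)).mem PUnit.unit
  | succ n ih =>
    rw [seqSet_succ]
    exact (IsFun.extSet (.const (Γ := PUnit) (natCast_mem n)) (.const hα) (.const ih)).mem
      PUnit.unit

theorem IsFun.seqSet {F : Γ → Idx.{u}} {G : Γ → Ord A} (hF : AFun A F) (hG : AFun A G) :
    IsFun A fun g => Admissible.seqSet (F g).val (G g).1 := by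
  have h1 : AFun A fun p : Ord A × Idx.{u} =>
      (⟨Admissible.seqSet p.2.val p.1.1, seqSet_mem _ p.1.2⟩ : Elem A) := by
    have hH : IsFun A fun p : (Ord A × Idx.{u}) × Elem A => Admissible.extSet
        (Coded.enc (A := A) p.1.2).1 (Coded.enc (A := A) p.1.1).1 p.2.1 :=
      .extSet (.enc (by fun_prop)) (.enc (by fun_prop)) (.val (by fun_prop))
    refine .nat_rec (B := fun _ => ⟨{∅}, (IsFun.singleton (.const (Γ := PUnit) empty_mem)).mem
      PUnit.unit⟩) (H := fun p => ⟨_, hH.mem p⟩) (by fun_prop) (.of_enc hH) (fun g => ?_)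
      fun g n => ?_
    · exact Subtype.ext (seqSet_zero _)
    · exact Subtype.ext (seqSet_succ _ _)
  exact .val (h1.comp (hG.prodMk hF))

theorem mem_tmSet_iff {α : Ordinal.{u}} {t : D.Term} :
    termCode t ∈ tmSet D α ↔ ∀ i, t.args i < α := by
  rw [tmSet, ZFSet.mem_range]
  constructor
  · rintro ⟨s, hs⟩
    rw [← termCode_injective hs]
    exact s.2
  · exact fun h => ⟨⟨t, h⟩, rfl⟩

/-- Kripke-Platek set theory does not include the axiom of infinity. Here `ω` is obtained as the domain
of the object map of `D`. -/
theorem omega_mem (hD : D.code ∈ A) : Ordinal.omega0.{u}.toZFSet ∈ A := by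
  have : Fact (D.code ∈ A) := ⟨hD⟩
  have hO := objCode_mem (D := D) (A := A)
  have hU := (IsFun.sUnion (IsFun.sUnion (.const (Γ := PUnit) hO))).mem PUnit.unit
  refine (IsFun.of_sep (Γ := PUnit) (F := fun _ => Ordinal.omega0.{u}.toZFSet)
    (R := fun _ x => ∃ y : Elem A, y.1 ∈ ZFSet.sUnion (ZFSet.sUnion (objCode D)) ∧
      ZFSet.pair x y.1 ∈ objCode D) (.const hU) (.bex (.const hU) (.mem (.pair (.val (by fun_prop))
        (.val (by fun_prop))) (.const hO))) fun _ z => ?_).mem PUnit.unit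
  constructor
  · intro hz
    obtain ⟨β, hβ, rfl⟩ := Ordinal.mem_toZFSet_iff.1 hz
    obtain ⟨n, rfl⟩ := Ordinal.lt_omega0.1 hβ
    have h1 := pair_mem_objCode.2 (Eq.refl (D.obj n).toZFSet)
    exact ⟨ZFSet.mem_sUnion_of_mem (ZFSet.mem_singleton.2 rfl) (ZFSet.mem_sUnion_of_mem
      (ZFSet.mem_pair.2 (Or.inl rfl)) h1), ⟨_, obj_mem n⟩, ZFSet.mem_sUnion_of_mem
      (ZFSet.mem_pair.2 (Or.inr rfl)) (ZFSet.mem_sUnion_of_mem (ZFSet.mem_pair.2 (Or.inr rfl)) h1),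
      h1⟩
  · rintro ⟨-, y, -, hy⟩
    obtain ⟨n, hn⟩ := ZFSet.mem_range.1 hy
    rw [← (ZFSet.pair_injective hn).1]
    exact Ordinal.toZFSet_mem_toZFSet_iff.2 (Ordinal.natCast_lt_omega0 n)

theorem Idx.exists_of_mem_omega {x : ZFSet.{u}} (hx : x ∈ Ordinal.omega0.{u}.toZFSet) :
    ∃ m : Idx.{u}, (Coded.enc (A := A) m).1 = x := by
  obtain ⟨β, hβ, rfl⟩ := Ordinal.mem_toZFSet_iff.1 hx
  obtain ⟨m, rfl⟩ := Ordinal.lt_omega0.1 hβ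
  exact ⟨⟨m⟩, rfl⟩

variable [hD : Fact (D.code ∈ A)]

theorem mem_tmSet {α : Ordinal.{u}} (hα : α.toZFSet ∈ A) {x : ZFSet.{u}} : x ∈ tmSet D α ↔
    ∃ t : Tm D A, t.1.bound ≤ α ∧ (Coded.enc (A := A) t).1 = x := by
  simp only [Term.bound_le_iff]
  constructor
  · intro hx
    obtain ⟨t, rfl⟩ := ZFSet.mem_range.1 hx
    exact ⟨⟨t.1, fun i => Ord.mem_of_le hα (t.2 i).le⟩, t.2, rfl⟩
  · rintro ⟨t, ht, rfl⟩
    exact mem_tmSet_iff.2 ht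

theorem enc_mem_tmSet {α : Ordinal.{u}} {t : Tm D A} :
    (Coded.enc (A := A) t).1 ∈ tmSet D α ↔ t.1.bound ≤ α := by
  rw [Term.bound_le_iff]
  exact mem_tmSet_iff

/-- The set of terms with arguments below `α` is a union over the arities `n`, of products of the
set of trace elements of arity `n` with the set of increasing sequences of length `n`. This uses
that `ω` lies in `A`. -/
theorem IsFun.tmSet {F : Γ → Ord A} (hF : AFun A F) :
    IsFun A fun g => Admissible.tmSet D (F g).1 := by
  refine .of_biUnion_enc (C := Idx.{u}) (K := fun g n => ZFSet.prod {(Coded.enc (A := A) n).1}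
    (ZFSet.prod (Admissible.traceSet D n.val) (Admissible.seqSet n.val (F g).1)))
    (.const (omega_mem hD.out)) (fun g x hx => Idx.exists_of_mem_omega hx)
    (.prod (.singleton (.enc (by fun_prop))) (.prod (.traceSet (by fun_prop))
      (.seqSet (by fun_prop) (by fun_prop)))) fun g z => ?_
  constructor
  · intro hz
    obtain ⟨t, rfl⟩ := ZFSet.mem_range.1 hz
    refine ⟨⟨t.1.sym.1.1⟩, Ordinal.toZFSet_mem_toZFSet_iff.2 (Ordinal.natCast_lt_omega0 _),
      ZFSet.pair_mem_prod.2 ⟨ZFSet.mem_singleton.2 rfl, ZFSet.pair_mem_prod.2 ⟨?_, ?_⟩⟩⟩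
    · exact ZFSet.mem_range.2 ⟨⟨t.1.sym.1.2, t.1.sym.2⟩, rfl⟩
    · exact mem_seqSet.2 ⟨_, ⟨t.1.strictMono, t.2⟩, rfl⟩
  · rintro ⟨n, -, hz⟩
    obtain ⟨a, ha, b, hb, rfl⟩ := ZFSet.mem_prod.1 hz
    obtain ⟨c, hc, d, hd, rfl⟩ := ZFSet.mem_prod.1 hb
    obtain ⟨σ, rfl⟩ := ZFSet.mem_range.1 hc
    obtain ⟨h, ⟨hh, hhα⟩, rfl⟩ := mem_seqSet.1 hd
    rw [ZFSet.mem_singleton.1 ha]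
    exact ZFSet.mem_range.2 ⟨⟨⟨⟨⟨n.val, σ.1⟩, σ.2⟩, h, hh⟩, hhα⟩, rfl⟩

/-- The least upper bound of the successors of the arguments of a term. -/
noncomputable def Tm.bound (t : Tm D A) : Ord A := ⟨t.1.bound, Ord.bound_mem t⟩

@[fun_prop]
theorem AFun.bound {F : Γ → Tm D A} (hF : AFun A F) : AFun A fun g => (F g).bound := by
  refine AFun.comp (F := Tm.bound) (.of_least (R := fun t α => (Coded.enc (A := A) t).1 ∈
    Admissible.tmSet D α.1) (.mem (.enc (by fun_prop)) (.tmSet (by fun_prop))) (fun t => ?_)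
    fun t α h => enc_mem_tmSet.1 h) hF
  exact enc_mem_tmSet.2 le_rfl

theorem IsDelta.hasTop {F : Γ → Tm D A} {G : Γ → Ord A} (hF : AFun A F) (hG : AFun A G) :
    IsDelta A fun g => (F g).1.HasTop (G g).1 := by
  refine (IsDelta.eq (.enc (A := A) (F := fun g => (F g).bound) (by fun_prop))
    (.enc (F := fun g => (G g).addOne) (by fun_prop))).congr fun g => ?_
  rw [Term.hasTop_iff_bound_eq, enc_ord, enc_ord, Ordinal.toZFSet_injective.eq_iff]
  rfl

end Admissible

/-! ### The order of terms and the set of good terms are `Δ`-definable -/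

namespace PreDilator.Term

variable {D : PreDilator.{u}}

/-- The terms `s` and `t` coincide up to their last argument. -/
def Sim (s t : D.Term) : Prop := ∃ δ, ∃ h : s.ParamsLt δ, t = s.setTop δ h

theorem Sim.eq_setTop {s t : D.Term} {δ : Ordinal.{u}} (h : s.Sim t) (ht : t.HasTop δ) :
    ∃ h : s.ParamsLt δ, t = s.setTop δ h := by
  obtain ⟨ε, hε, rfl⟩ := h
  obtain ⟨i, hi, rfl⟩ := ht
  have h1 : (s.setTop ε hε).args i = ε := setTop_args_top s hε hi
  simp only [h1]
  exact ⟨hε, trivial⟩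

theorem Sim.exists_hasTop {s t : D.Term} {δ : Ordinal.{u}} (h : s.Sim t) (hs : s.HasTop δ) :
    ∃ ε, t.HasTop ε := by
  obtain ⟨ε, hε, rfl⟩ := h
  exact ⟨ε, hs.setTop hε⟩

theorem sim_iff {s t : D.Term} : s.Sim t ↔ s.sym.1.1 = t.sym.1.1 ∧
    s.sym.1.2.1 = t.sym.1.2.1 ∧ ∀ (i : ℕ) (hs : i < s.sym.1.1) (ht : i < t.sym.1.1),
      i + 1 ≠ s.sym.1.1 → s.args ⟨i, hs⟩ = t.args ⟨i, ht⟩ := by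
  constructor
  · rintro ⟨δ, h, rfl⟩
    exact ⟨rfl, rfl, fun i hs _ hi => (setTop_args_of_ne s h (i := ⟨i, hs⟩) hi).symm⟩
  · obtain ⟨⟨⟨m, σ⟩, hσ⟩, g, hg⟩ := s
    obtain ⟨⟨⟨n, τ⟩, hτ⟩, k, hk⟩ := t
    rintro ⟨hmn, hστ, h⟩
    obtain rfl : m = n := hmn
    obtain rfl : σ = τ := Subtype.ext hστ
    change Fin m → Ordinal.{u} at g k
    change ∀ (i : ℕ) (hs : i < m) (ht : i < m), i + 1 ≠ m → g ⟨i, hs⟩ = k ⟨i, ht⟩ at h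
    have hlast : ∀ i j : Fin m, (i : ℕ) + 1 ≠ m → (j : ℕ) + 1 = m → i < j := by
      intro i j hi hj
      rw [Fin.lt_def]
      have := i.2
      omega
    have hext : ∀ δ, (∀ i : Fin m, (i : ℕ) + 1 = m → k i = δ) →
        k = fun i : Fin m => if (i : ℕ) + 1 = m then δ else g i := by
      intro δ hδ
      funext i
      split_ifs with hi
      · exact hδ i hi
      · exact (h i i.2 i.2 hi).symm
    rcases Nat.eq_zero_or_pos m with rfl | hm
    · refine ⟨0, fun i => i.elim0, ?_⟩
      obtain rfl : k = g := funext fun i => i.elim0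
      ext1
      · rfl
      · exact heq_of_eq (hext 0 fun i => i.elim0)
    · have hl : ((⟨m - 1, by omega⟩ : Fin m) : ℕ) + 1 = m := by dsimp only; omega
      refine ⟨k ⟨m - 1, by omega⟩, fun i hi => ?_, ?_⟩
      · exact (h i i.2 i.2 hi).trans_lt (hk (hlast _ _ hi hl))
      · ext1
        · rfl
        · exact heq_of_eq (hext _ fun i hi => congrArg k (Fin.ext (by dsimp only; omega)))

end PreDilator.Term

namespace Admissible

open PreDilator

variable {A : ZFSet.{u}} {Γ C : Type (u + 1)} [Ctx A Γ] [Coded A C] {D : PreDilator.{u}}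

theorem Mor.exists_eq_mk {n : ℕ} (f : Mor D) (h : f.dom = n) :
    ∃ (k : ℕ) (f' : Fin n ↪o Fin k), f = ⟨n, k, f'⟩ := by
  obtain ⟨m, k, f⟩ := f
  obtain rfl : m = n := h
  exact ⟨k, f, rfl⟩

variable [hA : Fact (IsAdmissible A)]

theorem IsDelta.iff {R S : Γ → Prop} (hR : IsDelta A R) (hS : IsDelta A S) :
    IsDelta A fun g => (R g ↔ S g) :=
  ((hR.imp hS).and (hS.imp hR)).congr fun _ => iff_iff_implies_and_implies

theorem IsFun.of_sep_enc {F G : Γ → ZFSet.{u}} (hG : IsFun A G)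
    (hC : ∀ g, ∀ x ∈ G g, ∃ c : C, (Coded.enc (A := A) c).1 = x) {R : Γ → C → Prop}
    (hR : IsDelta A fun p : Γ × C => R p.1 p.2)
    (h : ∀ g z, z ∈ F g ↔ ∃ c : C, (Coded.enc (A := A) c).1 ∈ G g ∧ R g c ∧
      z = (Coded.enc (A := A) c).1) : IsFun A F := by
  refine .of_sep (R := fun g z => ∃ c : C, (Coded.enc (A := A) c).1 ∈ G g ∧ R g c ∧
    z = (Coded.enc (A := A) c).1) hG (.bex_enc (hG.comp (by fun_prop)) (fun _ => hC _)
      (.and ?_ (.eq (.val (by fun_prop)) (.enc (by fun_prop))))) fun g z => ?_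
  · exact hR.comp (F := fun p : (Γ × Elem A) × C => (p.1.1, p.2)) (by fun_prop)
  · rw [h, iff_and_self]
    rintro ⟨c, hc, -, rfl⟩
    exact hc

variable [hD : Fact (D.code ∈ A)]

theorem Tm.exists_of_mem {α : Ord A} {x : ZFSet.{u}} (hx : x ∈ tmSet D α.1) :
    ∃ t : Tm D A, (Coded.enc (A := A) t).1 = x := ((mem_tmSet α.2).1 hx).imp fun _ h => h.2

/-- The embeddings `f` and `g` witness the comparison of `s` and `t`. -/
def IsLtWitness (s t : Tm D A) (f g : Mor D) : Prop :=
  f.dom = s.1.sym.1.1 ∧ g.dom = t.1.sym.1.1 ∧ f.cod = g.cod ∧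
    (∀ i : Idx.{u}, (Coded.enc (A := A) i).1 ∈ (Coded.enc (A := A) (⟨f.dom⟩ : Idx.{u})).1 →
      ∀ j : Idx.{u}, (Coded.enc (A := A) j).1 ∈ (Coded.enc (A := A) (⟨g.dom⟩ : Idx.{u})).1 →
        ∃ β γ k l : Elem A, ZFSet.pair (Coded.enc (A := A) i).1 β.1 ∈ seqCode s.1.args ∧
          ZFSet.pair (Coded.enc (A := A) j).1 γ.1 ∈ seqCode t.1.args ∧
          ZFSet.pair (Coded.enc (A := A) i).1 k.1 ∈ f.graph ∧
          ZFSet.pair (Coded.enc (A := A) j).1 l.1 ∈ g.graph ∧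
          (β.1 ∈ γ.1 ↔ k.1 ∈ l.1) ∧ (γ.1 ∈ β.1 ↔ l.1 ∈ k.1)) ∧
    ∃ a b : Elem A, ZFSet.pair s.1.sym.1.2.1.toZFSet a.1 ∈ f.mapGraph ∧
      ZFSet.pair t.1.sym.1.2.1.toZFSet b.1 ∈ g.mapGraph ∧ a.1 ∈ b.1

theorem isSigma_isLtWitness :
    IsSigma A fun p : (((Tm D A) × Tm D A) × Mor D) × Mor D =>
      IsLtWitness p.1.1.1 p.1.1.2 p.1.2 p.2 := by
  refine .and ?_ (.and ?_ (.and ?_ (.and ?_ ?_)))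
  · exact (IsDelta.eq_idx (F := fun p : (((Tm D A) × Tm D A) × Mor D) × Mor D => ⟨p.1.2.dom⟩)
      (G := fun p : (((Tm D A) × Tm D A) × Mor D) × Mor D => ⟨p.1.1.1.1.sym.1.1⟩)
      (by fun_prop) (by fun_prop)).1
  · exact (IsDelta.eq_idx (F := fun p : (((Tm D A) × Tm D A) × Mor D) × Mor D => ⟨p.2.dom⟩)
      (G := fun p : (((Tm D A) × Tm D A) × Mor D) × Mor D => ⟨p.1.1.2.1.sym.1.1⟩)
      (by fun_prop) (by fun_prop)).1
  · exact (IsDelta.eq_idx (F := fun p : (((Tm D A) × Tm D A) × Mor D) × Mor D => ⟨p.1.2.cod⟩)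
      (G := fun p : (((Tm D A) × Tm D A) × Mor D) × Mor D => ⟨p.2.cod⟩)
      (by fun_prop) (by fun_prop)).1
  · refine .ball_enc (.enc (by fun_prop)) (fun _ _ hx => (Idx.exists_of_mem hx).imp fun _ h => h.2)
      (.ball_enc (.enc (by fun_prop)) (fun _ _ hx => (Idx.exists_of_mem hx).imp fun _ h => h.2)
      (.exists_elem (.exists_elem (.exists_elem (.exists_elem (.and ?_ (.and ?_ (.and ?_ (.and ?_
        (.and ?_ ?_))))))))))
    · exact (IsDelta.mem (.pair (.enc (by fun_prop)) (.val (by fun_prop))) (.seq (by fun_prop))).1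
    · exact (IsDelta.mem (.pair (.enc (by fun_prop)) (.val (by fun_prop))) (.seq (by fun_prop))).1
    · exact (IsDelta.mem (.pair (.enc (by fun_prop)) (.val (by fun_prop)))
        (.graphSet (by fun_prop))).1
    · exact (IsDelta.mem (.pair (.enc (by fun_prop)) (.val (by fun_prop)))
        (.graphSet (by fun_prop))).1
    · exact (IsDelta.iff (.mem (.val (by fun_prop)) (.val (by fun_prop)))
        (.mem (.val (by fun_prop)) (.val (by fun_prop)))).1
    · exact (IsDelta.iff (.mem (.val (by fun_prop)) (.val (by fun_prop)))
        (.mem (.val (by fun_prop)) (.val (by fun_prop)))).1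
  · refine .exists_elem (.exists_elem (.and ?_ (.and ?_ ?_)))
    · exact (IsDelta.mem (.pair (.symbol (by fun_prop)) (.val (by fun_prop)))
        (.mapGraph (by fun_prop))).1
    · exact (IsDelta.mem (.pair (.symbol (by fun_prop)) (.val (by fun_prop)))
        (.mapGraph (by fun_prop))).1
    · exact (IsDelta.mem (.val (by fun_prop)) (.val (by fun_prop))).1

theorem isLtWitness_mk_iff {s t : Tm D A} {k : ℕ} {f : Fin s.1.sym.1.1 ↪o Fin k}
    {g : Fin t.1.sym.1.1 ↪o Fin k} : IsLtWitness s t ⟨_, _, f⟩ ⟨_, _, g⟩ ↔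
      (∀ i j, (s.1.args i < t.1.args j ↔ f i < g j) ∧ (t.1.args j < s.1.args i ↔ g j < f i)) ∧
        D.map f s.1.sym.1.2 < D.map g t.1.sym.1.2 := by
  have hcast : ∀ a b : Fin k, Ordinal.toZFSet.{u} (a : ℕ) ∈ Ordinal.toZFSet.{u} (b : ℕ) ↔ a < b :=
    fun a b => by rw [Ordinal.toZFSet_mem_toZFSet_iff, Nat.cast_lt, Fin.lt_def]
  unfold IsLtWitness
  simp only [true_and]
  refine and_congr ⟨fun h i j => ?_, fun h i hi j hj => ?_⟩ ⟨?_, fun h => ?_⟩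
  · obtain ⟨β, γ, k, l, h1, h2, h3, h4, h5, h6⟩ := h ⟨i⟩
      (Ordinal.toZFSet_mem_toZFSet_iff.2 (Nat.cast_lt.2 i.2)) ⟨j⟩
      (Ordinal.toZFSet_mem_toZFSet_iff.2 (Nat.cast_lt.2 j.2))
    have h1 := pair_mem_seqCode.1 h1
    have h2 := pair_mem_seqCode.1 h2
    have h3 := (Mor.pair_mem_graph (f := ⟨_, _, f⟩) (i := i)).1 h3
    have h4 := (Mor.pair_mem_graph (f := ⟨_, _, g⟩) (i := j)).1 h4
    rw [h1, h2, h3, h4, hcast, Ordinal.toZFSet_mem_toZFSet_iff] at h5 h6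
    exact ⟨h5, h6⟩
  · have hi' := enc_idx_mem_iff.1 hi
    have hj' := enc_idx_mem_iff.1 hj
    obtain ⟨h5, h6⟩ := h ⟨i.val, hi'⟩ ⟨j.val, hj'⟩
    refine ⟨⟨_, s.2 ⟨i.val, hi'⟩⟩, ⟨_, t.2 ⟨j.val, hj'⟩⟩, ⟨_, natCast_mem (f ⟨i.val, hi'⟩)⟩,
      ⟨_, natCast_mem (g ⟨j.val, hj'⟩)⟩, (pair_mem_seqCode (i := ⟨i.val, hi'⟩)).2 rfl,
      (pair_mem_seqCode (i := ⟨j.val, hj'⟩)).2 rfl,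
      (Mor.pair_mem_graph (f := ⟨_, _, f⟩) (i := ⟨i.val, hi'⟩)).2 rfl,
      (Mor.pair_mem_graph (f := ⟨_, _, g⟩) (i := ⟨j.val, hj'⟩)).2 rfl, ?_⟩
    rw [hcast, hcast, Ordinal.toZFSet_mem_toZFSet_iff, Ordinal.toZFSet_mem_toZFSet_iff]
    exact ⟨h5, h6⟩
  · rintro ⟨a, b, ha, hb, hab⟩
    rw [(Mor.pair_mem_mapGraph (f := ⟨_, _, f⟩)).1 ha,
      (Mor.pair_mem_mapGraph (f := ⟨_, _, g⟩)).1 hb, Ordinal.toZFSet_mem_toZFSet_iff] at hab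
    exact hab
  · have hmem : ∀ x : Set.Iio (D.obj k), x.1.toZFSet ∈ A := fun x =>
      mem_of_mem (Ordinal.toZFSet_mem_toZFSet_iff.2 x.2) (obj_mem (D := D) k)
    exact ⟨⟨_, hmem _⟩, ⟨_, hmem _⟩, (Mor.pair_mem_mapGraph (f := ⟨_, _, f⟩)).2 rfl,
      (Mor.pair_mem_mapGraph (f := ⟨_, _, g⟩)).2 rfl, Ordinal.toZFSet_mem_toZFSet_iff.2 h⟩

theorem exists_isLtWitness_iff {s t : Tm D A} :
    (∃ f g : Mor D, IsLtWitness s t f g) ↔ s.1.Lt t.1 := by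
  constructor
  · rintro ⟨f, g, h⟩
    obtain ⟨k, f, rfl⟩ := f.exists_eq_mk h.1
    obtain ⟨k', g, rfl⟩ := g.exists_eq_mk h.2.1
    obtain rfl : k = k' := h.2.2.1
    obtain ⟨h1, h2⟩ := isLtWitness_mk_iff.1 h
    exact (Term.lt_iff_map_lt s.1 t.1 f g (fun i j => (h1 i j).1) fun i j => (h1 i j).2).2 h2
  · intro h
    exact ⟨⟨_, _, _⟩, ⟨_, _, _⟩, isLtWitness_mk_iff.2 ⟨fun i j =>
      ⟨(Term.positionEmb_lt_iff _ _ _ _ _ _ _).symm, (Term.positionEmb_lt_iff _ _ _ _ _ _ _).symm⟩,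
      h⟩⟩

/-- The order on terms is `Σ`, as it is decided by finite embeddings, and hence `Δ` since it is
total. -/
theorem IsDelta.tm_lt {F G : Γ → Tm D A} (hF : AFun A F) (hG : AFun A G) :
    IsDelta A fun g => (F g).1.Lt (G g).1 := by
  have h1 : IsSigma A fun p : Tm D A × Tm D A => p.1.1.Lt p.2.1 := by
    have h2 : IsSigma A fun p : Tm D A × Tm D A =>
        ∃ f : Mor D, (Coded.enc (A := A) f).1 ∈ mapCode D ∧
          ∃ g : Mor D, (Coded.enc (A := A) g).1 ∈ mapCode D ∧ IsLtWitness p.1 p.2 f g :=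
      .bex_enc (.const mapCode_mem) (fun _ _ => Mor.exists_of_mem) (.bex_enc (.const mapCode_mem)
        (fun _ _ => Mor.exists_of_mem) isSigma_isLtWitness)
    refine h2.congr fun p => exists_isLtWitness_iff.symm.trans ?_
    exact ⟨fun ⟨f, g, h⟩ => ⟨f, f.enc_mem, g, g.enc_mem, h⟩,
      fun ⟨f, _, g, _, h⟩ => ⟨f, g, h⟩⟩
  have h2 : IsDelta A fun p : Tm D A × Tm D A => p.1.1.Lt p.2.1 := by
    refine ⟨h1, ((IsDelta.eq_tm (F := fun p : Tm D A × Tm D A => p.1) (G := fun p => p.2)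
      (by fun_prop) (by fun_prop)).1.or (h1.comp (F := fun p : Tm D A × Tm D A => (p.2, p.1))
        (by fun_prop))).congr fun p => ?_⟩
    rcases Std.Trichotomous.rel_or_eq_or_rel_swap (r := Term.Lt) (a := p.1.1) (b := p.2.1) with h | h | h
    · refine iff_of_false (not_not.2 h) ?_
      rintro (h' | h')
      · rw [h'] at h
        exact irrefl _ h
      · exact irrefl _ (_root_.trans h h')
    · exact iff_of_true (fun h' : p.1.1.Lt p.2.1 => irrefl (r := Term.Lt) p.2.1 (by rwa [h] at h'))
        (Or.inl (Subtype.ext h))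
    · exact iff_of_true (fun h' => irrefl _ (_root_.trans h h')) (Or.inr h)
  exact h2.comp (F := fun g => (F g, G g)) (by fun_prop)

theorem IsDelta.sim {F G : Γ → Tm D A} (hF : AFun A F) (hG : AFun A G) :
    IsDelta A fun g => (F g).1.Sim (G g).1 := by
  have h1 : IsDelta A fun g => (F g).1.sym.1.1 = (G g).1.sym.1.1 ∧
      (F g).1.sym.1.2.1.toZFSet = (G g).1.sym.1.2.1.toZFSet ∧ ∀ i : Idx.{u},
        (Coded.enc (A := A) i).1 ∈ (Coded.enc (A := A) (⟨(F g).1.sym.1.1⟩ : Idx.{u})).1 →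
        ¬ i.val + 1 = (F g).1.sym.1.1 → ∃ β : Elem A,
          β.1 ∈ (Coded.enc (A := A) (F g).bound).1 ∧
          ZFSet.pair (Coded.enc (A := A) i).1 β.1 ∈ seqCode (F g).1.args ∧
          ZFSet.pair (Coded.enc (A := A) i).1 β.1 ∈ seqCode (G g).1.args := by
    refine .and ?_ (.and (.eq (.symbol hF) (.symbol hG)) (.ball_enc (.enc (by fun_prop))
      (fun _ _ hx => (Idx.exists_of_mem hx).imp fun _ h => h.2) (.imp (.not ?_) (.bex
        (.enc (by fun_prop)) (.and ?_ ?_)))))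
    · exact .eq_idx (F := fun g => ⟨(F g).1.sym.1.1⟩) (G := fun g => ⟨(G g).1.sym.1.1⟩)
        (by fun_prop) (by fun_prop)
    · exact .eq_idx (F := fun p : Γ × Idx.{u} => ⟨p.2.val + 1⟩)
        (G := fun p : Γ × Idx.{u} => ⟨(F p.1).1.sym.1.1⟩) (by fun_prop) (by fun_prop)
    · exact .mem (.pair (.enc (by fun_prop)) (.val (by fun_prop))) (.seq (by fun_prop))
    · exact .mem (.pair (.enc (by fun_prop)) (.val (by fun_prop))) (.seq (by fun_prop))
  refine h1.congr fun g => ?_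
  rw [Term.sim_iff, Ordinal.toZFSet_injective.eq_iff]
  refine and_congr_right fun h => and_congr_right fun _ => ⟨fun h' i hi hi1 => ?_,
    fun h' i hs ht hi => ?_⟩
  · have hi' := enc_idx_mem_iff.1 hi
    refine ⟨⟨_, (F g).2 ⟨i.val, hi'⟩⟩, Ordinal.toZFSet_mem_toZFSet_iff.2 (Term.lt_bound _ _),
      (pair_mem_seqCode (i := ⟨i.val, hi'⟩)).2 rfl,
      (pair_mem_seqCode (i := ⟨i.val, h ▸ hi'⟩)).2
      (congrArg Ordinal.toZFSet (h' i.val hi' (h ▸ hi') hi1))⟩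
  · obtain ⟨β, -, h1, h2⟩ := h' ⟨i⟩ (enc_idx_mem_iff.2 hs) hi
    exact Ordinal.toZFSet_injective (((pair_mem_seqCode (i := ⟨i, hs⟩)).1 h1).symm.trans
      ((pair_mem_seqCode (i := ⟨i, ht⟩)).1 h2))

end Admissible

/-! ### The ordinals denoted by terms are computed in the admissible set -/

namespace Admissible

open PreDilator NormalDilator

variable {A : ZFSet.{u}} {Γ : Type (u + 1)} [Ctx A Γ] {D : NormalDilator.{u}}

theorem termLt_wf : WellFounded (Term.Lt (D := D.toPreDilator)) := by
  refine Subrelation.wf (fun {s t} h => ?_) (InvImage.wf (NormalDilator.ord (D := D)) Ordinal.lt_wf)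
  exact ord_lt_ord.2 h

theorem singleton_empty_ne_empty : ({∅} : ZFSet.{u}) ≠ ∅ := by
  intro h
  have h1 := ZFSet.mem_singleton.2 (Eq.refl (∅ : ZFSet.{u}))
  rw [h] at h1
  exact ZFSet.notMem_empty ∅ h1

variable [hA : Fact (IsAdmissible A)]

theorem exists_tm_of_lt {t : Tm D.toPreDilator A} {s : D.Term} (h : s.Lt t.1) :
    ∃ s' : Tm D.toPreDilator A, s'.1 = s :=
  ⟨⟨s, fun i => Ord.mem_of_le (Ord.bound_mem t) ((s.lt_bound i).le.trans (bound_le_of_lt h))⟩, rfl⟩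

variable [hD : Fact (D.code ∈ A)]

/-- The ordinal that is denoted by a term is determined by `Σ`-recursion along the order of
terms. -/
theorem IsFun.ord {F : Γ → Tm D.toPreDilator A} (hF : AFun A F) :
    IsFun A fun g => (NormalDilator.ord (F g).1).toZFSet := by
  have hF' : ∀ (t : Tm D.toPreDilator A) z, z ∈ (NormalDilator.ord t.1).toZFSet ↔
      ∃ s : Tm D.toPreDilator A, s.1.Lt t.1 ∧ (NormalDilator.ord s.1).toZFSet = z := by
    intro t z
    rw [Ordinal.mem_toZFSet_iff]
    constructor
    · rintro ⟨β, hβ, rfl⟩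
      obtain ⟨s, rfl⟩ := ord_surjective (D := D) β
      obtain ⟨s, rfl⟩ := exists_tm_of_lt (ord_lt_ord.1 hβ)
      exact ⟨s, ord_lt_ord.1 hβ, rfl⟩
    · rintro ⟨s, hs, rfl⟩
      exact ⟨_, ord_lt_ord.2 hs, rfl⟩
  have h1 : IsFun A fun p : PUnit × Tm D.toPreDilator A => (NormalDilator.ord p.2.1).toZFSet := by
    refine .recursion (F := fun _ t => (NormalDilator.ord t.1).toZFSet) enc_tm_injective
      (r := fun _ s t => s.1.Lt t.1) (fun _ => InvImage.wf Subtype.val termLt_wf)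
      (fun _ _ _ _ h h' => _root_.trans h h') (P := fun _ t => ZFSet.sep
        (fun x => ∃ s : Tm D.toPreDilator A, s.1.Lt t.1 ∧ x = (Coded.enc (A := A) s).1)
        (Admissible.tmSet D.toPreDilator t.1.bound)) ?_ ?_ (Step := fun _ _ f y =>
        y.1 = Admissible.rangeSet f.1) ?_ ?_
    · refine .of_sep_enc (R := fun (p : PUnit × Tm D.toPreDilator A) (s : Tm D.toPreDilator A) =>
        s.1.Lt p.2.1) (.tmSet (F := fun p : PUnit × Tm D.toPreDilator A => p.2.bound)
          (by fun_prop)) (fun p x => Tm.exists_of_mem (α := p.2.bound))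
          (.tm_lt (by fun_prop) (by fun_prop)) fun p z => ?_
      rw [ZFSet.mem_sep]
      constructor
      · rintro ⟨h1, s, h2, rfl⟩
        exact ⟨s, h1, h2, rfl⟩
      · rintro ⟨s, h1, h2, rfl⟩
        exact ⟨h1, s, h2, rfl⟩
    · intro _ t x
      rw [ZFSet.mem_sep]
      constructor
      · rintro ⟨h1, s, h2, rfl⟩
        exact ⟨s, h2, rfl⟩
      · rintro ⟨s, h2, rfl⟩
        exact ⟨enc_mem_tmSet.2 (bound_le_of_lt h2), s, h2, rfl⟩
    · exact (IsDelta.eq (.val (by fun_prop)) (.rangeSet (.val (by fun_prop)))).1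
    · intro _ t f hf
      have h : (NormalDilator.ord t.1).toZFSet = Admissible.rangeSet f.1 := by
        ext z
        rw [hF', mem_rangeSet]
        constructor
        · rintro ⟨s, hs, rfl⟩
          exact ⟨_, (hf _).2 ⟨s, hs, rfl⟩⟩
        · rintro ⟨x, hx⟩
          obtain ⟨s, hs, h⟩ := (hf _).1 hx
          exact ⟨s, hs, (ZFSet.pair_injective h).2.symm⟩
      rw [h]
      exact ⟨(IsFun.rangeSet (.const (Γ := PUnit) f.2)).mem PUnit.unit, fun _ => Iff.rfl⟩
  exact h1.comp (G := fun g => (PUnit.unit, F g)) (by fun_prop)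

/-- The ordinal `D(α)` is the set of ordinals denoted by terms with arguments below `α`. -/
theorem IsFun.muOrd {F : Γ → Ord A} (hF : AFun A F) :
    IsFun A fun g => (D.muOrd (F g).1).toZFSet := by
  refine .of_image_enc (C := Tm D.toPreDilator A) (K := fun _ t => (NormalDilator.ord t.1).toZFSet)
    (.tmSet hF) (fun g x => Tm.exists_of_mem (α := F g)) (.ord (by fun_prop)) fun g z => ?_
  rw [Ordinal.mem_toZFSet_iff]
  constructor
  · rintro ⟨β, hβ, rfl⟩
    obtain ⟨s, rfl⟩ := ord_surjective (D := D) β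
    have hs := ord_lt_muOrd.1 hβ
    exact ⟨⟨s, fun i => Ord.mem_of_le (F g).2 (hs i).le⟩, mem_tmSet_iff.2 hs, rfl⟩
  · rintro ⟨t, ht, rfl⟩
    exact ⟨_, ord_lt_muOrd.2 (mem_tmSet_iff.1 ht), rfl⟩

variable (D) in
theorem muOrd_mem (α : Ord A) : (D.muOrd α.1).toZFSet ∈ A := (IsFun.muOrd (.id)).mem α

/-- The terms that are obtained from `s` by replacing the last argument `δ` by some `δ'` with
`η < δ' < ε`. -/
theorem exists_sim_iff {s : D.Term} {δ : Ordinal.{u}} (hs : s.HasTop δ) {η ε : Ordinal.{u}}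
    (hε : ε.toZFSet ∈ A) {R : D.Term → Prop} :
    (∃ s' : Tm D.toPreDilator A, (Coded.enc (A := A) s').1 ∈ tmSet D.toPreDilator ε ∧
      η + 1 < s'.1.bound ∧ s.Sim s'.1 ∧ R s'.1) ↔
      ∃ δ', η < δ' ∧ δ' < ε ∧ ∃ hp, R (s.setTop δ' hp) := by
  constructor
  · rintro ⟨s', h1, h2, h3, h4⟩
    obtain ⟨δ', hδ'⟩ := h3.exists_hasTop hs
    obtain ⟨hp, h⟩ := h3.eq_setTop hδ'
    have h5 := enc_mem_tmSet.1 h1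
    rw [Term.hasTop_iff_bound_eq.1 hδ'] at h2 h5
    exact ⟨δ', lt_of_add_lt_add_right h2, Order.add_one_le_iff.1 h5, hp, h ▸ h4⟩
  · rintro ⟨δ', h1, h2, hp, h⟩
    have htop := hs.setTop hp
    have hmem : ∀ i, (s.setTop δ' hp).args i < ε := fun i => (htop.args_le i).trans_lt h2
    refine ⟨⟨s.setTop δ' hp, fun i => Ord.mem_of_le hε (hmem i).le⟩, mem_tmSet_iff.2 hmem, ?_,
      ⟨δ', hp, rfl⟩, h⟩
    rw [Term.hasTop_iff_bound_eq.1 htop]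
    exact Order.add_one_le_iff.1 (Order.succ_le_succ (Order.add_one_le_of_lt h1))

/-- The recursive condition for a term to be good, where the good terms with smaller arguments
are those in the set `f`. -/
def IsGoodStep (t : Tm D.toPreDilator A) (f : ZFSet.{u}) : Prop :=
  ∃ δ : Ord A, (Coded.enc (A := A) δ).1 ∈ (Coded.enc (A := A) t.bound).1 ∧ t.1.HasTop δ.1 ∧
    (∅ : ZFSet.{u}) ∈ (Coded.enc (A := A) δ).1 ∧
    (D.muOrd δ.1).toZFSet = (Coded.enc (A := A) δ).1 ∧
    ∀ s : Tm D.toPreDilator A, (Coded.enc (A := A) s).1 ∈ tmSet D.toPreDilator t.bound.1 →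
      s.1.Lt t.1 → s.1.HasTop δ.1 →
      ∀ η : Ord A, (Coded.enc (A := A) η).1 ∈ (Coded.enc (A := A) δ).1 →
      ∃ s' : Tm D.toPreDilator A, (Coded.enc (A := A) s').1 ∈ tmSet D.toPreDilator δ.1 ∧
        η.addOne.1 < s'.bound.1 ∧ s.1.Sim s'.1 ∧
        ZFSet.pair (Coded.enc (A := A) s').1 {∅} ∈ f

theorem isDelta_isGoodStep : IsDelta A fun p : Tm D.toPreDilator A × Elem A =>
    IsGoodStep p.1 p.2.1 := by
  have h0 : IsFun A fun _ : PUnit.{u + 2} => ({∅} : ZFSet.{u}) := .singleton (.const empty_mem)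
  refine .bex_enc (.enc (by fun_prop)) (fun p _ => Ord.exists_of_mem p.1.bound.2)
    (.and (.hasTop (by fun_prop) (by fun_prop)) (.and (.mem (.const empty_mem)
      (.enc (by fun_prop))) (.and (.eq (.muOrd (by fun_prop)) (.enc (by fun_prop)))
      (.ball_enc (.tmSet (by fun_prop)) (fun p _ => Tm.exists_of_mem (α := p.1.1.bound))
        (.imp (.tm_lt (by fun_prop) (by fun_prop)) (.imp (.hasTop (by fun_prop) (by fun_prop))
        (.ball_enc (.enc (by fun_prop)) (fun p _ => Ord.exists_of_mem p.1.2.2)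
        (.bex_enc (.tmSet (by fun_prop)) (fun p _ => Tm.exists_of_mem (α := p.1.1.2))
        (.and (.lt (by fun_prop) (by fun_prop)) (.and (.sim (by fun_prop) (by fun_prop))
        (.mem (.pair (.enc (by fun_prop)) (.const (h0.mem PUnit.unit)))
          (.val (by fun_prop)))))))))))))

open Classical in
theorem isGoodStep_iff {t : Tm D.toPreDilator A} {f : ZFSet.{u}}
    (hf : IsGraphBelow A (fun s t : Tm D.toPreDilator A => s.1.bound < t.1.bound)
      (fun t => if Good t.1 then {∅} else ∅) t f) : IsGoodStep t f ↔ Good t.1 := by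
  have hf' : ∀ s' : Tm D.toPreDilator A, s'.1.bound < t.1.bound →
      (ZFSet.pair (Coded.enc (A := A) s').1 {∅} ∈ f ↔ Good s'.1) := by
    intro s' hs'
    rw [hf]
    constructor
    · rintro ⟨c, hc, h⟩
      obtain ⟨h1, h2⟩ := ZFSet.pair_injective h
      obtain rfl := enc_tm_injective (Subtype.ext h1)
      by_contra hg
      simp only [if_neg hg] at h2
      exact singleton_empty_ne_empty h2
    · intro h
      exact ⟨s', hs', by simp only [if_pos h]⟩
  have key : ∀ {δ : Ord A}, t.1.HasTop δ.1 → ∀ s : D.Term, s.HasTop δ.1 → ∀ η : Ordinal.{u},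
      (∃ s' : Tm D.toPreDilator A, (Coded.enc (A := A) s').1 ∈ tmSet D.toPreDilator δ.1 ∧
        η + 1 < s'.bound.1 ∧ s.Sim s'.1 ∧ ZFSet.pair (Coded.enc (A := A) s').1 {∅} ∈ f) ↔
      ∃ δ', η < δ' ∧ δ' < δ.1 ∧ ∃ hp, Good (s.setTop δ' hp) := by
    intro δ ht s hs η
    rw [← exists_sim_iff (A := A) hs δ.2]
    refine exists_congr fun s' => and_congr_right fun h => and_congr_right fun _ =>
      and_congr_right fun _ => hf' s' ?_
    rw [Term.hasTop_iff_bound_eq.1 ht]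
    exact Order.lt_add_one_iff.2 (enc_mem_tmSet.1 h)
  constructor
  · rintro ⟨δ, -, ht, h0, hμ, h⟩
    refine (good_iff ht).2 ⟨?_, Ordinal.toZFSet_injective hμ, fun s hst hs η hη => ?_⟩
    · rw [← Ordinal.toZFSet_zero] at h0
      exact Ordinal.toZFSet_mem_toZFSet_iff.1 h0
    · obtain ⟨s, rfl⟩ := exists_tm_of_lt hst
      exact (key ht s.1 hs η).1 (h s (enc_mem_tmSet.2 (bound_le_of_lt hst)) hst hs
        ⟨η, Ord.mem_of_le δ.2 hη.le⟩ (Ordinal.toZFSet_mem_toZFSet_iff.2 hη))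
  · intro hg
    obtain ⟨δ, ht, -⟩ := id hg
    have hb := Term.hasTop_iff_bound_eq.1 ht
    have hδt : δ < t.1.bound := hb ▸ Order.lt_add_one_iff.2 le_rfl
    have hδA : δ.toZFSet ∈ A := Ord.mem_of_le (Ord.bound_mem t) hδt.le
    obtain ⟨h0, hμ, h⟩ := (good_iff ht).1 hg
    refine ⟨⟨δ, hδA⟩, Ordinal.toZFSet_mem_toZFSet_iff.2 hδt, ht, ?_,
      congrArg Ordinal.toZFSet hμ, fun s _ hst hs η hη => ?_⟩
    · rw [← Ordinal.toZFSet_zero]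
      exact Ordinal.toZFSet_mem_toZFSet_iff.2 h0
    · exact (key (δ := ⟨δ, hδA⟩) ht s.1 hs η.1).2
        (h s.1 hst hs η.1 (Ordinal.toZFSet_mem_toZFSet_iff.1 hη))

/-- To be good is a `Δ`-property of terms, by recursion on the bound of the arguments. -/
theorem IsDelta.good {F : Γ → Tm D.toPreDilator A} (hF : AFun A F) :
    IsDelta A fun g => Good (F g).1 := by
  classical
  have h0 : IsFun A fun _ : PUnit.{u + 2} => ({∅} : ZFSet.{u}) := .singleton (.const empty_mem)
  have h0 := h0.mem PUnit.unit
  have h1 : IsFun A fun p : PUnit × Tm D.toPreDilator A =>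
      if Good p.2.1 then ({∅} : ZFSet.{u}) else ∅ := by
    refine .recursion (F := fun _ t => if Good t.1 then ({∅} : ZFSet.{u}) else ∅) enc_tm_injective
      (r := fun _ s t => s.1.bound < t.1.bound) (fun _ => InvImage.wf
        (fun t : Tm D.toPreDilator A => t.1.bound) Ordinal.lt_wf)
      (fun _ _ _ _ h h' => h.trans h') (P := fun _ t => ZFSet.sep
        (fun x => ∃ s : Tm D.toPreDilator A, s.1.bound < t.1.bound ∧ x = (Coded.enc (A := A) s).1)
        (Admissible.tmSet D.toPreDilator t.1.bound)) ?_ ?_ (Step := fun _ t f y =>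
        (IsGoodStep t f.1 ∧ y.1 = {∅}) ∨ (¬ IsGoodStep t f.1 ∧ y.1 = ∅)) ?_ ?_
    · refine .of_sep_enc (R := fun (p : PUnit × Tm D.toPreDilator A) (s : Tm D.toPreDilator A) =>
        s.1.bound < p.2.1.bound) (.tmSet (F := fun p : PUnit × Tm D.toPreDilator A => p.2.bound)
          (by fun_prop)) (fun p x => Tm.exists_of_mem (α := p.2.bound))
          (.lt (F := fun p : (PUnit × Tm D.toPreDilator A) × Tm D.toPreDilator A => p.2.bound)
          (G := fun p : (PUnit × Tm D.toPreDilator A) × Tm D.toPreDilator A => p.1.2.bound)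
          (by fun_prop) (by fun_prop)) fun p z => ?_
      rw [ZFSet.mem_sep]
      constructor
      · rintro ⟨h1, s, h2, rfl⟩
        exact ⟨s, h1, h2, rfl⟩
      · rintro ⟨s, h1, h2, rfl⟩
        exact ⟨h1, s, h2, rfl⟩
    · intro _ t x
      rw [ZFSet.mem_sep]
      constructor
      · rintro ⟨h1, s, h2, rfl⟩
        exact ⟨s, h2, rfl⟩
      · rintro ⟨s, h2, rfl⟩
        exact ⟨enc_mem_tmSet.2 h2.le, s, h2, rfl⟩
    · have h2 : IsDelta A fun p : ((PUnit × Tm D.toPreDilator A) × Elem A) × Elem A =>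
          IsGoodStep p.1.1.2 p.1.2.1 := isDelta_isGoodStep.comp (F := fun p :
            ((PUnit × Tm D.toPreDilator A) × Elem A) × Elem A => (p.1.1.2, p.1.2)) (by fun_prop)
      exact ((h2.and (.eq (.val (by fun_prop)) (.const h0))).or
        (h2.not.and (.eq (.val (by fun_prop)) (.const empty_mem)))).1
    · intro _ t f hf
      simp only [isGoodStep_iff hf]
      split_ifs with h
      · exact ⟨h0, fun y => by simp [h]⟩
      · exact ⟨empty_mem, fun y => by simp [h]⟩
  refine (IsDelta.eq (h1.comp (G := fun g => (PUnit.unit, F g)) (by fun_prop))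
    (.const h0)).congr fun g => ?_
  dsimp only
  split_ifs with h
  · simp [h]
  · exact iff_of_false h singleton_empty_ne_empty.symm

end Admissible

/-! ### Unboundedness -/

namespace NormalDilator

open PreDilator

variable {D : NormalDilator.{u}}

theorem muOrd_eq_of_forall_lt {δ : Ordinal.{u}} (h0 : 0 < δ)
    (h : ∀ η < δ, ∃ ε, η < ε ∧ ε < δ ∧ D.muOrd ε ≤ δ) : D.muOrd δ = δ := by
  refine le_antisymm (le_of_forall_lt fun ξ hξ => ?_) (le_muOrd δ)
  obtain ⟨s, rfl⟩ := ord_surjective (D := D) ξ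
  have hb : s.bound < δ := by
    refine (Finset.sup_lt_iff (by simpa using h0)).2 fun i _ => ?_
    obtain ⟨ε, h1, h2, -⟩ := h _ (ord_lt_muOrd.1 hξ i)
    exact (Order.add_one_le_of_lt h1).trans_lt h2
  obtain ⟨ε, h1, -, h2⟩ := h _ hb
  exact (ord_lt_muOrd.2 (Term.bound_le_iff.1 h1.le)).trans_le h2

end NormalDilator

namespace Admissible

open PreDilator PreDilator.Term NormalDilator

variable {A : ZFSet.{u}} {D : NormalDilator.{u}}

variable [hA : Fact (IsAdmissible A)] [hD : Fact (D.code ∈ A)]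

/-- Whenever the term `s` with last argument `η` lies below the term that is obtained from `t` by
replacing the last argument by `η`, there is a `δ` with `η < δ < ε` such that replacing the last
argument of `s` by `δ` yields a good term. -/
def HasGoodBelow (t : Tm D.toPreDilator A) (η : Ord A) (s : Tm D.toPreDilator A) (ε : Ord A) :
    Prop :=
  s.1.HasTop η.1 → ∀ t' : Tm D.toPreDilator A,
    (Coded.enc (A := A) t').1 ∈ tmSet D.toPreDilator η.addOne.1 → t'.1.HasTop η.1 →
    t.1.Sim t'.1 → s.1.Lt t'.1 → ∃ s' : Tm D.toPreDilator A,
      (Coded.enc (A := A) s').1 ∈ tmSet D.toPreDilator ε.1 ∧ η.addOne.1 < s'.bound.1 ∧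
      s.1.Sim s'.1 ∧ Good s'.1

theorem isDelta_hasGoodBelow (t : Tm D.toPreDilator A) :
    IsDelta A fun p : (Ord A × Tm D.toPreDilator A) × Ord A =>
      HasGoodBelow t p.1.1 p.1.2 p.2 := by
  refine .imp (.hasTop (by fun_prop) (by fun_prop)) (.ball_enc (.tmSet (by fun_prop))
    (fun p _ => Tm.exists_of_mem (α := p.1.1.addOne)) (.imp (.hasTop (by fun_prop) (by fun_prop))
    (.imp (.sim (by fun_prop) (by fun_prop)) (.imp (.tm_lt (by fun_prop) (by fun_prop))
    (.bex_enc (.tmSet (by fun_prop)) (fun p _ => Tm.exists_of_mem (α := p.1.2))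
    (.and (.lt (by fun_prop) (by fun_prop)) (.and (.sim (by fun_prop) (by fun_prop))
    (.good (by fun_prop)))))))))

/-- The ordinal `ε` is closed under the operations that have to be iterated on `η`. -/
def IsNext (t : Tm D.toPreDilator A) (η ε : Ord A) : Prop :=
  η.1 < ε.1 ∧ (D.muOrd η.1).toZFSet ∈ (Coded.enc (A := A) ε).1 ∧
    ∀ s : Tm D.toPreDilator A, (Coded.enc (A := A) s).1 ∈ tmSet D.toPreDilator η.addOne.1 →
      HasGoodBelow t η s ε

theorem isDelta_isNext (t : Tm D.toPreDilator A) :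
    IsDelta A fun p : Ord A × Ord A => IsNext t p.1 p.2 :=
  .and (.lt (by fun_prop) (by fun_prop)) (.and (.mem (.muOrd (by fun_prop)) (.enc (by fun_prop)))
    (.ball_enc (.tmSet (by fun_prop)) (fun p _ => Tm.exists_of_mem (α := p.1.addOne))
      ((isDelta_hasGoodBelow t).comp (F := fun p : (Ord A × Ord A) × Tm D.toPreDilator A =>
        ((p.1.1, p.2), p.1.2)) (by fun_prop))))

theorem HasGoodBelow.mono {t : Tm D.toPreDilator A} {η : Ord A} {s : Tm D.toPreDilator A}
    {ε ε' : Ord A} (h : HasGoodBelow t η s ε) (hε : ε.1 ≤ ε'.1) : HasGoodBelow t η s ε' := by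
  intro h1 t' h2 h3 h4 h5
  obtain ⟨s', h6, h7⟩ := h h1 t' h2 h3 h4 h5
  exact ⟨s', enc_mem_tmSet.2 ((enc_mem_tmSet.1 h6).trans hε), h7⟩

/-- Collection over the terms `s` with last argument `η` yields a bound `ε`. The choice of the least
bound makes `ε` a `Σ`-function of `η`. -/
theorem exists_least_isNext {t : Tm D.toPreDilator A}
    (h : ∀ (η : Ord A) (s : Tm D.toPreDilator A), ∃ ε, HasGoodBelow t η s ε) (η : Ord A) :
    ∃ ε, IsNext t η ε ∧ ∀ ε', IsNext t η ε' → ε.1 ≤ ε'.1 := by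
  have hex : ∃ ε, IsNext t η ε := by
    obtain ⟨β, hβ⟩ := IsSigma.exists_bound (isDelta_hasGoodBelow t).1 η
      ((IsFun.tmSet (D := D.toPreDilator) (.id)).mem η.addOne)
      (fun x => Tm.exists_of_mem (α := η.addOne)) fun s _ => h η s
    have hmax : ∀ α α' : Ord A, ∃ ε : Ord A, α.1 ≤ ε.1 ∧ α'.1 ≤ ε.1 := by
      intro α α'
      rcases le_total α.1 α'.1 with h | h
      exacts [⟨α', h, le_rfl⟩, ⟨α, le_rfl, h⟩]
    obtain ⟨ε, h1, h2⟩ := hmax η.addOne β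
    obtain ⟨ε', h3, h4⟩ := hmax ε (Ord.addOne ⟨_, muOrd_mem D η⟩)
    refine ⟨ε', (Order.lt_add_one_iff.2 le_rfl).trans_le (h1.trans h3),
      Ordinal.toZFSet_mem_toZFSet_iff.2 ((Order.lt_add_one_iff.2 le_rfl).trans_le h4),
      fun s hs => ?_⟩
    obtain ⟨α, hα, h⟩ := hβ s hs
    exact h.mono (hα.le.trans (h2.trans h3))
  have hwf : WellFounded fun α β : Ord A => α.1 < β.1 := InvImage.wf Subtype.val Ordinal.lt_wf
  obtain ⟨ε, h1, h2⟩ := hwf.has_min {ε | IsNext t η ε} hex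
  exact ⟨ε, h1, fun ε' h => not_lt.1 (h2 ε' h)⟩

/-- The operation `IsNext` can be iterated, and the iteration does not lead out of the admissible
set. -/
theorem exists_isNext_seq {t : Tm D.toPreDilator A}
    (h : ∀ (η : Ord A) (s : Tm D.toPreDilator A), ∃ ε, HasGoodBelow t η s ε) (η : Ord A) :
    ∃ (e : ℕ → Ord A) (δ : Ordinal.{u}), e 0 = η ∧ (∀ n, IsNext t (e n) (e (n + 1))) ∧
      δ.toZFSet ∈ A ∧ (∀ n, (e n).1 < δ) ∧ ∀ ξ < δ, ∃ n, ξ < (e n).1 := by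
  choose H hH hH' using exists_least_isNext h
  have hHA : AFun A H := .of_least (isDelta_isNext t) hH hH'
  set e : ℕ → Ord A := fun n => Nat.rec η (fun _ => H) n with he
  have heA : AFun A fun p : PUnit × Idx.{u} => e p.2.val :=
    .nat_rec (B := fun _ => η) (H := fun p => H p.2) (by fun_prop) (by fun_prop) (fun _ => rfl)
      fun _ _ => rfl
  have hlt : ∀ ξ, ξ < ⨆ n, (e n).1 ↔ ∃ n, ξ < (e n).1 := fun ξ =>
    lt_ciSup_iff (Ordinal.bddAbove_of_small)
  refine ⟨e, ⨆ n, (e n).1, rfl, fun n => hH _, ?_, fun n => ?_, fun ξ => (hlt ξ).1⟩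
  · refine (IsFun.of_biUnion_enc (Γ := PUnit) (C := Idx.{u}) (F := fun _ => (⨆ n, (e n).1).toZFSet)
      (K := fun _ n => (Coded.enc (A := A) (e n.val)).1) (.const (omega_mem hD.out))
      (fun _ _ => Idx.exists_of_mem_omega) (.enc (by exact heA)) fun _ z => ?_).mem PUnit.unit
    constructor
    · intro hz
      obtain ⟨ξ, hξ, rfl⟩ := Ordinal.mem_toZFSet_iff.1 hz
      obtain ⟨n, hn⟩ := (hlt ξ).1 hξ
      exact ⟨⟨n⟩, Ordinal.toZFSet_mem_toZFSet_iff.2 (Ordinal.natCast_lt_omega0 n),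
        Ordinal.toZFSet_mem_toZFSet_iff.2 hn⟩
    · rintro ⟨n, -, hz⟩
      obtain ⟨ξ, hξ, rfl⟩ := Ordinal.mem_toZFSet_iff.1 hz
      exact Ordinal.toZFSet_mem_toZFSet_iff.2 ((hlt ξ).2 ⟨_, hξ⟩)
  · exact (hlt _).2 ⟨n + 1, (hH (e n)).1⟩

/-- The step of the induction that proves unboundedness. -/
theorem exists_good_setTop_of_forall_lt {Ω : Ordinal.{u}}
    (hΩ : ∀ α : Ordinal.{u}, α.toZFSet ∈ A ↔ α < Ω) {t : D.Term} (ht : t.HasTop Ω)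
    (ih : ∀ s : D.Term, s.Lt t → s.HasTop Ω → ∀ η < Ω,
      ∃ δ, η < δ ∧ δ < Ω ∧ ∃ hp, Good (s.setTop δ hp)) {η : Ordinal.{u}} (hη : η < Ω) :
    ∃ δ, η < δ ∧ δ < Ω ∧ ∃ hp, Good (t.setTop δ hp) := by
  have hΩ0 : 0 < Ω := zero_le.trans_lt hη
  obtain ⟨η', hη', hp'⟩ := ht.paramsLt.exists_lt hΩ0
  have hsucc : ∀ {α}, α < Ω → α + 1 < Ω := fun h => (hΩ _).1 (add_one_mem ((hΩ _).2 h))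
  -- above `b`, the parameters of `t` play no role
  set b : Ordinal.{u} := max η η' + 1 with hb
  have hbΩ : b < Ω := hsucc (max_lt hη hη')
  have hpb : t.ParamsLt b := fun i hi =>
    ((hp' i hi).trans (le_max_right η η')).trans_lt (Order.lt_add_one_iff.2 le_rfl)
  have htb := ht.setTop hpb
  set t₀ : Tm D.toPreDilator A := ⟨t.setTop b hpb, fun i =>
    Ord.mem_of_le ((hΩ _).2 hbΩ) (htb.args_le i)⟩ with ht₀
  have hex : ∀ (ε : Ord A) (s : Tm D.toPreDilator A), ∃ ε', HasGoodBelow t₀ ε s ε' := by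
    intro ε s
    have hεΩ := (hΩ _).1 ε.2
    by_cases h : s.1.HasTop ε.1 ∧ ∃ hp : t.ParamsLt ε.1, s.1.Lt (t.setTop ε.1 hp)
    · obtain ⟨hs, hp, hst⟩ := h
      have hsΩ := hs.paramsLt.mono hεΩ.le
      have hst' : (s.1.setTop Ω hsΩ).Lt t := by
        have h1 := (setTop_lt_setTop hs.paramsLt hp hsΩ ht.paramsLt).1 (by rwa [hs.setTop_self])
        rwa [ht.setTop_self] at h1
      obtain ⟨δ, h1, h2, hpδ, h3⟩ := ih _ hst' (hs.setTop hsΩ) ε.1 hεΩ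
      rw [setTop_setTop] at h3
      refine ⟨⟨δ + 1, (hΩ _).2 (hsucc h2)⟩, fun _ _ _ _ _ _ => ?_⟩
      exact (exists_sim_iff hs ((hΩ _).2 (hsucc h2))).2 ⟨δ, h1, Order.lt_add_one_iff.2 le_rfl, _, h3⟩
    · refine ⟨ε, fun hs t' _ ht' hsim hlt => absurd ⟨hs, ?_⟩ h⟩
      obtain ⟨hp, h1⟩ := hsim.eq_setTop ht'
      rw [h1, setTop_setTop] at hlt
      exact ⟨_, hlt⟩
  -- `δ` is the limit of the sequence `e` in `A`: the parameters of any `s < t[δ]` and any given bound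
  -- lie below some `e n`, and then a witness for `s[e n] < t[e n]` lies below `e (n + 1)`
  obtain ⟨e, δ, he0, he, hδA, heδ, hδe⟩ := exists_isNext_seq hex ⟨b, (hΩ _).2 hbΩ⟩
  have hbe : ∀ n, b ≤ (e n).1 := by
    intro n
    induction n with
    | zero => rw [he0]
    | succ n ih => exact ih.trans (he n).1.le
  have hbδ : b < δ := (hbe 0).trans_lt (heδ 0)
  have hp : t.ParamsLt δ := hpb.mono hbδ.le
  refine ⟨δ, (le_max_left η η').trans_lt ((Order.lt_add_one_iff.2 le_rfl).trans hbδ), (hΩ _).1 hδA,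
    hp, (good_iff (ht.setTop hp)).2 ⟨zero_le.trans_lt hbδ, ?_, fun s hst hs ξ hξ => ?_⟩⟩
  · refine muOrd_eq_of_forall_lt (zero_le.trans_lt hbδ) fun ξ hξ => ?_
    obtain ⟨n, hn⟩ := hδe ξ hξ
    exact ⟨_, hn, heδ n, (Ordinal.toZFSet_mem_toZFSet_iff.1 (he n).2.1).le.trans (heδ _).le⟩
  · obtain ⟨ζ, hζ, hsζ⟩ := hs.paramsLt.exists_lt (zero_le.trans_lt hbδ)
    obtain ⟨n, hn⟩ := hδe _ (max_lt hξ hζ)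
    have hsn : s.ParamsLt (e n).1 := fun i hi =>
      (hsζ i hi).trans_lt ((le_max_right ξ ζ).trans_lt hn)
    have htn : t.ParamsLt (e n).1 := hpb.mono (hbe n)
    have hsn' := hs.setTop hsn
    have htn' := ht.setTop htn
    have hmem : ∀ {r : D.Term} {α : Ord A}, r.HasTop α.1 → ∀ i, (r.args i).toZFSet ∈ A :=
      fun {r α} hr i => Ord.mem_of_le α.2 (hr.args_le i)
    have hlt : (s.setTop _ hsn).Lt (t.setTop _ htn) := by
      rw [← setTop_lt_setTop hs.paramsLt hp hsn htn, hs.setTop_self]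
      exact hst
    have h1 := (he n).2.2 ⟨s.setTop _ hsn, hmem hsn'⟩
      (enc_mem_tmSet.2 (hasTop_iff_bound_eq.1 hsn').le) hsn' ⟨t.setTop _ htn, hmem htn'⟩
      (enc_mem_tmSet.2 (hasTop_iff_bound_eq.1 htn').le) htn'
      ⟨_, (paramsLt_setTop hpb).2 htn, (setTop_setTop hpb _).symm⟩ hlt
    obtain ⟨δ', h2, h3, hp2, h4⟩ := (exists_sim_iff hsn' (e (n + 1)).2).1 h1
    rw [setTop_setTop] at h4
    exact ⟨δ', ((le_max_left ξ ζ).trans_lt hn).trans h2, h3.trans (heδ _), _, h4⟩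

theorem exists_good_setTop {Ω : Ordinal.{u}} (hΩ : ∀ α : Ordinal.{u}, α.toZFSet ∈ A ↔ α < Ω)
    (t : D.Term) (ht : t.HasTop Ω) (η : Ordinal.{u}) (hη : η < Ω) :
    ∃ δ, η < δ ∧ δ < Ω ∧ ∃ hp, Good (t.setTop δ hp) := by
  induction t using (termLt_wf (D := D)).induction generalizing η with
  | h t ih => exact exists_good_setTop_of_forall_lt hΩ ht ih hη

/-- The height of the admissible set is a fixed point of the normal function. -/
theorem muOrd_height {Ω : Ordinal.{u}} (hΩ : ∀ α : Ordinal.{u}, α.toZFSet ∈ A ↔ α < Ω) :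
    D.muOrd Ω = Ω := by
  have hsucc : ∀ {α}, α < Ω → α + 1 < Ω := fun h => (hΩ _).1 (add_one_mem ((hΩ _).2 h))
  refine muOrd_eq_of_forall_lt ((hΩ 0).1 (by simpa using natCast_mem (A := A) 0)) fun η hη => ?_
  exact ⟨η + 1, Order.lt_add_one_iff.2 le_rfl, hsucc hη,
    ((hΩ _).1 (muOrd_mem D ⟨_, (hΩ _).2 (hsucc hη)⟩)).le⟩

end Admissible

/-! ### The classes `C_D(γ)` in terms of terms, and their closedness -/

namespace NormalDilator

open PreDilator PreDilator.Term

variable {D : NormalDilator.{u}}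

theorem rep_ord_iff {t : D.Term} {s : D.Trace} {g : Fin s.1.1 → Ordinal.{u}} :
    D.Rep (ord t) s g ↔ ∃ hg : StrictMono g, t = ⟨s, g, hg⟩ := by
  rw [rep_iff]
  exact exists_congr fun _ => ord_inj.trans eq_comm

/-- The condition `γ* ≤ δ` says that `δ` may replace the last argument of the term that
denotes `γ`. -/
theorem star_ord_le_iff {t : D.Term} {δ : Ordinal.{u}} :
    D.star (ord t) ≤ δ ↔ t.ParamsLt δ := by
  have h : {ξ | ∃ (s : D.Trace) (g : Fin s.1.1 → Ordinal.{u}), D.Rep (ord t) s g ∧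
      ∃ i : Fin s.1.1, (i : ℕ) + 1 < s.1.1 ∧ ξ = g i + 1} =
      {ξ | ∃ i : Fin t.sym.1.1, (i : ℕ) + 1 < t.sym.1.1 ∧ ξ = t.args i + 1} := by
    ext ξ
    constructor
    · rintro ⟨s, g, hr, h⟩
      obtain ⟨hg, rfl⟩ := rep_ord_iff.1 hr
      exact h
    · exact fun h => ⟨t.sym, t.args, rep_ord_iff.2 ⟨t.strictMono, rfl⟩, h⟩
  rw [star, h, csSup_le_iff' ⟨t.bound, ?_⟩]
  · constructor
    · intro h i hi
      exact Order.add_one_le_iff.1 (h _ ⟨i, by have := i.2; omega, rfl⟩)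
    · rintro h _ ⟨i, hi, rfl⟩
      exact Order.add_one_le_of_lt (h i (by omega))
  · rintro _ ⟨i, -, rfl⟩
    exact Order.add_one_le_of_lt (t.lt_bound i)

/-- Under this condition, `γ[δ]` is a proper infimum, over a set with a single element. -/
theorem subst_ord {t : D.Term} {δ ε : Ordinal.{u}} (ht : t.HasTop ε) (h : t.ParamsLt δ) :
    D.subst (ord t) δ = ord (t.setTop δ h) := by
  have h1 : {ξ | D.IsSubst (ord t) δ ξ} = {ord (t.setTop δ h)} := by
    ext ξ
    rw [Set.mem_ofPred_eq, Set.mem_singleton_iff]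
    constructor
    · rintro ⟨s, g, hr, -, hr'⟩
      obtain ⟨hg, rfl⟩ := rep_ord_iff.1 hr
      obtain ⟨hg', rfl⟩ := rep_iff.1 hr'
      rfl
    · rintro rfl
      obtain ⟨i, -⟩ := ht
      exact ⟨t.sym, t.args, rep_ord_iff.2 ⟨t.strictMono, rfl⟩, i.pos,
        rep_iff.2 ⟨(t.setTop δ h).strictMono, rfl⟩⟩
  rw [subst, h1, csInf_singleton]

theorem mem_clubClass_ord_iff {t : D.Term} {δ ε : Ordinal.{u}} (ht : t.HasTop ε) :
    δ ∈ D.clubClass (ord t) ↔ ∃ h : t.ParamsLt δ, D.LeOne δ (ord (t.setTop δ h)) := by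
  rw [clubClass, Set.mem_ofPred_eq, star_ord_le_iff, ← exists_prop]
  exact exists_congr fun h => by rw [subst_ord ht h]

theorem muOrd_eq_of_leOne_ord {t : D.Term} {δ : Ordinal.{u}} (ht : t.HasTop δ)
    (h : D.LeOne δ (ord t)) : D.muOrd δ = δ := by
  rcases h.le.eq_or_lt with h1 | h1
  · exact le_antisymm ((hasTop_iff.1 ht).1.trans h1.ge) (le_muOrd δ)
  · exact muOrd_eq_of_leOne h h1

/-- Suprema of elements of `C_D(γ)` lie in `C_D(γ)`. Here the characterization of good terms makes
it possible to pass to the limit. -/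
theorem mem_clubClass_of_forall_lt {t : D.Term} {ε : Ordinal.{u}} (ht : t.HasTop ε)
    {X : Set Ordinal.{u}} (hX : X ⊆ D.clubClass (ord t)) (hne : X.Nonempty) {δ : Ordinal.{u}}
    (hδ : ∀ x ∈ X, x ≤ δ) (hlub : ∀ η < δ, ∃ x ∈ X, η < x) : δ ∈ D.clubClass (ord t) := by
  by_cases hmem : δ ∈ X
  · exact hX hmem
  have hlt : ∀ x ∈ X, x < δ := fun x hx => (hδ x hx).lt_of_ne fun h => hmem (h ▸ hx)
  obtain ⟨x₀, hx₀⟩ := hne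
  have h0 : 0 < δ := zero_le.trans_lt (hlt x₀ hx₀)
  obtain ⟨hp₀, -⟩ := (mem_clubClass_ord_iff ht).1 (hX hx₀)
  have hp := hp₀.mono (hlt x₀ hx₀).le
  have hμ : ∀ x ∈ X, D.muOrd x = x := by
    intro x hx
    obtain ⟨hpx, hL⟩ := (mem_clubClass_ord_iff ht).1 (hX hx)
    exact muOrd_eq_of_leOne_ord (ht.setTop hpx) hL
  suffices Good (t.setTop δ hp) by
    obtain ⟨δ', hδ', -, -, hL⟩ := this
    obtain rfl := hδ'.eq (ht.setTop hp)
    exact (mem_clubClass_ord_iff ht).2 ⟨hp, hL⟩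
  refine (good_iff (ht.setTop hp)).2 ⟨h0, muOrd_eq_of_forall_lt h0 fun η hη => ?_,
    fun s hst hs η hη => ?_⟩
  · obtain ⟨x, hx, hηx⟩ := hlub η hη
    exact ⟨x, hηx, hlt x hx, (hμ x hx).trans_le (hδ x hx)⟩
  · obtain ⟨ζ, hζ, hsζ⟩ := hs.paramsLt.exists_lt h0
    obtain ⟨x, hx, hηx⟩ := hlub _ (max_lt hη hζ)
    obtain ⟨hpx, hL⟩ := (mem_clubClass_ord_iff ht).1 (hX hx)
    have hsx : s.ParamsLt x := fun i hi =>
      (hsζ i hi).trans_lt ((le_max_right η ζ).trans_lt hηx)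
    have hlt' : (s.setTop x hsx).Lt (t.setTop x hpx) := by
      rw [← setTop_lt_setTop hs.paramsLt hp hsx hpx, hs.setTop_self]
      exact hst
    exact ⟨x, (le_max_left η ζ).trans_lt hηx, hlt x hx, hsx, x, hs.setTop hsx,
      zero_le.trans_lt hηx, hμ x hx,
      hL.mono_right (NormalDilator.Term.HasTop.le_ord (hs.setTop hsx)) (ord_lt_ord.2 hlt').le⟩

end NormalDilator

open NormalDilator in
theorem mainTheorem4 (D : NormalDilator.{u}) (A : ZFSet.{u}) (hA : IsAdmissible A)
    (hDA : D.code ∈ A) (Ω : Ordinal.{u}) (hΩ : ∀ α : Ordinal.{u}, α.toZFSet ∈ A ↔ α < Ω)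
    (γ : Ordinal.{u}) (hγ : γ < D.value (Ω + 1)) (hΩγ : Ω ≤ γ) :
    IsClub {δ : Set.Iio Ω | (δ : Ordinal.{u}) ∈ D.clubClass γ} := by
  have : Fact (IsAdmissible A) := ⟨hA⟩
  have : Fact (D.code ∈ A) := ⟨hDA⟩
  obtain ⟨t, rfl⟩ := ord_surjective (D := D) γ
  have ht : t.HasTop Ω :=
    hasTop_iff.2 ⟨(Admissible.muOrd_height hΩ).trans_le hΩγ, value_eq_muOrd (D := D) _ ▸ hγ⟩
  refine ⟨dirSupClosed_iff_of_linearOrder.2 fun d hd hne δ hδ => ?_, fun η => ?_⟩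
  · refine mem_clubClass_of_forall_lt ht (X := Subtype.val '' d) (Set.image_subset_iff.2 hd)
      (hne.image _) ?_ fun η hη => ?_
    · rintro _ ⟨x, hx, rfl⟩
      exact hδ.1 hx
    · obtain ⟨x, hx, hηx⟩ := (lt_isLUB_iff hδ).1 (show (⟨η, hη.trans δ.2⟩ : Set.Iio Ω) < δ from hη)
      exact ⟨x, ⟨x, hx, rfl⟩, hηx⟩
  · obtain ⟨δ, hηδ, hδ, hp, δ', hδ', -, -, hL⟩ := Admissible.exists_good_setTop hΩ t ht η η.2
    obtain rfl := hδ'.eq (ht.setTop hp)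
    exact ⟨⟨_, hδ⟩, (mem_clubClass_ord_iff ht).2 ⟨hp, hL⟩, hηδ.le⟩
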